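/- Let $\mu$ be a probability measure on $\mathbb{Z}$. Write $\mu^n$ for its $n$-fold convolution power and $\theta(t)=\sum_{k\in\mathbb{Z}}\mu(k)e^{2\pi i kt}$ for its Fourier transform. Assume: 1. $\sum_{k}|k|\,\mu(k)<\infty$. 2. $\mu$ has bounded angular ratio: the support of $\mu$ is not contained in a coset of a proper subgroup of $\mathbb{Z}$, and $$\sup_{t\in[-1/2,1/2),\,t\neq 0}\frac{|\theta(t)-1|}{1-|\theta(t)|}<\infty .$$ 3. For some $0<\alpha\le 1$, $\ \sum_{|k|\le n}k^2\mu(k)=O(n^{1-\alpha})$ as $n\to\infty$. 4. For some $\delta>0$, the second derivative $\theta''(t)$ exists whenever $0<|t|<\delta$, and there $\operatorname{Re}\theta''(t)<0$ and $\operatorname{Re}\theta''(t)=p(t)+O(1)$, where $p$ is a real-valued function that is non-decreasing on $(0,\delta)$ and the $O(1)$ term is a bounded function on $0<|t|<\delta$. (Nothing is required of the monotonicity of $p$ for $t<0$; as $\operatorname{Re}\theta''$ is even, one could equivalently ask that $p$ be non-decreasing as a function of $|t|$.) Then for every probability space $(X,\mathcal{B},\lambda)$, every invertible bimeasurable measure-preserving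 transformation $T:X\to X$ and every (real or complex) $f\in L^1(X)$, for $\lambda$-almost every $x$ the series $\mu^n f(x)=\sum_{k\in\mathbb{Z}}\mu^n(k)f(T^kx)$ converges absolutely for all $n$, and the sequence $\bigl(\mu^n f(x)\bigr)_{n}$ converges to a finite limit. -/

import Mathlib

open Filter Topology MeasureTheory

noncomputable section

namespace ConvPow

/-- The real weight `μ(k)` of a probability `μ` on `ℤ`. -/
def weight (μ : PMF ℤ) (k : ℤ) : ℝ := (μ k).toReal

/-- Convolution of two weight functions on `ℤ`: `(a * b)(k) = ∑_j a(j) b(k - j)`. -/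
def conv (a b : ℤ → ℝ) (k : ℤ) : ℝ := ∑' j : ℤ, a j * b (k - j)

/-- The weights of the `n`-fold convolution power `μⁿ`, where `μ⁰` is the unit mass at `0`
and `μⁿ⁺¹ = μ * μⁿ`. -/
def power (μ : PMF ℤ) : ℕ → ℤ → ℝ
  | 0 => Pi.single 0 1
  | n + 1 => conv (weight μ) (power μ n)

/-- The Fourier transform `θ(t) = ∑_k μ(k) exp(2πikt)`, as a function on `ℝ`. -/
def fourier (μ : PMF ℤ) (t : ℝ) : ℂ :=
  ∑' k : ℤ, (weight μ k : ℂ) * Complex.exp (2 * Real.pi * Complex.I * k * t)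

/-- `m₁(μ) < ∞`. -/
def FiniteFirstMoment (μ : PMF ℤ) : Prop :=
  Summable fun k : ℤ => |(k : ℝ)| * weight μ k

/-- The support of `μ` is not contained in a coset of a proper subgroup of `ℤ`. -/
def StrictlyAperiodic (μ : PMF ℤ) : Prop :=
  ∀ H : AddSubgroup ℤ, H ≠ ⊤ → ∀ a : ℤ, ¬ μ.support ⊆ {k : ℤ | k - a ∈ H}

/-- Bounded angular ratio: `μ` is strictly aperiodic and
`sup_{t ≠ 0} |θ(t) - 1| / (1 - |θ(t)|) < ∞`, with `t` in `[-1/2, 1/2)`. For a strictly aperiodic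
`μ` the denominators are positive, and every such quotient is at least `1`. -/
def BoundedAngularRatio (μ : PMF ℤ) : Prop :=
  StrictlyAperiodic μ ∧
    BddAbove ((fun t : ℝ => ‖fourier μ t - 1‖ / (1 - ‖fourier μ t‖)) ''
      {t : ℝ | t ∈ Set.Ico (-(1 / 2)) (1 / 2) ∧ t ≠ 0})

/-- The truncated second moment `∑_{|k| ≤ n} k² μ(k)`. -/
def truncSecondMoment (μ : PMF ℤ) (n : ℕ) : ℝ :=
  ∑ k ∈ Finset.Icc (-(n : ℤ)) (n : ℤ), (k : ℝ) ^ 2 * weight μ k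

/-- The terms `μⁿ(k) f(T^k x)`, `k ∈ ℤ`, of the series `μⁿ f(x)`. -/
def term {X 𝕜 : Type*} [RCLike 𝕜] (μ : PMF ℤ) (T : Equiv.Perm X) (f : X → 𝕜) (n : ℕ) (x : X)
    (k : ℤ) : 𝕜 :=
  (power μ n k : 𝕜) * f ((T ^ k) x)

/-- `μⁿ f(x) = ∑_k μⁿ(k) f(T^k x)`. -/
def average {X 𝕜 : Type*} [RCLike 𝕜] (μ : PMF ℤ) (T : Equiv.Perm X) (f : X → 𝕜) (n : ℕ)
    (x : X) : 𝕜 :=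
  ∑' k : ℤ, term μ T f n x k

end ConvPow

end

/-! Write κ(k) = k μ(k), Δu(x) = u(x+1) - u(x) and φ = 1 - Re θ. Everything rests on the kernel
bound x² |Δμⁿ(x)| ≤ C, uniform in n and x, together with ‖Δμⁿ‖₁ → 0. The first gives a weak type
(1,1) maximal inequality on ℤ by a Calderón–Zygmund decomposition (`weak_type_int`), which transfers
along orbits to the system (`measure_max_le`). The second gives convergence on invariant functions
plus bounded coboundaries, which are dense in L¹ (`exists_decomposition`); the maximal inequality
extends this to all of L¹.

The kernel bound. Since Re θ'' < 0 off 0 and θ' is continuous, φ is convex near 0 (`convexOn_phi`).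
The second moment of μ may be infinite, but convexity controls it locally: second differences of φ
are nonnegative, have coefficients comparable to k² μ(k), and integrate to a quantity governed by
φ(τ). Testing them against a modulated tent, whose cosine transform is a Fejér kernel, bounds the
sum of k² μ(k) over any window of length about 1/τ by φ(τ)/τ², up to a constant
(`sum_sq_weight_window_le`). Splitting κ at frequency 1/(2τ), and using the angular ratio to bound
the mean of θ' on [0,τ], gives ∫ |θ'|² ≲ φ(τ)²/τ over |t| ≤ τ (`integral_norm_sq_ft_mom_le`).

For each n ≥ 1 choose τ with n φ(τ) of order 1. The angular ratio gives |θ| ≤ exp(-φ/K), so |θ|ⁿ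
decays rapidly in |t|/τ (`exists_decay`), and the bounds above become weighted integrals of |θ|ᵐ and
|θ'|²|θ|ᵐ for m comparable to n (`exists_integral_le`). Because k μⁿ(k) = n (κ * μⁿ⁻¹)(k), two
applications of the product rule express x² Δμⁿ(x) through n ∑ k² μ(k) Δμⁿ⁻¹(x-k), n(n-1) κ*κ*Δμⁿ⁻²,
(x+1) μⁿ(x+1) and μⁿ(x+1). The last is at most 1; the two middle ones are estimated by Fourier
inversion, and the first, for which θ'' would be needed, in physical space by the window bound. Each
comes out as a power of n φ(τ) ≤ 1, up to constants. -/

namespace ConvPow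

/-! ### Characters, Fourier inversion and Parseval on ℤ. -/

/-- The character `t ↦ exp(2πikt)`. -/
noncomputable def char (k : ℤ) (t : ℝ) : ℂ :=
  Complex.exp (2 * Real.pi * Complex.I * k * t)

/-- The Fourier transform of a summable real sequence. -/
noncomputable def ft (h : ℤ → ℝ) (t : ℝ) : ℂ := ∑' k : ℤ, (h k : ℂ) * char k t

theorem fourier_eq_ft (μ : PMF ℤ) : fourier μ = ft (weight μ) := rfl

theorem char_eq (k : ℤ) (t : ℝ) :
    char k t = Complex.exp (((2 * Real.pi * k * t : ℝ) : ℂ) * Complex.I) := by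
  unfold char; congr 1; push_cast; ring

@[simp] theorem norm_char (k : ℤ) (t : ℝ) : ‖char k t‖ = 1 := by
  rw [char_eq, Complex.norm_exp_ofReal_mul_I]

theorem char_re (k : ℤ) (t : ℝ) : (char k t).re = Real.cos (2 * Real.pi * k * t) := by
  rw [char_eq, Complex.exp_ofReal_mul_I_re]

@[simp] theorem char_zero (t : ℝ) : char 0 t = 1 := by simp [char]

@[simp] theorem char_at_zero (k : ℤ) : char k 0 = 1 := by simp [char]

theorem char_add (k l : ℤ) (t : ℝ) : char (k + l) t = char k t * char l t := by
  unfold char; rw [← Complex.exp_add]; congr 1; push_cast; ring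

theorem char_neg (k : ℤ) (t : ℝ) : char (-k) t = starRingEnd ℂ (char k t) := by
  rw [char_eq, char_eq, ← Complex.exp_conj, map_mul, Complex.conj_ofReal, Complex.conj_I]
  congr 1; push_cast; ring

theorem char_sub (k l : ℤ) (t : ℝ) : char (k - l) t = char k t * starRingEnd ℂ (char l t) := by
  rw [sub_eq_add_neg, char_add, char_neg]

@[fun_prop] theorem continuous_char (k : ℤ) : Continuous (char k) := by
  unfold char; fun_prop

theorem hasDerivAt_char (k : ℤ) (t : ℝ) :
    HasDerivAt (char k) (2 * Real.pi * Complex.I * k * char k t) t := by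
  have h1 : HasDerivAt (fun t : ℝ => 2 * (Real.pi : ℂ) * Complex.I * k * (t : ℂ))
      (2 * Real.pi * Complex.I * k * 1) t :=
    (Complex.ofRealCLM.hasDerivAt (x := t)).const_mul _
  exact h1.cexp.congr_deriv (by simp only [char]; ring)

theorem integral_char (k : ℤ) :
    ∫ t in (-(1/2) : ℝ)..(1/2), char k t = if k = 0 then 1 else 0 := by
  split_ifs with h
  · subst h; norm_num
  · have hk : (2 * Real.pi * Complex.I * k : ℂ) ≠ 0 := by
      simp [Real.pi_ne_zero, h]
    have := integral_exp_mul_complex (a := -(1/2)) (b := 1/2) hk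
    unfold char
    rw [this]
    have e : Complex.exp (2 * Real.pi * Complex.I * k * ((1/2 : ℝ) : ℂ)) =
        Complex.exp (2 * Real.pi * Complex.I * k * ((-(1/2) : ℝ) : ℂ)) := by
      rw [Complex.exp_eq_exp_iff_exists_int]
      exact ⟨k, by push_cast; ring⟩
    rw [e, sub_self, zero_div]

theorem summable_ofReal_mul_char {h : ℤ → ℝ} (hh : Summable h) (t : ℝ) :
    Summable fun k => (h k : ℂ) * char k t :=
  Summable.of_norm_bounded hh.abs fun k => by simp

@[fun_prop] theorem continuous_ft {h : ℤ → ℝ} (hh : Summable h) : Continuous (ft h) :=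
  continuous_tsum (fun k => continuous_const.mul (continuous_char k)) hh.abs fun k t => by simp

theorem norm_ft_le {h : ℤ → ℝ} (hh : Summable h) (t : ℝ) : ‖ft h t‖ ≤ ∑' k, |h k| := by
  exact tsum_of_norm_bounded hh.abs.hasSum fun k => by simp

theorem ft_neg_arg (h : ℤ → ℝ) (t : ℝ) : ft h (-t) = starRingEnd ℂ (ft h t) := by
  unfold ft
  rw [← RCLike.conjCLE_apply, ContinuousLinearEquiv.map_tsum]
  refine tsum_congr fun k => ?_
  simp only [RCLike.conjCLE_apply, map_mul, Complex.conj_ofReal, ← char_neg]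
  congr 1
  unfold char; congr 1; push_cast; ring

theorem hasSum_integral_mul_ft {h : ℤ → ℝ} (hh : Summable h) {ρ : ℝ → ℂ} (hρ : Continuous ρ)
    (a b : ℝ) :
    HasSum (fun k => (h k : ℂ) * ∫ t in a..b, ρ t * char k t) (∫ t in a..b, ρ t * ft h t) := by
  have := intervalIntegral.hasSum_integral_of_dominated_convergence (μ := volume) (a := a) (b := b)
    (F := fun (k : ℤ) t => ρ t * ((h k : ℂ) * char k t)) (f := fun t => ρ t * ft h t)
    (fun k t => ‖ρ t‖ * |h k|)
    (fun k => by
      apply Continuous.aestronglyMeasurable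
      fun_prop)
    (fun k => Eventually.of_forall fun t _ => by simp)
    (Eventually.of_forall fun t _ => hh.abs.mul_left _)
    (by
      simp_rw [tsum_mul_left]
      apply Continuous.intervalIntegrable
      fun_prop)
    (Eventually.of_forall fun t _ => (summable_ofReal_mul_char hh t).hasSum.mul_left _)
  have e : (fun k => (h k : ℂ) * ∫ t in a..b, ρ t * char k t)
      = fun (k : ℤ) => ∫ t in a..b, ρ t * ((h k : ℂ) * char k t) := by
    ext k
    rw [← intervalIntegral.integral_const_mul]
    congr 1; ext t; ring
  rw [e]; exact this

theorem ft_inversion {h : ℤ → ℝ} (hh : Summable h) (k : ℤ) :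
    ∫ t in (-(1/2) : ℝ)..(1/2), char (-k) t * ft h t = h k := by
  refine (hasSum_integral_mul_ft hh (continuous_char (-k)) _ _).unique ?_
  have : ∀ l, (h l : ℂ) * ∫ t in (-(1/2) : ℝ)..(1/2), char (-k) t * char l t
      = if l = k then (h k : ℂ) else 0 := fun l => by
    simp_rw [← char_add]
    rw [integral_char]
    have : -k + l = 0 ↔ l = k := by omega
    simp only [this]
    split_ifs with hl
    · rw [hl, mul_one]
    · simp
  simp_rw [this]
  exact hasSum_ite_eq k _

/-- Turns the algebra of convolution into pointwise multiplication: commutativity, associativity and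
the difference rules below are all checked on transforms. -/
theorem ft_injective {a b : ℤ → ℝ} (ha : Summable a) (hb : Summable b) (h : ft a = ft b) :
    a = b := by
  ext k
  have h1 := ft_inversion ha k
  rw [h, ft_inversion hb k] at h1
  exact_mod_cast h1.symm

theorem abs_le_integral_ft {h : ℤ → ℝ} (hh : Summable h) (k : ℤ) :
    |h k| ≤ ∫ t in (-(1/2) : ℝ)..(1/2), ‖ft h t‖ := by
  have h1 := ft_inversion hh k
  have : |h k| = ‖(h k : ℂ)‖ := by simp
  rw [this, ← h1]
  refine (intervalIntegral.norm_integral_le_integral_norm (by norm_num)).trans ?_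
  simp

theorem hasSum_sq_integral {h : ℤ → ℝ} (hh : Summable h) :
    HasSum (fun k => h k ^ 2) (∫ t in (-(1/2) : ℝ)..(1/2), ‖ft h t‖ ^ 2) := by
  have h1 := hasSum_integral_mul_ft hh
    (ρ := fun t => starRingEnd ℂ (ft h t)) (by fun_prop) (-(1/2)) (1/2)
  have h2 : ∀ k, (h k : ℂ) * ∫ t in (-(1/2) : ℝ)..(1/2), starRingEnd ℂ (ft h t) * char k t
      = ((h k ^ 2 : ℝ) : ℂ) := fun k => by
    have : ∀ t, starRingEnd ℂ (ft h t) * char k t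
        = starRingEnd ℂ (char (-k) t * ft h t) := fun t => by
      rw [map_mul, char_neg, Complex.conj_conj, mul_comm]
    simp_rw [this]
    have e := ft_inversion hh k
    rw [intervalIntegral.intervalIntegral_eq_integral_uIoc] at e ⊢
    rw [integral_conj]
    have e2 := congrArg (starRingEnd ℂ) e
    rw [Complex.conj_ofReal] at e2
    simp only [Complex.real_smul, map_mul, Complex.conj_ofReal] at e2 ⊢
    rw [e2]; push_cast; ring
  simp_rw [h2] at h1
  have h3 : ∀ t, starRingEnd ℂ (ft h t) * ft h t = ((‖ft h t‖ ^ 2 : ℝ) : ℂ) := fun t => by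
    rw [mul_comm, Complex.mul_conj, Complex.normSq_eq_norm_sq]
  simp_rw [h3] at h1
  rw [intervalIntegral.integral_ofReal] at h1
  exact_mod_cast h1

/-! ### Convolution of summable sequences -/

theorem summable_conv_pair {a b : ℤ → ℝ} (ha : Summable a) (hb : Summable b) :
    Summable fun p : ℤ × ℤ => a p.2 * b (p.1 - p.2) := by
  have h := summable_mul_of_summable_norm (f := a) (g := b) ha.norm hb.norm
  let e : ℤ × ℤ ≃ ℤ × ℤ :=
    { toFun := fun p => (p.2, p.1 - p.2)
      invFun := fun p => (p.1 + p.2, p.1)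
      left_inv := fun p => by ext <;> simp
      right_inv := fun p => by ext <;> simp }
  exact (e.summable_iff (f := fun x : ℤ × ℤ => a x.1 * b x.2)).2 h

theorem summable_conv_term {a b : ℤ → ℝ} (ha : Summable a) {B : ℝ} (hb : ∀ k, |b k| ≤ B) (k : ℤ) :
    Summable fun j => a j * b (k - j) :=
  Summable.of_norm_bounded (ha.abs.mul_right B) fun j => by
    rw [norm_mul, Real.norm_eq_abs, Real.norm_eq_abs]
    exact mul_le_mul_of_nonneg_left (hb _) (abs_nonneg _)

theorem abs_le_tsum_abs {b : ℤ → ℝ} (hb : Summable b) (k : ℤ) : |b k| ≤ ∑' j, |b j| :=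
  hb.abs.le_tsum k fun _ _ => abs_nonneg _

theorem summable_conv_term_of_summable {a b : ℤ → ℝ} (ha : Summable a) (hb : Summable b) (k : ℤ) :
    Summable fun j => a j * b (k - j) :=
  summable_conv_term ha (abs_le_tsum_abs hb) k

theorem summable_conv {a b : ℤ → ℝ} (ha : Summable a) (hb : Summable b) : Summable (conv a b) :=
  (summable_conv_pair ha hb).prod

theorem conv_nonneg {a b : ℤ → ℝ} (ha : ∀ k, 0 ≤ a k) (hb : ∀ k, 0 ≤ b k) (k : ℤ) :
    0 ≤ conv a b k :=
  tsum_nonneg fun j => mul_nonneg (ha j) (hb _)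

theorem ft_conv {a b : ℤ → ℝ} (ha : Summable a) (hb : Summable b) (t : ℝ) :
    ft (conv a b) t = ft a t * ft b t := by
  have ha' := (summable_ofReal_mul_char ha t).norm
  have hb' := (summable_ofReal_mul_char hb t).norm
  unfold ft
  rw [tsum_mul_tsum_of_summable_norm ha' hb']
  let e : ℤ × ℤ ≃ ℤ × ℤ :=
    { toFun := fun p => (p.2, p.1 - p.2)
      invFun := fun p => (p.1 + p.2, p.1)
      left_inv := fun p => by ext <;> simp
      right_inv := fun p => by ext <;> simp }
  have hs := summable_mul_of_summable_norm ha' hb'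
  have hs2 : Summable fun p => (fun x : ℤ × ℤ => (a x.1 * char x.1 t : ℂ) * (b x.2 * char x.2 t)) (e p) :=
    (e.summable_iff).2 hs
  rw [← e.tsum_eq, hs2.tsum_prod]
  refine tsum_congr fun k => ?_
  unfold conv
  rw [Complex.ofReal_tsum, ← tsum_mul_right]
  refine tsum_congr fun j => ?_
  simp only [e, Equiv.coe_fn_mk]
  have : char k t = char j t * char (k - j) t := by rw [← char_add]; congr 1; ring
  rw [this]; push_cast; ring

theorem conv_comm {a b : ℤ → ℝ} (ha : Summable a) (hb : Summable b) : conv a b = conv b a :=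
  ft_injective (summable_conv ha hb) (summable_conv hb ha) <| by
    ext t; rw [ft_conv ha hb, ft_conv hb ha, mul_comm]

theorem conv_assoc {a b c : ℤ → ℝ} (ha : Summable a) (hb : Summable b) (hc : Summable c) :
    conv (conv a b) c = conv a (conv b c) :=
  ft_injective (summable_conv (summable_conv ha hb) hc) (summable_conv ha (summable_conv hb hc)) <| by
    ext t
    rw [ft_conv (summable_conv ha hb) hc, ft_conv ha hb, ft_conv ha (summable_conv hb hc),
      ft_conv hb hc, mul_assoc]

/-- Forward difference. -/
def diff (u : ℤ → ℝ) (x : ℤ) : ℝ := u (x + 1) - u x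

/-- First moment sequence `k ↦ k u(k)`. -/
def mom (u : ℤ → ℝ) (k : ℤ) : ℝ := (k : ℝ) * u k

theorem summable_shift {u : ℤ → ℝ} (hu : Summable u) (c : ℤ) : Summable fun x => u (x + c) :=
  ((Equiv.addRight c).summable_iff (f := u)).2 hu

theorem summable_diff {u : ℤ → ℝ} (hu : Summable u) : Summable (diff u) :=
  (summable_shift hu 1).sub hu

theorem ft_diff {u : ℤ → ℝ} (hu : Summable u) (t : ℝ) :
    ft (diff u) t = (char (-1) t - 1) * ft u t := by
  have h1 : ∑' k, (u (k + 1) : ℂ) * char k t = char (-1) t * ft u t := by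
    unfold ft
    rw [← tsum_mul_left, ← (Equiv.addRight (1 : ℤ)).tsum_eq (fun k => char (-1) t * ((u k : ℂ) * char k t))]
    refine tsum_congr fun k => ?_
    simp only [Equiv.coe_addRight]
    have : char k t = char (-1) t * char (k + 1) t := by rw [← char_add]; congr 1; ring
    rw [this]; ring
  rw [sub_mul, one_mul, ← h1]
  unfold ft diff
  rw [← (summable_ofReal_mul_char (summable_shift hu 1) t).tsum_sub (summable_ofReal_mul_char hu t)]
  refine tsum_congr fun k => ?_
  push_cast; ring

theorem diff_conv {a b : ℤ → ℝ} (ha : Summable a) (hb : Summable b) :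
    diff (conv a b) = conv (diff a) b := by
  refine ft_injective (summable_diff (summable_conv ha hb)) (summable_conv (summable_diff ha) hb) ?_
  ext t
  rw [ft_diff (summable_conv ha hb), ft_conv ha hb, ft_conv (summable_diff ha) hb, ft_diff ha,
    mul_assoc]

/-- The Leibniz rule for θ ↦ θ', on the side of the coefficients: k = j + (k - j) inside the
convolution sum. -/
theorem mom_conv {a b : ℤ → ℝ} (ha : Summable a) (hb : Summable b)
    (ha' : Summable (mom a)) (hb' : Summable (mom b)) :
    mom (conv a b) = conv (mom a) b + conv a (mom b) := by
  ext k
  change (k : ℝ) * ∑' j, a j * b (k - j) = ∑' j, mom a j * b (k - j) + ∑' j, a j * mom b (k - j)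
  rw [← tsum_mul_left, ← (summable_conv_term_of_summable ha' hb k).tsum_add (summable_conv_term_of_summable ha hb' k)]
  refine tsum_congr fun j => ?_
  simp only [mom]; push_cast; ring

/-! ### Convolution powers -/

theorem weight_nonneg (μ : PMF ℤ) (k : ℤ) : 0 ≤ weight μ k := ENNReal.toReal_nonneg

theorem hasSum_weight (μ : PMF ℤ) : HasSum (weight μ) 1 := by
  have h := ENNReal.hasSum_toReal (f := fun k => μ k) (by rw [μ.tsum_coe]; simp)
  have h2 : ∑' k, (μ k).toReal = 1 := by
    rw [← ENNReal.tsum_toReal_eq (fun k => μ.apply_ne_top k), μ.tsum_coe]; simp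
  rw [h2] at h
  exact h

theorem summable_weight (μ : PMF ℤ) : Summable (weight μ) := (hasSum_weight μ).summable

theorem power_nonneg (μ : PMF ℤ) (n : ℕ) (k : ℤ) : 0 ≤ power μ n k := by
  induction n generalizing k with
  | zero => simp only [power, Pi.single_apply]; split_ifs <;> norm_num
  | succ n ih => exact conv_nonneg (weight_nonneg μ) ih k

theorem summable_power (μ : PMF ℤ) (n : ℕ) : Summable (power μ n) := by
  induction n with
  | zero => exact (hasSum_pi_single 0 1).summable
  | succ n ih => exact summable_conv (summable_weight μ) ih

theorem ft_power (μ : PMF ℤ) (n : ℕ) (t : ℝ) : ft (power μ n) t = fourier μ t ^ n := by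
  induction n with
  | zero =>
    unfold ft
    rw [tsum_eq_single 0]
    · simp [power]
    · intro k hk; simp [power, hk]
  | succ n ih =>
    simp only [power]
    rw [ft_conv (summable_weight μ) (summable_power μ n), ih, pow_succ', fourier_eq_ft]

theorem tsum_power (μ : PMF ℤ) (n : ℕ) : ∑' k, power μ n k = 1 := by
  have h := ft_power μ n 0
  have h1 : fourier μ 0 = 1 := by
    rw [fourier_eq_ft]; unfold ft
    simp only [char_at_zero, mul_one, ← Complex.ofReal_tsum, (hasSum_weight μ).tsum_eq]
    simp
  rw [h1, one_pow] at h
  unfold ft at h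
  simp only [char_at_zero, mul_one, ← Complex.ofReal_tsum] at h
  exact_mod_cast h

theorem power_le_one (μ : PMF ℤ) (n : ℕ) (k : ℤ) : power μ n k ≤ 1 := by
  rw [← tsum_power μ n]
  exact (summable_power μ n).le_tsum k fun j _ => power_nonneg μ n j

theorem power_add (μ : PMF ℤ) (m n : ℕ) : power μ (m + n) = conv (power μ m) (power μ n) := by
  refine ft_injective (summable_power μ _) (summable_conv (summable_power μ m) (summable_power μ n)) ?_
  ext t
  rw [ft_conv (summable_power μ m) (summable_power μ n), ft_power, ft_power, ft_power, pow_add]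

variable {μ : PMF ℤ}

theorem summable_mom_weight (hm : FiniteFirstMoment μ) : Summable (mom (weight μ)) := by
  refine Summable.of_norm_bounded hm fun k => ?_
  simp [mom, abs_of_nonneg (weight_nonneg μ k)]

theorem mom_power_zero : mom (power μ 0) = 0 := by
  ext k; by_cases hk : k = 0 <;> simp [mom, power, hk]

theorem power_succ (n : ℕ) : power μ (n + 1) = conv (weight μ) (power μ n) := rfl

theorem conv_smul (c : ℝ) (a b : ℤ → ℝ) : conv a (fun k => c * b k) = fun k => c * conv a b k := by
  ext k
  simp only [conv]
  rw [← tsum_mul_left]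
  exact tsum_congr fun j => by ring

/-- The coefficient form of (θⁿ⁺¹)' = (n+1) θ' θⁿ. It trades a factor k against a factor n and one
convolution with k μ(k). -/
theorem mom_power_succ (hm : FiniteFirstMoment μ) (n : ℕ) :
    mom (power μ (n + 1)) = fun k => ((n : ℝ) + 1) * conv (mom (weight μ)) (power μ n) k := by
  have hκ := summable_mom_weight hm
  have hw := summable_weight μ
  induction n with
  | zero =>
    rw [power_succ, mom_conv hw (summable_power μ 0) hκ
      (by rw [mom_power_zero]; exact summable_zero), mom_power_zero]
    ext k; simp [conv]
  | succ n ih =>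
    have hp := summable_power μ n
    have hc := summable_conv hκ hp
    have hs : Summable (mom (power μ (n + 1))) := by
      rw [ih]; exact hc.mul_left _
    have h2 : conv (weight μ) (conv (mom (weight μ)) (power μ n))
        = conv (mom (weight μ)) (power μ (n + 1)) := by
      rw [power_succ, ← conv_assoc hκ hw hp, conv_comm hκ hw, conv_assoc hw hκ hp]
    rw [power_succ, mom_conv hw (summable_power μ (n + 1)) hκ hs, ih, conv_smul, h2]
    ext k
    simp only [Pi.add_apply]
    push_cast; ring

theorem summable_mom_power (hm : FiniteFirstMoment μ) (n : ℕ) : Summable (mom (power μ n)) := by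
  cases n with
  | zero => rw [mom_power_zero]; exact summable_zero
  | succ n =>
    rw [mom_power_succ hm]
    exact (summable_conv (summable_mom_weight hm) (summable_power μ n)).mul_left _

/-! ### The derivative of θ and the function φ. -/

theorem hasDerivAt_fourier (hm : FiniteFirstMoment μ) (t : ℝ) :
    HasDerivAt (fourier μ) (2 * Real.pi * Complex.I * ft (mom (weight μ)) t) t := by
  have h := hasDerivAt_tsum (g := fun (k : ℤ) (t : ℝ) => (weight μ k : ℂ) * char k t)
    (g' := fun (k : ℤ) (t : ℝ) => (weight μ k : ℂ) * (2 * Real.pi * Complex.I * k * char k t))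
    (u := fun k : ℤ => 2 * Real.pi * (|(k : ℝ)| * weight μ k)) (y₀ := 0)
    (hm.mul_left _) (fun k t => (hasDerivAt_char k t).const_mul _)
    (fun k t => by
      simp [abs_of_nonneg (weight_nonneg μ k), abs_of_nonneg Real.pi_pos.le]
      apply le_of_eq; ring)
    (summable_ofReal_mul_char (summable_weight μ) 0) t
  have e : 2 * Real.pi * Complex.I * ft (mom (weight μ)) t
      = ∑' k : ℤ, (weight μ k : ℂ) * (2 * Real.pi * Complex.I * k * char k t) := by
    unfold ft
    rw [← tsum_mul_left]
    refine tsum_congr fun k => ?_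
    simp [mom]; ring
  rw [e]; exact h

theorem one_sub_cos_nonneg (x : ℝ) : 0 ≤ 1 - Real.cos x := by linarith [Real.cos_le_one x]

theorem eight_mul_sq_le_one_sub_cos {s : ℝ} (hs : |s| ≤ 1 / 2) :
    8 * s ^ 2 ≤ 1 - Real.cos (2 * Real.pi * s) := by
  have hπ := Real.pi_pos
  have h : |2 * Real.pi * s| ≤ Real.pi := by
    rw [abs_mul, abs_of_pos (by positivity)]; nlinarith
  have h1 := Real.cos_le_one_sub_mul_cos_sq h
  have h2 : 2 / Real.pi ^ 2 * (2 * Real.pi * s) ^ 2 = 8 * s ^ 2 := by field_simp; ring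
  linarith

/-- Since 1 - cos x = 2 sin²(x/2), this is the square of |sin(Ny)| ≤ N |sin y|. Summed against μ it
gives the doubling property of φ, valid without convexity. -/
theorem one_sub_cos_nat_mul_le (N : ℕ) (x : ℝ) :
    1 - Real.cos (N * x) ≤ N ^ 2 * (1 - Real.cos x) := by
  have key : ∀ y : ℝ, |Real.sin (N * y)| ≤ N * |Real.sin y| := by
    intro y
    induction N with
    | zero => simp
    | succ n ih =>
      have e : ((n + 1 : ℕ) : ℝ) * y = n * y + y := by push_cast; ring
      rw [e, Real.sin_add]
      calc |Real.sin (n * y) * Real.cos y + Real.cos (n * y) * Real.sin y|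
          ≤ |Real.sin (n * y)| * |Real.cos y| + |Real.cos (n * y)| * |Real.sin y| := by
            rw [← abs_mul, ← abs_mul]; exact abs_add_le _ _
        _ ≤ |Real.sin (n * y)| * 1 + 1 * |Real.sin y| := by
            gcongr <;> exact Real.abs_cos_le_one _
        _ ≤ ((n + 1 : ℕ) : ℝ) * |Real.sin y| := by push_cast; linarith
  have half : ∀ y : ℝ, 1 - Real.cos y = 2 * Real.sin (y / 2) ^ 2 := fun y => by
    have h1 := Real.cos_sq' (y / 2)
    have h2 := Real.cos_sq (y / 2)
    rw [mul_div_cancel₀ y two_ne_zero] at h2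
    linarith
  rw [half, half, mul_div_assoc]
  have := pow_le_pow_left₀ (abs_nonneg _) (key (x / 2)) 2
  rw [mul_pow, sq_abs, sq_abs] at this
  linarith

/-- `φ(t) = 1 - Re θ(t)`. -/
noncomputable def phi (μ : PMF ℤ) (t : ℝ) : ℝ := 1 - (fourier μ t).re

theorem hasSum_ft_re {g : ℤ → ℝ} (hg : Summable g) (t : ℝ) :
    HasSum (fun k => g k * Real.cos (2 * Real.pi * k * t)) (ft g t).re := by
  have := Complex.hasSum_re (summable_ofReal_mul_char hg t).hasSum
  simpa [Complex.re_ofReal_mul, char_re, ft] using this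

theorem hasSum_integral_mul_ft_re {g : ℤ → ℝ} (hg : Summable g) {ρ : ℝ → ℝ} (hρ : Continuous ρ)
    (a b : ℝ) :
    HasSum (fun k : ℤ => g k * ∫ t in a..b, ρ t * Real.cos (2 * Real.pi * k * t))
      (∫ t in a..b, ρ t * (ft g t).re) := by
  have h := Complex.hasSum_re (hasSum_integral_mul_ft hg (ρ := fun t => (ρ t : ℂ)) (by fun_prop) a b)
  have comm : ∀ u : ℝ → ℂ, Continuous u →
      (∫ t in a..b, (ρ t : ℂ) * u t).re = ∫ t in a..b, ρ t * (u t).re := fun u hu => by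
    have := Complex.reCLM.intervalIntegral_comp_comm (μ := volume) (a := a) (b := b)
      (f := fun t => (ρ t : ℂ) * u t) ((by fun_prop : Continuous _).intervalIntegrable _ _)
    simp only [Complex.reCLM_apply, Complex.re_ofReal_mul] at this
    exact this.symm
  simp only [Complex.re_ofReal_mul] at h
  rw [comm _ (continuous_ft hg)] at h
  simpa only [comm _ (continuous_char _), char_re] using h

theorem hasSum_phi (t : ℝ) :
    HasSum (fun k : ℤ => weight μ k * (1 - Real.cos (2 * Real.pi * k * t))) (phi μ t) := by
  have := (hasSum_weight μ).sub (hasSum_ft_re (summable_weight μ) t)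
  simpa [phi, fourier_eq_ft, mul_sub] using this

theorem phi_term_nonneg (k : ℤ) (t : ℝ) :
    0 ≤ weight μ k * (1 - Real.cos (2 * Real.pi * k * t)) :=
  mul_nonneg (weight_nonneg μ k) (one_sub_cos_nonneg _)

theorem phi_nonneg (t : ℝ) : 0 ≤ phi μ t := (hasSum_phi t).nonneg fun k => phi_term_nonneg k t

theorem phi_le_two (t : ℝ) : phi μ t ≤ 2 := by
  have h := hasSum_le (fun k : ℤ => (by
    have := Real.neg_one_le_cos (2 * Real.pi * k * t)
    nlinarith [weight_nonneg μ k] :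
      weight μ k * (1 - Real.cos (2 * Real.pi * k * t)) ≤ weight μ k * 2)) (hasSum_phi t)
      ((hasSum_weight μ).mul_right 2)
  linarith

theorem phi_zero : phi μ 0 = 0 := by
  refine (hasSum_phi (μ := μ) 0).unique ?_
  simp [hasSum_zero]

theorem phi_neg (t : ℝ) : phi μ (-t) = phi μ t := by
  simp [phi, fourier_eq_ft, ft_neg_arg]

theorem phi_nat_mul_le (N : ℕ) (t : ℝ) : phi μ (N * t) ≤ N ^ 2 * phi μ t := by
  refine hasSum_le (fun k => ?_) (hasSum_phi (N * t)) ((hasSum_phi t).mul_left ((N : ℝ) ^ 2))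
  have h := one_sub_cos_nat_mul_le N (2 * Real.pi * k * t)
  have e : 2 * Real.pi * k * (N * t) = N * (2 * Real.pi * k * t) := by ring
  rw [e]
  nlinarith [weight_nonneg μ k]

@[fun_prop] theorem continuous_fourier : Continuous (fourier μ) := by
  rw [fourier_eq_ft]; exact continuous_ft (summable_weight μ)

@[fun_prop] theorem continuous_phi : Continuous (phi μ) := by
  unfold phi; fun_prop

/-! ### Consequences of convexity -/

section Convex

variable {δ : ℝ} (hconv : ConvexOn ℝ (Set.Ioo (-δ) δ) (phi μ))
include hconv

/-- Convexity and φ(0) = 0 make φ(t)/t non-decreasing on (0, δ). -/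
theorem phi_mul_le_mul_phi {s t : ℝ} (hs : 0 ≤ s) (hst : s ≤ t) (ht : t < δ) :
    t * phi μ s ≤ s * phi μ t := by
  rcases hs.eq_or_lt with rfl | hs
  · simp [phi_zero]
  have ht0 : 0 < t := hs.trans_le hst
  have h := hconv.2 (Set.mem_Ioo.2 ⟨by linarith, ht⟩ : t ∈ _) (Set.mem_Ioo.2 ⟨by linarith, by linarith⟩ : (0 : ℝ) ∈ _)
    (show 0 ≤ s / t by positivity) (show 0 ≤ 1 - s / t by rw [sub_nonneg, div_le_one ht0]; exact hst)
    (by ring)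
  simp only [smul_eq_mul, mul_zero, add_zero, phi_zero, div_mul_cancel₀ s ht0.ne'] at h
  calc t * phi μ s ≤ t * (s / t * phi μ t) := by gcongr
    _ = s * phi μ t := by field_simp

theorem phi_mono {s t : ℝ} (hs : 0 ≤ s) (hst : s ≤ t) (ht : t < δ) : phi μ s ≤ phi μ t := by
  rcases (hs.trans hst).eq_or_lt with h0 | h0
  · have : s = t := by linarith
    rw [this]
  have h := phi_mul_le_mul_phi hconv hs hst ht
  have : s * phi μ t ≤ t * phi μ t := mul_le_mul_of_nonneg_right hst (phi_nonneg t)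
  exact le_of_mul_le_mul_left (h.trans this) h0

theorem phi_abs_le {τ t : ℝ} (ht : |t| ≤ τ) (hτ : τ < δ) : phi μ t ≤ phi μ τ := by
  have : phi μ t = phi μ |t| := by
    rcases abs_cases t with ⟨h, _⟩ | ⟨h, _⟩ <;> rw [h]
    rw [phi_neg]
  rw [this]
  exact phi_mono hconv (abs_nonneg t) ht hτ

theorem phi_second_difference_nonneg {t h : ℝ} (hh : 0 ≤ h) (ht : |t| + h < δ) :
    0 ≤ phi μ (t + h) + phi μ (t - h) - 2 * phi μ t := by
  have h1 := neg_abs_le t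
  have h2 := le_abs_self t
  have := hconv.2 (Set.mem_Ioo.2 ⟨by linarith, by linarith⟩ : t + h ∈ _)
    (Set.mem_Ioo.2 ⟨by linarith, by linarith⟩ : t - h ∈ _)
    (show (0 : ℝ) ≤ 1 / 2 by norm_num) (show (0 : ℝ) ≤ 1 / 2 by norm_num) (by norm_num)
  simp only [smul_eq_mul] at this
  rw [show 1 / 2 * (t + h) + 1 / 2 * (t - h) = t by ring] at this
  linarith

/-- Slopes of a convex function increase, so the slope on [u, v] is at most that on [v, 4τ]. The
latter is at most φ(4τ)/(2τ), and φ(4τ) ≤ 16 φ(τ). -/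
theorem phi_sub_le {τ u v : ℝ} (hτ : 0 < τ) (hτδ : 4 * τ < δ) (hu : -(2 * τ) ≤ u) (huv : u ≤ v)
    (hv : v ≤ 2 * τ) : phi μ v - phi μ u ≤ 8 * phi μ τ / τ * (v - u) := by
  rcases huv.eq_or_lt with rfl | huv
  · simp
  have h := hconv.slope_mono_adjacent (x := u) (y := v) (z := 4 * τ)
    ⟨by linarith, by linarith⟩ ⟨by linarith, by linarith⟩ huv (by linarith)
  have h4 : phi μ (4 * τ) ≤ 16 * phi μ τ := by
    have := phi_nat_mul_le (μ := μ) 4 τ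
    norm_num at this; exact this
  have h5 : (phi μ (4 * τ) - phi μ v) / (4 * τ - v) ≤ 8 * phi μ τ / τ := by
    rw [div_le_div_iff₀ (by linarith) hτ]
    have := phi_nonneg (μ := μ) v
    have := phi_nonneg (μ := μ) τ
    nlinarith
  have := h.trans h5
  rwa [div_le_iff₀ (by linarith)] at this

/-- The integral telescopes: only first differences on two intervals of length h, at the ends ±τ,
survive. Each is bounded by the slope 8φ(τ)/τ times h, on the left after reflection by evenness. -/
theorem integral_second_difference_le {τ h : ℝ} (hτ : 0 < τ) (hτδ : 4 * τ < δ) (hh : 0 ≤ h)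
    (hhτ : h ≤ τ) :
    ∫ t in (-τ)..τ, (phi μ (t + h) + phi μ (t - h) - 2 * phi μ t) ≤ 16 * phi μ τ / τ * h ^ 2 := by
  have hc := continuous_phi (μ := μ)
  have ii : ∀ a b : ℝ, IntervalIntegrable (fun u => phi μ (u + h) - phi μ u) volume a b :=
    fun a b => (by fun_prop : Continuous fun u => phi μ (u + h) - phi μ u).intervalIntegrable _ _
  have e1 : ∫ t in (-τ)..τ, (phi μ (t + h) + phi μ (t - h) - 2 * phi μ t)
      = (∫ t in (-τ)..τ, (phi μ (t + h) - phi μ t))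
        - ∫ t in (-τ - h)..(τ - h), (phi μ (t + h) - phi μ t) := by
    rw [← intervalIntegral.integral_comp_sub_right (fun t => phi μ (t + h) - phi μ t) h,
      ← intervalIntegral.integral_sub (ii _ _)
        ((by fun_prop : Continuous fun u => phi μ (u - h + h) - phi μ (u - h)).intervalIntegrable _ _)]
    congr 1; ext t; rw [sub_add_cancel]; ring
  have e2 : (∫ t in (-τ)..τ, (phi μ (t + h) - phi μ t))
        - ∫ t in (-τ - h)..(τ - h), (phi μ (t + h) - phi μ t)
      = (∫ t in (τ - h)..τ, (phi μ (t + h) - phi μ t))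
        - ∫ t in (-τ - h)..(-τ), (phi μ (t + h) - phi μ t) := by
    have a1 := intervalIntegral.integral_add_adjacent_intervals (ii (-τ) (τ - h)) (ii (τ - h) τ)
    have a2 := intervalIntegral.integral_add_adjacent_intervals (ii (-τ - h) (-τ)) (ii (-τ) (τ - h))
    linarith
  have b1 : ∫ t in (τ - h)..τ, (phi μ (t + h) - phi μ t)
      ≤ ∫ _ in (τ - h)..τ, 8 * phi μ τ / τ * h := by
    refine intervalIntegral.integral_mono_on (by linarith) (ii _ _) (by simp) fun t ht => ?_
    have := phi_sub_le hconv hτ hτδ (u := t) (v := t + h) (by linarith [ht.1]) (by linarith)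
      (by linarith [ht.2])
    simpa using this
  have b2 : ∫ _ in (-τ - h)..(-τ), -(8 * phi μ τ / τ * h)
      ≤ ∫ t in (-τ - h)..(-τ), (phi μ (t + h) - phi μ t) := by
    refine intervalIntegral.integral_mono_on (by linarith) (by simp) (ii _ _) fun t ht => ?_
    have := phi_sub_le hconv hτ hτδ (u := -(t + h)) (v := -t) (by linarith [ht.2]) (by linarith)
      (by linarith [ht.1])
    rw [phi_neg, phi_neg] at this
    have e : -t - -(t + h) = h := by ring
    rw [e] at this
    linarith
  rw [e1, e2]
  simp only [intervalIntegral.integral_const, smul_eq_mul] at b1 b2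
  have e3 : (τ - (τ - h)) * (8 * phi μ τ / τ * h) - (-τ - (-τ - h)) * -(8 * phi μ τ / τ * h)
      = 16 * phi μ τ / τ * h ^ 2 := by ring
  linarith

end Convex

/-! ### The Fejér kernel -/

/-- The tent of half-width `τ`. -/
noncomputable def tent (τ t : ℝ) : ℝ := 1 - |t| / τ

@[fun_prop] theorem continuous_tent (τ : ℝ) : Continuous (tent τ) := by unfold tent; fun_prop

/-- The cosine transform of the tent of half-width `τ`. -/
noncomputable def fejer (τ : ℝ) (m : ℤ) : ℝ :=
  ∫ t in (-τ)..τ, tent τ t * Real.cos (2 * Real.pi * m * t)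

theorem integral_eq_two_mul_of_even {f : ℝ → ℝ} (hf : Continuous f) (he : ∀ t, f (-t) = f t)
    (τ : ℝ) : ∫ t in (-τ)..τ, f t = 2 * ∫ t in (0 : ℝ)..τ, f t := by
  rw [← intervalIntegral.integral_add_adjacent_intervals (hf.intervalIntegrable (-τ) 0)
    (hf.intervalIntegrable 0 τ)]
  have : ∫ t in (-τ)..0, f t = ∫ t in (0 : ℝ)..τ, f t := by
    have := intervalIntegral.integral_comp_neg (a := 0) (b := τ) f
    simp only [he, neg_zero] at this
    exact this.symm
  rw [this]; ring

theorem fejer_zero {τ : ℝ} (hτ : 0 < τ) : fejer τ 0 = τ := by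
  unfold fejer
  rw [integral_eq_two_mul_of_even (by fun_prop) (fun t => by simp [tent])]
  have h : ∀ t ∈ Set.uIcc 0 τ, HasDerivAt (fun t : ℝ => t - t ^ 2 / (2 * τ)) (tent τ t *
      Real.cos (2 * Real.pi * ((0 : ℤ) : ℝ) * t)) t := fun t ht => by
    rw [Set.uIcc_of_le hτ.le] at ht
    have := (hasDerivAt_id t).sub (((hasDerivAt_id t).pow 2).div_const (2 * τ))
    refine this.congr_deriv ?_
    simp [tent, abs_of_nonneg ht.1]; field_simp
  rw [intervalIntegral.integral_eq_sub_of_hasDerivAt h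
    ((by fun_prop : Continuous _).intervalIntegrable _ _)]
  field_simp; ring

theorem fejer_eq {τ : ℝ} (hτ : 0 < τ) {m : ℤ} (hm : m ≠ 0) :
    fejer τ m = (1 - Real.cos (2 * Real.pi * (m * τ))) / (2 * Real.pi ^ 2 * m ^ 2 * τ) := by
  unfold fejer
  rw [integral_eq_two_mul_of_even (by fun_prop) (fun t => by simp [tent])]
  have hm' : (m : ℝ) ≠ 0 := by exact_mod_cast hm
  set a : ℝ := 2 * Real.pi * m with ha
  have ha0 : a ≠ 0 := by simp [ha, Real.pi_ne_zero, hm']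
  have h : ∀ t ∈ Set.uIcc 0 τ, HasDerivAt (fun t : ℝ => (1 - t / τ) * (Real.sin (a * t) / a)
      - Real.cos (a * t) / (a ^ 2 * τ)) (tent τ t * Real.cos (a * t)) t := fun t ht => by
    rw [Set.uIcc_of_le hτ.le] at ht
    have hl : HasDerivAt (fun t : ℝ => a * t) (a * 1) t := (hasDerivAt_id t).const_mul a
    have h1 := (((hasDerivAt_id t).div_const τ).const_sub 1).mul (hl.sin.div_const a)
    have h2 := hl.cos.div_const (a ^ 2 * τ)
    refine (h1.sub h2).congr_deriv ?_
    simp [tent, abs_of_nonneg ht.1]; field_simp; ring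
  rw [intervalIntegral.integral_eq_sub_of_hasDerivAt h
    ((by fun_prop : Continuous _).intervalIntegrable _ _)]
  have e : 2 * Real.pi * (m * τ) = a * τ := by rw [ha]; ring
  have e2 : 2 * Real.pi ^ 2 * m ^ 2 * τ = a ^ 2 * τ / 2 := by rw [ha]; ring
  rw [e, e2]
  have h1 : (1 : ℝ) - τ / τ = 0 := by rw [div_self hτ.ne', sub_self]
  rw [mul_zero, Real.sin_zero, Real.cos_zero, h1]
  field_simp
  ring

theorem fejer_nonneg {τ : ℝ} (hτ : 0 < τ) (m : ℤ) : 0 ≤ fejer τ m := by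
  by_cases hm : m = 0
  · rw [hm, fejer_zero hτ]; exact hτ.le
  · rw [fejer_eq hτ hm]
    exact div_nonneg (one_sub_cos_nonneg _) (by positivity)

theorem fejer_neg (τ : ℝ) (m : ℤ) : fejer τ (-m) = fejer τ m := by
  unfold fejer
  refine intervalIntegral.integral_congr fun t _ => ?_
  have e : 2 * Real.pi * ((-m : ℤ) : ℝ) * t = -(2 * Real.pi * m * t) := by push_cast; ring
  simp only [e, Real.cos_neg]

/-- In the range |m|τ ≤ 1/2 the bound 1 - cos(2πs) ≥ 8s² gives the value 4τ/π² at least, and π² ≤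
10. -/
theorem two_fifths_mul_le_fejer {τ : ℝ} (hτ : 0 < τ) {m : ℤ} (hm : |(m : ℝ)| * τ ≤ 1 / 2) :
    2 / 5 * τ ≤ fejer τ m := by
  by_cases h0 : m = 0
  · rw [h0, fejer_zero hτ]; linarith
  have hm' : (m : ℝ) ≠ 0 := by exact_mod_cast h0
  have h := eight_mul_sq_le_one_sub_cos (s := m * τ) (by rwa [abs_mul, abs_of_pos hτ])
  rw [fejer_eq hτ h0, le_div_iff₀ (by positivity)]
  refine le_trans ?_ h
  have hπ : Real.pi ^ 2 ≤ 10 := by nlinarith [Real.pi_lt_d2, Real.pi_pos]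
  have : 0 ≤ (m : ℝ) ^ 2 * τ ^ 2 := by positivity
  nlinarith

theorem fejer_le_half {τ : ℝ} (hτ : 0 < τ) {m : ℤ} (hm : 1 / 2 < |(m : ℝ)| * τ) :
    fejer τ m ≤ τ / 2 := by
  have h0 : m ≠ 0 := by rintro rfl; norm_num at hm
  have hm' : (m : ℝ) ≠ 0 := by exact_mod_cast h0
  rw [fejer_eq hτ h0, div_le_iff₀ (by positivity)]
  have h1 := Real.neg_one_le_cos (2 * Real.pi * (m * τ))
  have hπ : 9 ≤ Real.pi ^ 2 := by nlinarith [Real.pi_gt_three]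
  have h2 : 1 / 4 ≤ (m : ℝ) ^ 2 * τ ^ 2 := by
    have : (1 / 2 : ℝ) ^ 2 ≤ (|(m : ℝ)| * τ) ^ 2 := by gcongr
    rw [mul_pow, sq_abs] at this; linarith
  nlinarith

theorem tent_nonneg {τ t : ℝ} (hτ : 0 < τ) (ht : t ∈ Set.Icc (-τ) τ) : 0 ≤ tent τ t := by
  unfold tent
  rw [sub_nonneg, div_le_one hτ]
  exact abs_le.2 ht

theorem tent_le_one {τ t : ℝ} (hτ : 0 < τ) : tent τ t ≤ 1 := by
  unfold tent
  have : 0 ≤ |t| / τ := by positivity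
  linarith

/-! ### Local second moments and tails of μ. -/

/-- The second difference of φ with step h has cosine coefficients 2μ(k)(1 - cos 2πkh), at least 16
h² k² μ(k) when |kh| ≤ 1/2. By convexity it is nonnegative on [-τ, τ], so its integral against the
tent modulated by the frequency k₀ is at most its plain integral; modulation shifts the Fejér kernel
to ±k₀. The powers h² cancel, and no second derivative of φ is needed. -/
theorem sum_sq_weight_fejer_le {δ : ℝ} (hconv : ConvexOn ℝ (Set.Ioo (-δ) δ) (phi μ)) {τ : ℝ}
    (hτ : 0 < τ) (hτδ : 4 * τ < δ) (S : Finset ℤ) (k₀ : ℤ) :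
    ∑ k ∈ S, (k : ℝ) ^ 2 * weight μ k * fejer τ (k - k₀) ≤ 4 * phi μ τ / τ := by
  obtain ⟨B, hB0, hB⟩ : ∃ B : ℝ, 0 < B ∧ ∀ k ∈ S, |(k : ℝ)| ≤ B := by
    refine ⟨1 + ∑ k ∈ S, |(k : ℝ)|, by positivity, fun k hk => ?_⟩
    have := Finset.single_le_sum (f := fun k : ℤ => |(k : ℝ)|) (fun _ _ => abs_nonneg _) hk
    linarith
  -- The step depends on the finite set: small enough that |kh| ≤ 1/2 throughout S. The final bound
  -- does not see it.
  set h : ℝ := min τ (1 / (2 * B)) with hh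
  have hh0 : 0 < h := by positivity
  have hhτ : h ≤ τ := min_le_left _ _
  have hhS : ∀ k ∈ S, |(k : ℝ) * h| ≤ 1 / 2 := fun k hk => by
    rw [abs_mul, abs_of_pos hh0]
    calc |(k : ℝ)| * h ≤ B * (1 / (2 * B)) := by
          gcongr
          · exact hB k hk
          · exact min_le_right _ _
      _ = 1 / 2 := by field_simp
  set g : ℤ → ℝ := fun k => 2 * (weight μ k * (1 - Real.cos (2 * Real.pi * k * h))) with hg
  have hgs : Summable g := (hasSum_phi h).summable.mul_left 2
  have hg0 : ∀ k, 0 ≤ g k := fun k => mul_nonneg (by norm_num) (phi_term_nonneg k h)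
  have hΔ : ∀ t, (ft g t).re = phi μ (t + h) + phi μ (t - h) - 2 * phi μ t := fun t => by
    refine (hasSum_ft_re hgs t).unique ?_
    have := ((hasSum_phi (μ := μ) (t + h)).add (hasSum_phi (μ := μ) (t - h))).sub
      ((hasSum_phi (μ := μ) t).mul_left 2)
    refine (congrArg (fun f => HasSum f _) (funext fun k => ?_)).mpr this
    simp only [hg]
    rw [mul_add, mul_sub (2 * Real.pi * (k : ℝ)), Real.cos_add, Real.cos_sub]
    ring
  have hs := hasSum_integral_mul_ft_re hgs (ρ := fun t => tent τ t * Real.cos (2 * Real.pi * k₀ * t))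
    (by fun_prop) (-τ) τ
  have hF : ∀ k : ℤ, ∫ t in (-τ)..τ, tent τ t * Real.cos (2 * Real.pi * k₀ * t)
      * Real.cos (2 * Real.pi * k * t) = (fejer τ (k - k₀) + fejer τ (k + k₀)) / 2 := fun k => by
    unfold fejer
    rw [← intervalIntegral.integral_add ((by fun_prop : Continuous _).intervalIntegrable _ _)
      ((by fun_prop : Continuous _).intervalIntegrable _ _), ← intervalIntegral.integral_div]
    congr 1; ext t
    push_cast
    rw [mul_sub, mul_add, sub_mul, add_mul, Real.cos_sub, Real.cos_add]
    ring
  simp only [hF, hΔ] at hs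
  have hle : ∑ k ∈ S, g k * ((fejer τ (k - k₀) + fejer τ (k + k₀)) / 2)
      ≤ 16 * phi μ τ / τ * h ^ 2 := by
    refine (sum_le_hasSum S (fun k _ => mul_nonneg (hg0 k) ?_) hs).trans ?_
    · have := fejer_nonneg hτ (k - k₀)
      have := fejer_nonneg hτ (k + k₀)
      positivity
    · refine le_trans ?_ (integral_second_difference_le hconv hτ hτδ hh0.le hhτ)
      refine intervalIntegral.integral_mono_on (by linarith)
        ((by fun_prop : Continuous _).intervalIntegrable _ _)
        ((by fun_prop : Continuous _).intervalIntegrable _ _) fun t ht => ?_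
      have hnn := phi_second_difference_nonneg hconv (t := t) hh0.le
        (by have := abs_le.2 ht; linarith)
      have h1 : tent τ t * Real.cos (2 * Real.pi * k₀ * t) ≤ 1 :=
        (mul_le_of_le_one_right (tent_nonneg hτ ht) (Real.cos_le_one _)).trans (tent_le_one hτ)
      exact mul_le_of_le_one_left hnn h1
  have hlow : ∑ k ∈ S, (k : ℝ) ^ 2 * weight μ k * fejer τ (k - k₀) * (8 * h ^ 2)
      ≤ ∑ k ∈ S, g k * ((fejer τ (k - k₀) + fejer τ (k + k₀)) / 2) := by
    refine Finset.sum_le_sum fun k hk => ?_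
    have h1 := eight_mul_sq_le_one_sub_cos (hhS k hk)
    rw [← mul_assoc] at h1
    have f1 := fejer_nonneg hτ (k - k₀)
    have f2 := fejer_nonneg hτ (k + k₀)
    have hw := weight_nonneg μ k
    calc (k : ℝ) ^ 2 * weight μ k * fejer τ (k - k₀) * (8 * h ^ 2)
        = weight μ k * (8 * ((k : ℝ) * h) ^ 2) * fejer τ (k - k₀) := by ring
      _ ≤ weight μ k * (1 - Real.cos (2 * Real.pi * k * h)) * fejer τ (k - k₀) := by gcongr
      _ ≤ weight μ k * (1 - Real.cos (2 * Real.pi * k * h)) *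
          (fejer τ (k - k₀) + fejer τ (k + k₀)) :=
          mul_le_mul_of_nonneg_left (by linarith) (phi_term_nonneg k h)
      _ = _ := by simp only [hg]; ring
  rw [← Finset.sum_mul] at hlow
  have hfin := hlow.trans hle
  have hh2 : 0 < h ^ 2 := by positivity
  have h3 : (∑ k ∈ S, (k : ℝ) ^ 2 * weight μ k * fejer τ (k - k₀)) * h ^ 2
      ≤ (2 * phi μ τ / τ) * h ^ 2 := by
    have : 16 * phi μ τ / τ * h ^ 2 = 8 * ((2 * phi μ τ / τ) * h ^ 2) := by ring
    nlinarith
  refine (le_of_mul_le_mul_right h3 hh2).trans ?_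
  have := phi_nonneg (μ := μ) τ
  gcongr; norm_num

theorem sum_sq_weight_window_le {δ : ℝ} (hconv : ConvexOn ℝ (Set.Ioo (-δ) δ) (phi μ)) {τ : ℝ}
    (hτ : 0 < τ) (hτδ : 4 * τ < δ) (S : Finset ℤ) (k₀ : ℤ)
    (hS : ∀ k ∈ S, |((k - k₀ : ℤ) : ℝ)| * τ ≤ 1 / 2) :
    ∑ k ∈ S, (k : ℝ) ^ 2 * weight μ k ≤ 10 * phi μ τ / τ ^ 2 := by
  have h1 := sum_sq_weight_fejer_le hconv hτ hτδ S k₀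
  have h2 : (∑ k ∈ S, (k : ℝ) ^ 2 * weight μ k) * (2 / 5 * τ)
      ≤ ∑ k ∈ S, (k : ℝ) ^ 2 * weight μ k * fejer τ (k - k₀) := by
    rw [Finset.sum_mul]
    refine Finset.sum_le_sum fun k hk => ?_
    have := weight_nonneg μ k
    exact mul_le_mul_of_nonneg_left (two_fifths_mul_le_fejer hτ (hS k hk)) (by positivity)
  have h3 := h2.trans h1
  rw [← le_div_iff₀ (by positivity)] at h3
  refine h3.trans (le_of_eq ?_)
  field_simp; ring

theorem sum_sq_weight_low_le {τ : ℝ} (hτ : 0 < τ) (S : Finset ℤ)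
    (hS : ∀ k ∈ S, |(k : ℝ)| * τ ≤ 1 / 2) :
    ∑ k ∈ S, (k : ℝ) ^ 2 * weight μ k ≤ phi μ τ / (8 * τ ^ 2) := by
  rw [le_div_iff₀ (by positivity), Finset.sum_mul]
  refine le_trans (Finset.sum_le_sum fun k hk => ?_)
    (sum_le_hasSum S (fun k _ => phi_term_nonneg k τ) (hasSum_phi τ))
  have h1 := eight_mul_sq_le_one_sub_cos (s := k * τ) (by rw [abs_mul, abs_of_pos hτ]; exact hS k hk)
  rw [← mul_assoc] at h1
  have := mul_le_mul_of_nonneg_left h1 (weight_nonneg μ k)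
  linarith

/-- Averaging φ against the tent gives ∑ μ(k)(τ - fejer τ k) ≤ τ φ(τ), by monotonicity of φ. Every
term is nonnegative, and those with |k|τ > 1/2 have second factor at least τ/2. -/
theorem sum_weight_high_le {δ : ℝ} (hconv : ConvexOn ℝ (Set.Ioo (-δ) δ) (phi μ)) {τ : ℝ}
    (hτ : 0 < τ) (hτδ : τ < δ) (S : Finset ℤ) (hS : ∀ k ∈ S, 1 / 2 < |(k : ℝ)| * τ) :
    ∑ k ∈ S, weight μ k ≤ 2 * phi μ τ := by
  have hs := hasSum_integral_mul_ft_re (summable_weight μ) (continuous_tent τ) (-τ) τ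
  have hs' : HasSum (fun k : ℤ => weight μ k * (τ - fejer τ k)) (∫ t in (-τ)..τ, tent τ t * phi μ t) := by
    have h1 := ((hasSum_weight μ).mul_right τ).sub hs
    have h0 : ∫ t in (-τ)..τ, tent τ t = τ := by
      have := fejer_zero hτ
      simpa [fejer] using this
    have e : ∫ t in (-τ)..τ, tent τ t * phi μ t
        = 1 * τ - ∫ t in (-τ)..τ, tent τ t * (ft (weight μ) t).re := by
      have hc := continuous_ft (summable_weight μ)
      have h3 := intervalIntegral.integral_sub ((continuous_tent τ).intervalIntegrable (μ := volume) (-τ) τ)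
        ((by fun_prop : Continuous fun t => tent τ t * (ft (weight μ) t).re).intervalIntegrable
          (μ := volume) (-τ) τ)
      rw [h0] at h3
      rw [one_mul, ← h3]
      congr 1; ext t; simp only [phi, fourier_eq_ft]; ring
    rw [e]
    refine (congrArg (fun f => HasSum f _) (funext fun k => ?_)).mpr h1
    simp only [fejer]; ring
  have hfl : ∀ k, fejer τ k ≤ τ := fun k => by
    by_cases hk : 1 / 2 < |(k : ℝ)| * τ
    · linarith [fejer_le_half hτ hk]
    · have : fejer τ k ≤ ∫ t in (-τ)..τ, tent τ t := by
        refine intervalIntegral.integral_mono_on (by linarith)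
          ((by fun_prop : Continuous _).intervalIntegrable _ _)
          ((continuous_tent _).intervalIntegrable _ _) fun t ht => ?_
        exact mul_le_of_le_one_right (tent_nonneg hτ ht) (Real.cos_le_one _)
      have h0 := fejer_zero hτ
      simp only [fejer, Int.cast_zero, mul_zero, zero_mul, Real.cos_zero, mul_one] at h0
      linarith
  have hub : ∫ t in (-τ)..τ, tent τ t * phi μ t ≤ τ * phi μ τ := by
    have h0 := fejer_zero hτ
    simp only [fejer, Int.cast_zero, mul_zero, zero_mul, Real.cos_zero, mul_one] at h0
    calc ∫ t in (-τ)..τ, tent τ t * phi μ t ≤ ∫ t in (-τ)..τ, tent τ t * phi μ τ := by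
          refine intervalIntegral.integral_mono_on (by linarith)
            ((by fun_prop : Continuous _).intervalIntegrable _ _)
            ((by fun_prop : Continuous _).intervalIntegrable _ _) fun t ht => ?_
          exact mul_le_mul_of_nonneg_left (phi_abs_le hconv (abs_le.2 ht) hτδ) (tent_nonneg hτ ht)
      _ = τ * phi μ τ := by rw [intervalIntegral.integral_mul_const, h0]
  have hlow : (∑ k ∈ S, weight μ k) * (τ / 2) ≤ ∑ k ∈ S, weight μ k * (τ - fejer τ k) := by
    rw [Finset.sum_mul]
    refine Finset.sum_le_sum fun k hk => mul_le_mul_of_nonneg_left ?_ (weight_nonneg μ k)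
    linarith [fejer_le_half hτ (hS k hk)]
  have := (hlow.trans (sum_le_hasSum S (fun k _ => mul_nonneg (weight_nonneg μ k)
    (by linarith [hfl k])) hs')).trans hub
  nlinarith

/-! ### Square integrals of the derivative of θ near 0. -/

theorem norm_char_sub_one_le (k : ℤ) (t : ℝ) : ‖char k t - 1‖ ≤ 2 * Real.pi * (|(k : ℝ)| * |t|) := by
  rw [char_eq, mul_comm _ Complex.I]
  refine Real.norm_exp_I_mul_ofReal_sub_one_le.trans (le_of_eq ?_)
  rw [Real.norm_eq_abs, abs_mul, abs_mul, abs_of_pos (by positivity : 0 < 2 * Real.pi)]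
  ring

theorem integral_tent_mul_norm_sq_sum (h : ℤ → ℝ) (S : Finset ℤ) (τ : ℝ) :
    ∫ t in (-τ)..τ, tent τ t * ‖∑ k ∈ S, (h k : ℂ) * char k t‖ ^ 2
      = ∑ k ∈ S, ∑ l ∈ S, h k * h l * fejer τ (k - l) := by
  have h1 : ∀ t, ‖∑ k ∈ S, (h k : ℂ) * char k t‖ ^ 2
      = ∑ k ∈ S, ∑ l ∈ S, h k * h l * Real.cos (2 * Real.pi * ((k - l : ℤ) : ℝ) * t) := fun t => by
    have e : ((‖∑ k ∈ S, (h k : ℂ) * char k t‖ ^ 2 : ℝ) : ℂ)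
        = ∑ k ∈ S, ∑ l ∈ S, ((h k * h l : ℝ) : ℂ) * char (k - l) t := by
      rw [← Complex.normSq_eq_norm_sq, ← Complex.mul_conj, map_sum, Finset.sum_mul_sum]
      refine Finset.sum_congr rfl fun k _ => Finset.sum_congr rfl fun l _ => ?_
      rw [map_mul, Complex.conj_ofReal, char_sub]; push_cast; ring
    have e2 := congrArg Complex.re e
    rw [Complex.ofReal_re] at e2
    rw [e2]
    simp only [Complex.re_sum, Complex.re_ofReal_mul, char_re]
  simp only [h1, Finset.mul_sum]
  rw [intervalIntegral.integral_finsetSum fun k _ =>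
    (by fun_prop : Continuous _).intervalIntegrable _ _]
  refine Finset.sum_congr rfl fun k _ => ?_
  rw [intervalIntegral.integral_finsetSum fun k _ =>
    (by fun_prop : Continuous _).intervalIntegrable _ _]
  refine Finset.sum_congr rfl fun l _ => ?_
  rw [fejer, ← intervalIntegral.integral_const_mul]
  congr 1; ext t; ring

/-- The tent has nonnegative transform, so the quadratic form only grows when coefficients are
replaced by their absolute values. Finite sums suffice, by dominated convergence. -/
theorem integral_tent_mul_norm_sq_ft_le {h : ℤ → ℝ} (hh : Summable h) {τ B : ℝ} (hτ : 0 < τ)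
    (hB : ∀ S : Finset ℤ, ∑ k ∈ S, ∑ l ∈ S, |h k| * |h l| * fejer τ (k - l) ≤ B) :
    ∫ t in (-τ)..τ, tent τ t * ‖ft h t‖ ^ 2 ≤ B := by
  have hlim : Tendsto (fun S : Finset ℤ => ∫ t in (-τ)..τ, tent τ t *
      ‖∑ k ∈ S, (h k : ℂ) * char k t‖ ^ 2) atTop
      (𝓝 (∫ t in (-τ)..τ, tent τ t * ‖ft h t‖ ^ 2)) := by
    refine intervalIntegral.tendsto_integral_filter_of_dominated_convergence
      (fun t => |tent τ t| * (∑' k, |h k|) ^ 2) ?_ ?_ ?_ ?_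
    · exact Eventually.of_forall fun S => (by fun_prop : Continuous _).aestronglyMeasurable
    · refine Eventually.of_forall fun S => Eventually.of_forall fun t _ => ?_
      rw [norm_mul, Real.norm_eq_abs, norm_pow, norm_norm]
      gcongr
      refine (norm_sum_le _ _).trans ?_
      simp only [norm_mul, norm_char, mul_one, Complex.norm_real, Real.norm_eq_abs]
      exact hh.abs.sum_le_tsum S fun _ _ => abs_nonneg _
    · exact (by fun_prop : Continuous _).intervalIntegrable _ _
    · refine Eventually.of_forall fun t _ => ?_
      exact ((summable_ofReal_mul_char hh t).hasSum.norm.pow 2).const_mul _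
  refine le_of_tendsto' hlim fun S => ?_
  rw [integral_tent_mul_norm_sq_sum]
  refine le_trans (Finset.sum_le_sum fun k _ => Finset.sum_le_sum fun l _ => ?_) (hB S)
  refine mul_le_mul_of_nonneg_right ?_ (fejer_nonneg hτ _)
  rw [← abs_mul]; exact le_abs_self _

/-- The part of `k ↦ k μ(k)` carried by the frequencies `|k| > 1 / (2τ)`. -/
noncomputable def momHigh (μ : PMF ℤ) (τ : ℝ) (k : ℤ) : ℝ :=
  if 1 / 2 < |(k : ℝ)| * τ then mom (weight μ) k else 0

/-- The part of `k ↦ k μ(k)` carried by the frequencies `|k| ≤ 1 / (2τ)`. -/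
noncomputable def momLow (μ : PMF ℤ) (τ : ℝ) (k : ℤ) : ℝ :=
  if 1 / 2 < |(k : ℝ)| * τ then 0 else mom (weight μ) k

theorem summable_momHigh (hm : FiniteFirstMoment μ) (τ : ℝ) : Summable (momHigh μ τ) := by
  refine Summable.of_norm_bounded (summable_mom_weight hm).abs fun k => ?_
  unfold momHigh; split_ifs <;> simp

theorem summable_momLow (hm : FiniteFirstMoment μ) (τ : ℝ) : Summable (momLow μ τ) := by
  refine Summable.of_norm_bounded (summable_mom_weight hm).abs fun k => ?_
  unfold momLow; split_ifs <;> simp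

theorem ft_mom_eq (hm : FiniteFirstMoment μ) (τ t : ℝ) :
    ft (mom (weight μ)) t = ft (momLow μ τ) t + ft (momHigh μ τ) t := by
  unfold ft
  rw [← (summable_ofReal_mul_char (summable_momLow hm τ) t).tsum_add
    (summable_ofReal_mul_char (summable_momHigh hm τ) t)]
  refine tsum_congr fun k => ?_
  unfold momLow momHigh; split_ifs <;> simp

theorem phi_two_mul_le (τ : ℝ) : phi μ (2 * τ) ≤ 4 * phi μ τ := by
  have := phi_nat_mul_le (μ := μ) 2 τ
  norm_num at this; exact this

/-- The tent of half-width 2τ is at least 1/2 on [-τ, τ], which reduces to a double sum of |k||l|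
μ(k) μ(l) against a Fejér kernel. After |k||l| ≤ (k² + l²)/2, the sum of the squared variable
against the kernel is O(φ(τ)/τ), and the remaining tail of μ is at most 2φ(τ). -/
theorem integral_norm_sq_ft_momHigh_le (hm : FiniteFirstMoment μ) {δ : ℝ}
    (hconv : ConvexOn ℝ (Set.Ioo (-δ) δ) (phi μ)) {τ : ℝ} (hτ : 0 < τ) (hτδ : 8 * τ < δ) :
    ∫ t in (-τ)..τ, ‖ft (momHigh μ τ) t‖ ^ 2 ≤ 32 * phi μ τ ^ 2 / τ := by
  have hs := summable_momHigh hm τ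
  have hφ := phi_nonneg (μ := μ) τ
  have key : ∫ t in (-(2 * τ))..(2 * τ), tent (2 * τ) t * ‖ft (momHigh μ τ) t‖ ^ 2
      ≤ 16 * phi μ τ ^ 2 / τ := by
    refine integral_tent_mul_norm_sq_ft_le hs (by linarith) fun S => ?_
    set S' := S.filter fun k : ℤ => 1 / 2 < |(k : ℝ)| * τ with hS'
    have e1 : ∑ k ∈ S, ∑ l ∈ S, |momHigh μ τ k| * |momHigh μ τ l| * fejer (2 * τ) (k - l)
        = ∑ k ∈ S', ∑ l ∈ S', |mom (weight μ) k| * |mom (weight μ) l| * fejer (2 * τ) (k - l) := by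
      rw [hS', Finset.sum_filter]
      refine Finset.sum_congr rfl fun k _ => ?_
      unfold momHigh
      split_ifs with hk
      · rw [Finset.sum_filter]
        refine Finset.sum_congr rfl fun l _ => ?_
        split_ifs <;> simp
      · simp
    have e2 : ∀ k l : ℤ, |mom (weight μ) k| * |mom (weight μ) l| * fejer (2 * τ) (k - l)
        ≤ weight μ l * ((k : ℝ) ^ 2 * weight μ k * fejer (2 * τ) (k - l)) / 2
          + weight μ k * ((l : ℝ) ^ 2 * weight μ l * fejer (2 * τ) (l - k)) / 2 := fun k l => by
      have hk := weight_nonneg μ k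
      have hl := weight_nonneg μ l
      have hf := fejer_nonneg (show 0 < 2 * τ by linarith) (k - l)
      have hsym : fejer (2 * τ) (l - k) = fejer (2 * τ) (k - l) := by
        rw [← fejer_neg]; congr 1; ring
      have h1 : |(k : ℝ)| * |(l : ℝ)| ≤ ((k : ℝ) ^ 2 + (l : ℝ) ^ 2) / 2 := by
        have := two_mul_le_add_sq |(k : ℝ)| |(l : ℝ)|
        rw [sq_abs, sq_abs] at this; linarith
      rw [hsym]
      simp only [mom, abs_mul, abs_of_nonneg hk, abs_of_nonneg hl]
      calc |(k : ℝ)| * weight μ k * (|(l : ℝ)| * weight μ l) * fejer (2 * τ) (k - l)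
          = (|(k : ℝ)| * |(l : ℝ)|) * (weight μ k * weight μ l * fejer (2 * τ) (k - l)) := by ring
        _ ≤ (((k : ℝ) ^ 2 + (l : ℝ) ^ 2) / 2) * (weight μ k * weight μ l * fejer (2 * τ) (k - l)) :=
            mul_le_mul_of_nonneg_right h1 (by positivity)
        _ = _ := by ring
    have hin : ∀ k : ℤ, ∑ l ∈ S', weight μ k * ((l : ℝ) ^ 2 * weight μ l * fejer (2 * τ) (l - k)) / 2
        ≤ weight μ k * (4 * phi μ τ / τ) := fun k => by
      rw [← Finset.sum_div, ← Finset.mul_sum]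
      have h1 := sum_sq_weight_fejer_le hconv (show 0 < 2 * τ by linarith) (by linarith) S' k
      have h2 : 4 * phi μ (2 * τ) / (2 * τ) ≤ 2 * (4 * phi μ τ / τ) := by
        rw [div_le_iff₀ (by linarith)]
        have := phi_two_mul_le (μ := μ) τ
        have e : 2 * (4 * phi μ τ / τ) * (2 * τ) = 16 * phi μ τ := by field_simp; ring
        rw [e]; linarith
      have := mul_le_mul_of_nonneg_left (h1.trans h2) (weight_nonneg μ k)
      linarith
    have hout : ∑ k ∈ S', weight μ k ≤ 2 * phi μ τ :=
      sum_weight_high_le hconv hτ (by linarith) S' fun k hk => (Finset.mem_filter.1 hk).2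
    rw [e1]
    calc ∑ k ∈ S', ∑ l ∈ S', |mom (weight μ) k| * |mom (weight μ) l| * fejer (2 * τ) (k - l)
        ≤ ∑ k ∈ S', ∑ l ∈ S', (weight μ l * ((k : ℝ) ^ 2 * weight μ k * fejer (2 * τ) (k - l)) / 2
          + weight μ k * ((l : ℝ) ^ 2 * weight μ l * fejer (2 * τ) (l - k)) / 2) :=
          Finset.sum_le_sum fun k _ => Finset.sum_le_sum fun l _ => e2 k l
      _ = (∑ l ∈ S', ∑ k ∈ S', weight μ l * ((k : ℝ) ^ 2 * weight μ k * fejer (2 * τ) (k - l)) / 2)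
          + ∑ k ∈ S', ∑ l ∈ S', weight μ k * ((l : ℝ) ^ 2 * weight μ l * fejer (2 * τ) (l - k)) / 2 := by
          simp only [Finset.sum_add_distrib]
          rw [Finset.sum_comm]
      _ ≤ (∑ l ∈ S', weight μ l * (4 * phi μ τ / τ)) + ∑ k ∈ S', weight μ k * (4 * phi μ τ / τ) :=
          add_le_add (Finset.sum_le_sum fun k _ => hin k) (Finset.sum_le_sum fun k _ => hin k)
      _ = (∑ k ∈ S', weight μ k) * (8 * phi μ τ / τ) := by rw [← Finset.sum_mul]; ring
      _ ≤ 2 * phi μ τ * (8 * phi μ τ / τ) := by gcongr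
      _ = _ := by ring
  have hc : Continuous fun t => ‖ft (momHigh μ τ) t‖ ^ 2 := by
    have := continuous_ft hs; fun_prop
  have hc2 : Continuous fun t => 2 * (tent (2 * τ) t * ‖ft (momHigh μ τ) t‖ ^ 2) := by fun_prop
  calc ∫ t in (-τ)..τ, ‖ft (momHigh μ τ) t‖ ^ 2
      ≤ ∫ t in (-τ)..τ, 2 * (tent (2 * τ) t * ‖ft (momHigh μ τ) t‖ ^ 2) := by
        refine intervalIntegral.integral_mono_on (by linarith) (hc.intervalIntegrable _ _)
          (hc2.intervalIntegrable _ _) fun t ht => ?_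
        have h1 : 1 / 2 ≤ tent (2 * τ) t := by
          unfold tent
          have : |t| / (2 * τ) ≤ 1 / 2 := by
            rw [div_le_iff₀ (by linarith)]; have := abs_le.2 ht; linarith
          linarith
        have h2 : 0 ≤ ‖ft (momHigh μ τ) t‖ ^ 2 := by positivity
        nlinarith
    _ ≤ ∫ t in (-(2 * τ))..(2 * τ), 2 * (tent (2 * τ) t * ‖ft (momHigh μ τ) t‖ ^ 2) := by
        refine intervalIntegral.integral_mono_interval (by linarith) (by linarith) (by linarith) ?_
          (hc2.intervalIntegrable _ _)
        rw [EventuallyLE, ae_restrict_iff' measurableSet_Ioc]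
        refine Eventually.of_forall fun t ht => ?_
        have := tent_nonneg (show 0 < 2 * τ by linarith) (Set.Ioc_subset_Icc_self ht)
        simp only [Pi.zero_apply]; positivity
    _ = 2 * ∫ t in (-(2 * τ))..(2 * τ), tent (2 * τ) t * ‖ft (momHigh μ τ) t‖ ^ 2 := by
        rw [intervalIntegral.integral_const_mul]
    _ ≤ 2 * (16 * phi μ τ ^ 2 / τ) := by linarith
    _ = _ := by ring

/-- On low frequencies |e(kt) - 1| ≤ 2π|k|τ, so the variation is at most 2πτ times the second moment
over |k| ≤ 1/(2τ). -/
theorem norm_ft_momLow_sub_le (hm : FiniteFirstMoment μ) {τ t : ℝ} (hτ : 0 < τ) (ht : |t| ≤ τ) :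
    ‖ft (momLow μ τ) t - ft (momLow μ τ) 0‖ ≤ phi μ τ / τ := by
  have hs := summable_momLow hm τ
  have e : ft (momLow μ τ) t - ft (momLow μ τ) 0
      = ∑' k : ℤ, (momLow μ τ k : ℂ) * (char k t - 1) := by
    unfold ft
    rw [← (summable_ofReal_mul_char hs t).tsum_sub (summable_ofReal_mul_char hs 0)]
    refine tsum_congr fun k => ?_
    rw [char_at_zero]; ring
  have hsum : Summable fun k : ℤ => ‖(momLow μ τ k : ℂ) * (char k t - 1)‖ := by
    refine Summable.of_nonneg_of_le (fun _ => norm_nonneg _) (fun k => ?_) (hs.abs.mul_right 2)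
    rw [norm_mul, Complex.norm_real, Real.norm_eq_abs]
    gcongr
    refine (norm_sub_le _ _).trans ?_
    simp; norm_num
  have hφ := phi_nonneg (μ := μ) τ
  rw [e]
  refine (norm_tsum_le_tsum_norm hsum).trans (hsum.tsum_le_of_sum_le fun S => ?_)
  have hterm : ∀ k : ℤ, ‖(momLow μ τ k : ℂ) * (char k t - 1)‖
      ≤ if 1 / 2 < |(k : ℝ)| * τ then 0 else (k : ℝ) ^ 2 * weight μ k * (2 * Real.pi * τ) := by
    intro k
    rw [norm_mul, Complex.norm_real, Real.norm_eq_abs]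
    unfold momLow
    split_ifs with hk
    · simp
    · have h1 := norm_char_sub_one_le k t
      have hw := weight_nonneg μ k
      rw [mom, abs_mul, abs_of_nonneg hw]
      calc |(k : ℝ)| * weight μ k * ‖char k t - 1‖
          ≤ |(k : ℝ)| * weight μ k * (2 * Real.pi * (|(k : ℝ)| * τ)) := by
            gcongr
            refine h1.trans ?_
            have := Real.pi_pos
            gcongr
        _ = (|(k : ℝ)| ^ 2) * weight μ k * (2 * Real.pi * τ) := by ring
        _ = _ := by rw [sq_abs]
  refine (Finset.sum_le_sum fun k _ => hterm k).trans ?_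
  have h3 : ∑ k ∈ S, (if 1 / 2 < |(k : ℝ)| * τ then 0
      else (k : ℝ) ^ 2 * weight μ k * (2 * Real.pi * τ))
      = (∑ k ∈ S.filter (fun k : ℤ => ¬ 1 / 2 < |(k : ℝ)| * τ), (k : ℝ) ^ 2 * weight μ k)
        * (2 * Real.pi * τ) := by
    rw [Finset.sum_mul, Finset.sum_filter]
    refine Finset.sum_congr rfl fun k _ => ?_
    split_ifs <;> simp_all
  rw [h3]
  have h4 := sum_sq_weight_low_le (μ := μ) hτ (S.filter (fun k : ℤ => ¬ 1 / 2 < |(k : ℝ)| * τ))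
    fun k hk => not_lt.1 (Finset.mem_filter.1 hk).2
  have hπ := Real.pi_pos
  calc _ ≤ phi μ τ / (8 * τ ^ 2) * (2 * Real.pi * τ) := by gcongr
    _ = phi μ τ / τ * (Real.pi / 4) := by field_simp; ring
    _ ≤ phi μ τ / τ * 1 := by gcongr; linarith [Real.pi_le_four]
    _ = _ := mul_one _

/-- The truncated drift is compared with the mean of θ' over [0, τ], which is (θ(τ) - 1)/τ and hence
controlled by `hK`. The errors are the oscillation of the low part and the high part, the latter
estimated in mean square. With A = φ(τ)/τ they contribute 3/2 + 16 ≤ 18 in units of Aτ. -/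
theorem norm_ft_momLow_zero_le (hm : FiniteFirstMoment μ) {δ K : ℝ}
    (hconv : ConvexOn ℝ (Set.Ioo (-δ) δ) (phi μ)) {τ : ℝ} (hτ : 0 < τ) (hτδ : 8 * τ < δ)
    (hφ : 0 < phi μ τ) (hK : ‖fourier μ τ - 1‖ ≤ K * phi μ τ) :
    ‖ft (momLow μ τ) 0‖ ≤ (K + 18) * (phi μ τ / τ) := by
  have hlow := continuous_ft (summable_momLow hm τ)
  have hhigh := continuous_ft (summable_momHigh hm τ)
  have hmom := continuous_ft (summable_mom_weight hm)
  set A := phi μ τ / τ with hA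
  have hA0 : 0 < A := div_pos hφ hτ
  have hAτ : A * τ = phi μ τ := by rw [hA]; field_simp
  set z : ℂ := 2 * Real.pi * Complex.I with hz
  have hzn : ‖z‖ = 2 * Real.pi := by simp [hz, abs_of_pos Real.pi_pos]
  have hftc : ∫ t in (0 : ℝ)..τ, z * ft (mom (weight μ)) t = fourier μ τ - 1 := by
    rw [intervalIntegral.integral_eq_sub_of_hasDerivAt (fun t _ => hasDerivAt_fourier hm t)
      ((by fun_prop : Continuous _).intervalIntegrable _ _)]
    congr 1
    have h1 := ft_power μ 1 0
    have h2 : phi μ 0 = 0 := phi_zero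
    rw [fourier_eq_ft]; unfold ft
    simp only [char_at_zero, mul_one, ← Complex.ofReal_tsum, (hasSum_weight μ).tsum_eq]
    simp
  rw [intervalIntegral.integral_const_mul] at hftc
  have e : (τ : ℂ) * ft (momLow μ τ) 0 = (∫ t in (0 : ℝ)..τ, ft (mom (weight μ)) t)
      - ∫ t in (0 : ℝ)..τ, ((ft (momLow μ τ) t - ft (momLow μ τ) 0) + ft (momHigh μ τ) t) := by
    rw [← intervalIntegral.integral_sub (hmom.intervalIntegrable _ _)
      ((by fun_prop : Continuous fun t => (ft (momLow μ τ) t - ft (momLow μ τ) 0)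
        + ft (momHigh μ τ) t).intervalIntegrable _ _)]
    have : ∀ t, ft (mom (weight μ)) t - ((ft (momLow μ τ) t - ft (momLow μ τ) 0)
        + ft (momHigh μ τ) t) = ft (momLow μ τ) 0 := fun t => by
      rw [ft_mom_eq hm τ t]; ring
    simp [this]
  have hI1 : ‖∫ t in (0 : ℝ)..τ, ft (mom (weight μ)) t‖ ≤ K * phi μ τ := by
    have h1 : 2 * Real.pi * ‖∫ t in (0 : ℝ)..τ, ft (mom (weight μ)) t‖ ≤ K * phi μ τ := by
      rw [← hzn, ← norm_mul, hftc]; exact hK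
    refine le_trans ?_ h1
    exact le_mul_of_one_le_left (norm_nonneg _) (by linarith [Real.pi_gt_three])
  have hI2 : ‖∫ t in (0 : ℝ)..τ, ((ft (momLow μ τ) t - ft (momLow μ τ) 0) + ft (momHigh μ τ) t)‖
      ≤ 18 * phi μ τ := by
    refine (intervalIntegral.norm_integral_le_integral_norm hτ.le).trans ?_
    calc ∫ t in (0 : ℝ)..τ, ‖(ft (momLow μ τ) t - ft (momLow μ τ) 0) + ft (momHigh μ τ) t‖
        ≤ ∫ t in (0 : ℝ)..τ, (3 / 2 * A + 1 / (2 * A) * ‖ft (momHigh μ τ) t‖ ^ 2) := by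
          refine intervalIntegral.integral_mono_on hτ.le
            ((by fun_prop : Continuous _).intervalIntegrable _ _)
            ((by fun_prop : Continuous _).intervalIntegrable _ _) fun t ht => ?_
          refine (norm_add_le _ _).trans ?_
          have h1 := norm_ft_momLow_sub_le hm hτ (t := t) (abs_le.2 ⟨by linarith [ht.1], ht.2⟩)
          have h2 : ‖ft (momHigh μ τ) t‖ ≤ A / 2 + 1 / (2 * A) * ‖ft (momHigh μ τ) t‖ ^ 2 := by
            have h3 : 0 ≤ (A - ‖ft (momHigh μ τ) t‖) ^ 2 / (2 * A) := by positivity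
            have h4 : (A - ‖ft (momHigh μ τ) t‖) ^ 2 / (2 * A) = A / 2
                + 1 / (2 * A) * ‖ft (momHigh μ τ) t‖ ^ 2 - ‖ft (momHigh μ τ) t‖ := by
              field_simp; ring
            linarith
          linarith
      _ = 3 / 2 * A * τ + 1 / (2 * A) * ∫ t in (0 : ℝ)..τ, ‖ft (momHigh μ τ) t‖ ^ 2 := by
          rw [intervalIntegral.integral_add (by simp)
            ((by fun_prop : Continuous _).intervalIntegrable _ _),
            intervalIntegral.integral_const_mul]
          simp; ring
      _ ≤ 3 / 2 * A * τ + 1 / (2 * A) * (32 * phi μ τ ^ 2 / τ) := by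
          gcongr
          refine le_trans ?_ (integral_norm_sq_ft_momHigh_le hm hconv hτ hτδ)
          refine intervalIntegral.integral_mono_interval (by linarith) (by linarith) le_rfl ?_
            ((by fun_prop : Continuous _).intervalIntegrable _ _)
          exact Eventually.of_forall fun t => by simp only [Pi.zero_apply]; positivity
      _ ≤ 18 * phi μ τ := by
          rw [← hAτ]
          have : 1 / (2 * A) * (32 * (A * τ) ^ 2 / τ) = 16 * (A * τ) := by field_simp; ring
          rw [this]
          have : 0 < A * τ := by positivity
          linarith
  have h5 : τ * ‖ft (momLow μ τ) 0‖ ≤ (K + 18) * phi μ τ := by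
    have : τ * ‖ft (momLow μ τ) 0‖ = ‖(τ : ℂ) * ft (momLow μ τ) 0‖ := by
      rw [norm_mul, Complex.norm_real, Real.norm_eq_abs, abs_of_pos hτ]
    rw [this, e]
    refine (norm_sub_le _ _).trans ?_
    linarith
  rw [hA, ← mul_div_assoc, le_div_iff₀ hτ]
  linarith

theorem integral_norm_sq_ft_mom_le (hm : FiniteFirstMoment μ) {δ K : ℝ}
    (hconv : ConvexOn ℝ (Set.Ioo (-δ) δ) (phi μ)) {τ : ℝ} (hτ : 0 < τ) (hτδ : 8 * τ < δ)
    (hφ : 0 < phi μ τ) (hK : ‖fourier μ τ - 1‖ ≤ K * phi μ τ) :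
    ∫ t in (-τ)..τ, ‖ft (mom (weight μ)) t‖ ^ 2
      ≤ (6 * (K + 18) ^ 2 + 102) * (phi μ τ ^ 2 / τ) := by
  have hhigh := continuous_ft (summable_momHigh hm τ)
  have hmom := continuous_ft (summable_mom_weight hm)
  have h0 := norm_ft_momLow_zero_le hm hconv hτ hτδ hφ hK
  have hA0 : 0 < phi μ τ / τ := div_pos hφ hτ
  calc ∫ t in (-τ)..τ, ‖ft (mom (weight μ)) t‖ ^ 2
      ≤ ∫ t in (-τ)..τ, (3 * ((K + 18) ^ 2 + 1) * (phi μ τ / τ) ^ 2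
          + 3 * ‖ft (momHigh μ τ) t‖ ^ 2) := by
        refine intervalIntegral.integral_mono_on (by linarith)
          ((by fun_prop : Continuous _).intervalIntegrable _ _)
          ((by fun_prop : Continuous _).intervalIntegrable _ _) fun t ht => ?_
        have h1 := norm_ft_momLow_sub_le hm hτ (t := t) (abs_le.2 ht)
        have e : ft (mom (weight μ)) t = ft (momLow μ τ) 0
            + (ft (momLow μ τ) t - ft (momLow μ τ) 0) + ft (momHigh μ τ) t := by
          rw [ft_mom_eq hm τ t]; ring
        have h2 : ‖ft (mom (weight μ)) t‖ ≤ (K + 18) * (phi μ τ / τ) + phi μ τ / τ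
            + ‖ft (momHigh μ τ) t‖ := by
          rw [e]
          refine (norm_add_le _ _).trans (add_le_add ((norm_add_le _ _).trans ?_) le_rfl)
          exact add_le_add h0 h1
        set a := (K + 18) * (phi μ τ / τ)
        set b := phi μ τ / τ
        set c := ‖ft (momHigh μ τ) t‖
        have h3 : ‖ft (mom (weight μ)) t‖ ^ 2 ≤ (a + b + c) ^ 2 :=
          pow_le_pow_left₀ (norm_nonneg _) h2 2
        have h4 : 3 * ((K + 18) ^ 2 + 1) * b ^ 2 = 3 * a ^ 2 + 3 * b ^ 2 := by
          simp only [a]; ring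
        rw [h4]
        nlinarith [sq_nonneg (a - b), sq_nonneg (b - c), sq_nonneg (a - c)]
    _ = 3 * ((K + 18) ^ 2 + 1) * (phi μ τ / τ) ^ 2 * (2 * τ)
          + 3 * ∫ t in (-τ)..τ, ‖ft (momHigh μ τ) t‖ ^ 2 := by
        rw [intervalIntegral.integral_add (by simp)
          ((by fun_prop : Continuous _).intervalIntegrable _ _),
          intervalIntegral.integral_const_mul]
        simp; ring
    _ ≤ 3 * ((K + 18) ^ 2 + 1) * (phi μ τ / τ) ^ 2 * (2 * τ) + 3 * (32 * phi μ τ ^ 2 / τ) := by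
        gcongr
        exact integral_norm_sq_ft_momHigh_le hm hconv hτ hτδ
    _ = _ := by field_simp; ring

/-! ### The frequency scale of a convolution power and decay beyond it. -/

/-- The quantitative information on the Fourier transform from which the kernel estimates are
derived. -/
structure Regular (μ : PMF ℤ) (δ K c : ℝ) : Prop where
  moment : FiniteFirstMoment μ
  convex : ConvexOn ℝ (Set.Ioo (-δ) δ) (phi μ)
  δ_pos : 0 < δ
  δ_le : δ ≤ 1 / 2
  K_pos : 0 < K
  c_pos : 0 < c
  norm_sub_one_le : ∀ t, |t| ≤ 1 / 2 → ‖fourier μ t - 1‖ ≤ K * phi μ t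
  norm_le_exp : ∀ t, |t| ≤ 1 / 2 → ‖fourier μ t‖ ≤ Real.exp (-(phi μ t / K))
  lower : ∀ t, |t| ≤ 1 / 2 → c * t ^ 2 ≤ phi μ t

/-- `τ` is the frequency scale of the `n`-th convolution power. -/
structure IsScale (μ : PMF ℤ) (δ : ℝ) (n : ℕ) (τ : ℝ) : Prop where
  pos : 0 < τ
  le : τ ≤ δ / 16
  le_one : n * phi μ τ ≤ 1
  ge : phi μ (δ / 16) ≤ 2 * (n * phi μ τ)

variable {δ K c : ℝ}

namespace Regular

theorem phi_pos (h : Regular μ δ K c) {t : ℝ} (ht0 : t ≠ 0) (ht : |t| ≤ 1 / 2) : 0 < phi μ t := by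
  have := h.lower t ht
  have := h.c_pos
  have : 0 < t ^ 2 := by positivity
  have : 0 < c * t ^ 2 := by positivity
  linarith

/-- By the intermediate value theorem n φ(τ) = 1 is solvable in [0, δ/16] unless n φ(δ/16) ≤ 1, in
which case τ = δ/16 serves. The lower bound in the first case uses φ ≤ 2. -/
theorem exists_scale (h : Regular μ δ K c) {n : ℕ} (hn : 1 ≤ n) : ∃ τ, IsScale μ δ n τ := by
  have hδ := h.δ_pos
  have hδ' := h.δ_le
  have hn' : (1 : ℝ) ≤ n := by exact_mod_cast hn
  by_cases hc : n * phi μ (δ / 16) ≤ 1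
  · refine ⟨δ / 16, by positivity, le_rfl, hc, ?_⟩
    have := le_mul_of_one_le_left (phi_nonneg (μ := μ) (δ / 16)) hn'
    have := phi_nonneg (μ := μ) (δ / 16)
    linarith
  · push Not at hc
    have hcont : ContinuousOn (fun t => n * phi μ t) (Set.Icc 0 (δ / 16)) :=
      (by fun_prop : Continuous fun t => n * phi μ t).continuousOn
    obtain ⟨τ, hτ, hτe⟩ := intermediate_value_Icc (by positivity : (0 : ℝ) ≤ δ / 16) hcont
      (show (1 : ℝ) ∈ Set.Icc (n * phi μ 0) (n * phi μ (δ / 16)) by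
        rw [phi_zero, mul_zero]; exact ⟨zero_le_one, hc.le⟩)
    simp only at hτe
    have hτ0 : τ ≠ 0 := by
      rintro rfl; rw [phi_zero, mul_zero] at hτe; norm_num at hτe
    refine ⟨τ, lt_of_le_of_ne hτ.1 (Ne.symm hτ0), hτ.2, hτe.le, ?_⟩
    rw [hτe]
    linarith [phi_le_two (μ := μ) (δ / 16)]

/-- Since φ(t)/t increases, n φ(t) grows at least linearly in |t|/τ up to δ/16; beyond, the
quadratic lower bound and nτ ≥ δ/32 suffice. Thus |θ|ᵐ ≲ exp(-b|t|/τ). The condition on m leaves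
room to split a power in halves and to drop further factors. Of the exponent 7, two powers serve as
a weight and five make shells summable. -/
theorem exists_decay (h : Regular μ δ K c) : ∃ C : ℝ, 0 < C ∧ ∀ (n : ℕ) (τ : ℝ),
    IsScale μ δ n τ → ∀ m : ℕ, n ≤ 8 * m + 8 → ∀ t, |t| ≤ 1 / 2 →
      ‖fourier μ t‖ ^ m * (1 + |t| / τ) ^ 7 ≤ C := by
  have hδ := h.δ_pos
  have hδ' := h.δ_le
  have hK := h.K_pos
  have hc := h.c_pos
  set τ₀ := δ / 16 with hτ₀
  have hτ₀0 : 0 < τ₀ := by positivity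
  have hp0 : 0 < phi μ τ₀ := h.phi_pos hτ₀0.ne' (by rw [abs_of_pos hτ₀0]; linarith)
  -- The two entries are the slopes available inside and outside |t| ≤ τ₀; the 8 in `b` is the loss
  -- from n to m.
  set a := min (phi μ τ₀ / 2) (c * τ₀ ^ 3) with ha
  have ha0 : 0 < a := by positivity
  set b := a / (8 * K) with hb
  have hb0 : 0 < b := by positivity
  -- Here 5040 = 7!, from y⁷/7! ≤ exp y with y = b(1 + |t|/τ).
  refine ⟨Real.exp (2 / K + b) * (5040 / b ^ 7 * Real.exp b), by positivity, ?_⟩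
  intro n τ hτ m hnm t ht
  have hτ0 := hτ.pos
  have hτle : τ ≤ τ₀ := hτ.le
  have hge : phi μ τ₀ ≤ 2 * (n * phi μ τ) := hτ.ge
  have hφt := phi_nonneg (μ := μ) t
  have hlow : a * (|t| / τ) - a ≤ n * phi μ t := by
    rcases le_or_gt |t| τ with h1 | h1
    · have : |t| / τ ≤ 1 := (div_le_one hτ0).2 h1
      have : 0 ≤ n * phi μ t := by positivity
      nlinarith
    suffices a * (|t| / τ) ≤ n * phi μ t by linarith
    rw [← mul_div_assoc, div_le_iff₀ hτ0]
    rcases le_or_gt |t| τ₀ with h2 | h2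
    · have h3 := phi_mul_le_mul_phi h.convex hτ0.le h1.le (by linarith)
      have h4 : phi μ |t| = phi μ t := by
        rcases abs_cases t with ⟨h, _⟩ | ⟨h, _⟩ <;> rw [h]
        rw [phi_neg]
      rw [h4] at h3
      calc a * |t| ≤ phi μ τ₀ / 2 * |t| := by gcongr; exact min_le_left _ _
        _ ≤ n * phi μ τ * |t| := by gcongr; linarith
        _ = n * (|t| * phi μ τ) := by ring
        _ ≤ n * (τ * phi μ t) := by gcongr
        _ = _ := by ring
    · have h3 := phi_mul_le_mul_phi h.convex hτ0.le hτle (by linarith)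
      have h5 : τ₀ / 2 ≤ n * τ := by
        have h6 : phi μ τ₀ * τ₀ ≤ phi μ τ₀ * (2 * (n * τ)) := by
          calc phi μ τ₀ * τ₀ ≤ 2 * (n * phi μ τ) * τ₀ := by gcongr
            _ = 2 * n * (τ₀ * phi μ τ) := by ring
            _ ≤ 2 * n * (τ * phi μ τ₀) := by gcongr
            _ = _ := by ring
        have := le_of_mul_le_mul_left h6 hp0
        linarith
      have h7 : c * τ₀ ^ 2 ≤ phi μ t := by
        refine le_trans ?_ (h.lower t ht)
        rw [← sq_abs t]; gcongr
      calc a * |t| ≤ c * τ₀ ^ 3 * (1 / 2) := by gcongr; exact min_le_right _ _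
        _ = (τ₀ / 2) * (c * τ₀ ^ 2) := by ring
        _ ≤ (n * τ) * phi μ t := by gcongr
        _ = _ := by ring
  have hm : (n : ℝ) * phi μ t / 8 - 2 ≤ m * phi μ t := by
    have h1 : (n : ℝ) ≤ 8 * m + 8 := by exact_mod_cast hnm
    have h2 := mul_le_mul_of_nonneg_right h1 hφt
    linarith [phi_le_two (μ := μ) t]
  set s := |t| / τ with hs
  have hs0 : 0 ≤ s := by positivity
  have hexp : ‖fourier μ t‖ ^ m ≤ Real.exp (2 / K + b) * Real.exp (-(b * s)) := by
    calc ‖fourier μ t‖ ^ m ≤ Real.exp (-(phi μ t / K)) ^ m :=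
          pow_le_pow_left₀ (norm_nonneg _) (h.norm_le_exp t ht) m
      _ = Real.exp (-(m * phi μ t / K)) := by rw [← Real.exp_nat_mul]; congr 1; ring
      _ ≤ Real.exp (2 / K + b + -(b * s)) := by
          rw [Real.exp_le_exp]
          have h1 : (n : ℝ) * phi μ t / 8 / K - 2 / K ≤ m * phi μ t / K := by
            rw [← sub_div]; gcongr
          have h2 : (a * s - a) / (8 * K) ≤ n * phi μ t / (8 * K) := by gcongr
          have h3 : (a * s - a) / (8 * K) = b * s - b := by rw [hb]; ring
          have h4 : n * phi μ t / (8 * K) = (n : ℝ) * phi μ t / 8 / K := by rw [div_div]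
          linarith
      _ = _ := Real.exp_add _ _
  have hpow : (1 + s) ^ 7 ≤ 5040 / b ^ 7 * (Real.exp b * Real.exp (b * s)) := by
    have h1 := Real.pow_div_factorial_le_exp (b * (1 + s)) (by positivity) 7
    rw [← Real.exp_add, ← show b * (1 + s) = b + b * s by ring]
    have h2 : (Nat.factorial 7 : ℝ) = 5040 := by norm_num [Nat.factorial]
    rw [h2, mul_pow, div_le_iff₀ (by norm_num)] at h1
    rw [div_mul_eq_mul_div, le_div_iff₀ (by positivity)]
    linarith
  calc ‖fourier μ t‖ ^ m * (1 + s) ^ 7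
      ≤ (Real.exp (2 / K + b) * Real.exp (-(b * s)))
        * (5040 / b ^ 7 * (Real.exp b * Real.exp (b * s))) := by gcongr
    _ = Real.exp (2 / K + b) * (5040 / b ^ 7 * Real.exp b)
        * (Real.exp (-(b * s)) * Real.exp (b * s)) := by ring
    _ = _ := by rw [← Real.exp_add]; simp

end Regular

/-! ### Weighted integrals at the frequency scale. -/

/-- The integral of `w` over `|t| ≤ r` within the fundamental interval. -/
noncomputable def mass (w : ℝ → ℝ) (r : ℝ) : ℝ :=
  ∫ t in Set.Icc (-(1 / 2) : ℝ) (1 / 2), (Set.Icc (-r) r).indicator w t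

/-- Decompose into shells |t| ≈ Nτ: growth N³ against the weight N⁻⁵ leaves the convergent sum of
N⁻². -/
theorem integral_div_pow_le_of_mass_le {w : ℝ → ℝ} (hw : Continuous w) (hw0 : ∀ t, 0 ≤ w t)
    {τ A : ℝ} (hτ : 0 < τ) (hA : ∀ N : ℕ, 1 ≤ N → mass w (N * τ) ≤ A * N ^ 3) :
    ∫ t in (-(1 / 2) : ℝ)..(1 / 2), w t / (1 + |t| / τ) ^ 5 ≤ A * ∑' N : ℕ, 1 / (N : ℝ) ^ 2 := by
  set M := ⌊1 / 2 / τ⌋₊ + 1 with hM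
  have hint : IntegrableOn w (Set.Icc (-(1 / 2) : ℝ) (1 / 2)) :=
    hw.continuousOn.integrableOn_compact isCompact_Icc
  have hint' : ∀ N : ℕ, Integrable (fun t => 1 / (N : ℝ) ^ 5 *
      (Set.Icc (-(N * τ)) (N * τ)).indicator w t)
      (volume.restrict (Set.Icc (-(1 / 2) : ℝ) (1 / 2))) := fun N =>
    (hint.integrable.indicator measurableSet_Icc).const_mul _
  rw [intervalIntegral.integral_of_le (by norm_num), ← integral_Icc_eq_integral_Ioc]
  have hcd : Continuous fun t => w t / (1 + |t| / τ) ^ 5 :=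
    hw.div (by fun_prop) fun t => by positivity
  calc ∫ t in Set.Icc (-(1 / 2) : ℝ) (1 / 2), w t / (1 + |t| / τ) ^ 5
      ≤ ∫ t in Set.Icc (-(1 / 2) : ℝ) (1 / 2), ∑ N ∈ Finset.Icc 1 M, 1 / (N : ℝ) ^ 5 *
          (Set.Icc (-(N * τ)) (N * τ)).indicator w t := by
        refine setIntegral_mono_on (hcd.continuousOn.integrableOn_compact isCompact_Icc)
          (integrable_finsetSum _ fun N _ => hint' N) measurableSet_Icc fun t ht => ?_
        have ht' : |t| ≤ 1 / 2 := abs_le.2 ht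
        set N := ⌊|t| / τ⌋₊ + 1 with hN
        have hNM : N ∈ Finset.Icc 1 M := by
          rw [Finset.mem_Icc]
          exact ⟨by omega, by rw [hN, hM]; gcongr⟩
        have h1 : |t| / τ < N := by rw [hN]; push_cast; exact Nat.lt_floor_add_one _
        have h2 : (N : ℝ) ≤ 1 + |t| / τ := by
          rw [hN]; push_cast
          have := Nat.floor_le (show 0 ≤ |t| / τ by positivity)
          linarith
        have hN0 : (0 : ℝ) < N := by rw [hN]; positivity
        have h3 : t ∈ Set.Icc (-(N * τ)) (N * τ) := by
          rw [div_lt_iff₀ hτ] at h1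
          exact abs_le.1 h1.le
        refine le_trans ?_ (Finset.single_le_sum (f := fun N : ℕ => 1 / (N : ℝ) ^ 5 *
          (Set.Icc (-(N * τ)) (N * τ)).indicator w t) (fun i _ => ?_) hNM)
        · rw [Set.indicator_of_mem h3, div_eq_mul_one_div, mul_comm]
          gcongr
          exact hw0 t
        · exact mul_nonneg (by positivity) (Set.indicator_nonneg (fun t _ => hw0 t) _)
    _ = ∑ N ∈ Finset.Icc 1 M, 1 / (N : ℝ) ^ 5 * mass w (N * τ) := by
        rw [integral_finsetSum _ fun N _ => hint' N]
        refine Finset.sum_congr rfl fun N _ => ?_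
        rw [integral_const_mul, mass]
    _ ≤ ∑ N ∈ Finset.Icc 1 M, A * (1 / (N : ℝ) ^ 2) := by
        refine Finset.sum_le_sum fun N hN => ?_
        have hN1 := (Finset.mem_Icc.1 hN).1
        have hN0 : (0 : ℝ) < N := by exact_mod_cast hN1
        calc 1 / (N : ℝ) ^ 5 * mass w (N * τ) ≤ 1 / (N : ℝ) ^ 5 * (A * N ^ 3) := by
              gcongr; exact hA N hN1
          _ = _ := by field_simp
    _ ≤ A * ∑' N : ℕ, 1 / (N : ℝ) ^ 2 := by
        rw [← Finset.mul_sum]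
        have hA0 : 0 ≤ A := by
          have h1 := hA 1 le_rfl
          have h2 : 0 ≤ mass w ((1 : ℕ) * τ) :=
            integral_nonneg fun t => Set.indicator_nonneg (fun t _ => hw0 t) _
          simp at h1 h2; linarith
        gcongr
        exact (Real.summable_one_div_nat_pow.2 (by norm_num)).sum_le_tsum _ fun _ _ => by positivity

theorem mass_le_integral {w : ℝ → ℝ} (hw : Continuous w) (hw0 : ∀ t, 0 ≤ w t) {r : ℝ}
    (hr : 0 ≤ r) : mass w r ≤ ∫ t in (-r)..r, w t := by
  unfold mass
  rw [setIntegral_indicator measurableSet_Icc, intervalIntegral.integral_of_le (by linarith),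
    ← integral_Icc_eq_integral_Ioc]
  exact setIntegral_mono_set (hw.continuousOn.integrableOn_compact isCompact_Icc)
    (Eventually.of_forall hw0) (Set.inter_subset_right.eventuallyLE)

theorem mass_le_of_le {w : ℝ → ℝ} (hw : Continuous w) {B : ℝ} (hB : ∀ t, w t ≤ B) (hB0 : 0 ≤ B)
    (r : ℝ) : mass w r ≤ B := by
  unfold mass
  calc _ ≤ ∫ _ in Set.Icc (-(1 / 2) : ℝ) (1 / 2), B := by
        refine integral_mono ((hw.continuousOn.integrableOn_compact
          isCompact_Icc).integrable.indicator measurableSet_Icc) (by simp) fun t => ?_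
        exact Set.indicator_le' (fun t _ => hB t) (fun _ _ => hB0) t
    _ = B := by simp; norm_num

namespace Regular

/-- At radius Nτ ≤ δ/16 the local square estimate and φ(Nτ) ≤ N² φ(τ) give N⁴/N = N³. At larger
radii boundedness of θ' is enough, because φ(τ)²/τ ≥ c²τ³ and Nτ is bounded below. -/
theorem exists_mass_le (h : Regular μ δ K c) : ∃ C : ℝ, 0 < C ∧ ∀ τ, 0 < τ → τ ≤ δ / 16 →
    ∀ N : ℕ, 1 ≤ N → mass (fun t => ‖ft (mom (weight μ)) t‖ ^ 2) (N * τ)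
      ≤ C * (phi μ τ ^ 2 / τ) * N ^ 3 := by
  have hδ := h.δ_pos
  have hδ' := h.δ_le
  have hc := h.c_pos
  have hcont : Continuous fun t => ‖ft (mom (weight μ)) t‖ ^ 2 := by
    have := continuous_ft (summable_mom_weight h.moment); fun_prop
  set B := (∑' k, |mom (weight μ) k|) ^ 2 with hB
  have hB0 : 0 ≤ B := by positivity
  set C₁ := 6 * (K + 18) ^ 2 + 102 with hC₁
  have hC₁0 : 0 < C₁ := by positivity
  set C₂ := B / (c ^ 2 * (δ / 16) ^ 3) with hC₂
  refine ⟨C₁ + C₂, by positivity, fun τ hτ hτδ N hN => ?_⟩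
  have hN1 : (1 : ℝ) ≤ N := by exact_mod_cast hN
  have hP : 0 < phi μ τ := h.phi_pos hτ.ne' (by rw [abs_of_pos hτ]; linarith)
  rcases le_or_gt (N * τ) (δ / 16) with h1 | h1
  · have hNτ : 0 < N * τ := by positivity
    have habs : |N * τ| ≤ 1 / 2 := by rw [abs_of_pos hNτ]; linarith
    refine (mass_le_integral hcont (fun t => by positivity) hNτ.le).trans ?_
    refine (integral_norm_sq_ft_mom_le h.moment h.convex hNτ (by linarith)
      (h.phi_pos hNτ.ne' habs) (h.norm_sub_one_le _ habs)).trans ?_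
    have h2 := phi_nat_mul_le (μ := μ) N τ
    have h3 := phi_nonneg (μ := μ) (N * τ)
    calc C₁ * (phi μ (N * τ) ^ 2 / (N * τ)) ≤ C₁ * ((N ^ 2 * phi μ τ) ^ 2 / (N * τ)) := by gcongr
      _ = C₁ * (phi μ τ ^ 2 / τ) * N ^ 3 := by field_simp
      _ ≤ _ := by gcongr; linarith [show 0 ≤ C₂ by positivity]
  · refine (mass_le_of_le hcont (B := B) (fun t => ?_) hB0 _).trans ?_
    · exact pow_le_pow_left₀ (norm_nonneg _) (norm_ft_le (summable_mom_weight h.moment) t) 2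
    have h2 : c ^ 2 * τ ^ 3 ≤ phi μ τ ^ 2 / τ := by
      rw [le_div_iff₀ hτ]
      have := pow_le_pow_left₀ (by positivity) (h.lower τ (by rw [abs_of_pos hτ]; linarith)) 2
      linarith [show (c * τ ^ 2) ^ 2 = c ^ 2 * τ ^ 3 * τ by ring]
    calc B = C₂ * (c ^ 2 * (δ / 16) ^ 3) := by rw [hC₂]; field_simp
      _ ≤ C₂ * (c ^ 2 * (N * τ) ^ 3) := by gcongr
      _ = C₂ * (c ^ 2 * τ ^ 3) * N ^ 3 := by ring
      _ ≤ C₂ * (phi μ τ ^ 2 / τ) * N ^ 3 := by gcongr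
      _ ≤ _ := by gcongr; linarith

/-- Weighted integrals against powers of `|θ|`. -/
theorem exists_integral_le (h : Regular μ δ K c) : ∃ C : ℝ, 0 < C ∧ ∀ (n : ℕ) (τ : ℝ),
    IsScale μ δ n τ → ∀ m : ℕ, n ≤ 8 * m + 8 →
      (∫ t in (-(1 / 2) : ℝ)..(1 / 2), (1 + |t| / τ) ^ 2 * ‖fourier μ t‖ ^ m) ≤ C * τ ∧
      (∫ t in (-(1 / 2) : ℝ)..(1 / 2), (1 + |t| / τ) ^ 2 * ‖ft (mom (weight μ)) t‖ ^ 2 *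
        ‖fourier μ t‖ ^ m) ≤ C * (phi μ τ ^ 2 / τ) := by
  obtain ⟨C₁, hC₁, hdecay⟩ := h.exists_decay
  obtain ⟨C₂, hC₂, hmass⟩ := h.exists_mass_le
  have hmom := continuous_ft (summable_mom_weight h.moment)
  set Z := ∑' N : ℕ, 1 / (N : ℝ) ^ 2 with hZ
  have hZ0 : 0 ≤ Z := tsum_nonneg fun N => by positivity
  have hgen : ∀ (n : ℕ) (τ : ℝ), IsScale μ δ n τ → ∀ m : ℕ, n ≤ 8 * m + 8 →
      ∀ (w : ℝ → ℝ) (A : ℝ), Continuous w → (∀ t, 0 ≤ w t) →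
      (∀ N : ℕ, 1 ≤ N → mass w (N * τ) ≤ A * N ^ 3) →
      ∫ t in (-(1 / 2) : ℝ)..(1 / 2), (1 + |t| / τ) ^ 2 * w t * ‖fourier μ t‖ ^ m
        ≤ C₁ * (A * Z) := by
    intro n τ hτ m hm w A hw hw0 hA
    have hτ0 := hτ.pos
    have hcd : Continuous fun t => w t / (1 + |t| / τ) ^ 5 :=
      hw.div (by fun_prop) fun t => by positivity
    calc _ ≤ ∫ t in (-(1 / 2) : ℝ)..(1 / 2), C₁ * (w t / (1 + |t| / τ) ^ 5) := by
          refine intervalIntegral.integral_mono_on (by norm_num)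
            ((by fun_prop : Continuous _).intervalIntegrable _ _)
            ((by fun_prop : Continuous _).intervalIntegrable _ _) fun t ht => ?_
          have h1 := hdecay n τ hτ m hm t (abs_le.2 ht)
          have hs : 0 < 1 + |t| / τ := by positivity
          rw [← mul_div_assoc, le_div_iff₀ (by positivity)]
          calc _ = w t * (‖fourier μ t‖ ^ m * (1 + |t| / τ) ^ 7) := by ring
            _ ≤ w t * C₁ := mul_le_mul_of_nonneg_left h1 (hw0 t)
            _ = _ := mul_comm _ _
      _ ≤ C₁ * (A * Z) := by
          rw [intervalIntegral.integral_const_mul]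
          gcongr
          exact integral_div_pow_le_of_mass_le hw hw0 hτ0 hA
  refine ⟨C₁ * (2 * Z) + C₁ * (C₂ * Z) + 1, by positivity, fun n τ hτ m hm => ⟨?_, ?_⟩⟩
  · have hτ0 := hτ.pos
    have h1 := hgen n τ hτ m hm (fun _ => 1) (2 * τ) continuous_const (fun _ => zero_le_one)
      fun N hN => by
        have hN1 : (1 : ℝ) ≤ N := by exact_mod_cast hN
        refine (mass_le_integral continuous_const (fun _ => zero_le_one) (by positivity)).trans ?_
        simp only [intervalIntegral.integral_const, smul_eq_mul, mul_one]
        have : (N : ℝ) ≤ N ^ 3 := le_self_pow₀ hN1 (by norm_num)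
        nlinarith
    simp only [mul_one] at h1
    refine h1.trans ?_
    have : 0 ≤ (C₁ * (C₂ * Z) + 1) * τ := by positivity
    linarith
  · have hτ0 := hτ.pos
    refine (hgen n τ hτ m hm _ (C₂ * (phi μ τ ^ 2 / τ)) (by fun_prop) (fun t => by positivity)
      (hmass τ hτ0 hτ.le)).trans ?_
    have h2 : 0 ≤ phi μ τ ^ 2 / τ := by positivity
    have : 0 ≤ (C₁ * (2 * Z) + 1) * (phi μ τ ^ 2 / τ) := by positivity
    linarith

end Regular

/-! ### Elementary sums -/

/-- After the first term, each term is bounded by a telescoping difference of τ⁻¹/(1 + τn); τ ≤ 1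
absorbs the constants. -/
theorem hasSum_int_inv_sq_le {τ : ℝ} (hτ : 0 < τ) (hτ1 : τ ≤ 1) :
    Summable (fun x : ℤ => 1 / (1 + τ * |(x : ℝ)|) ^ 2) ∧
      ∑' x : ℤ, 1 / (1 + τ * |(x : ℝ)|) ^ 2 ≤ 4 / τ := by
  have hpart : ∀ N : ℕ, ∑ n ∈ Finset.range N, 1 / (1 + τ * (n : ℝ)) ^ 2
      ≤ 1 + 1 / τ := fun N => by
    suffices ∑ n ∈ Finset.range (N + 1), 1 / (1 + τ * (n : ℝ)) ^ 2
        ≤ 1 + 1 / τ * (1 - 1 / (1 + τ * N)) by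
      refine (Finset.sum_le_sum_of_subset_of_nonneg (Finset.range_mono (Nat.le_succ N))
        fun i _ _ => by positivity).trans (this.trans ?_)
      have : 0 ≤ 1 / τ * (1 / (1 + τ * N)) := by positivity
      linarith
    induction N with
    | zero => simp
    | succ n ih =>
      rw [Finset.sum_range_succ]
      have h1 : 1 / (1 + τ * ((n + 1 : ℕ) : ℝ)) ^ 2
          ≤ 1 / τ * (1 / (1 + τ * n) - 1 / (1 + τ * ((n + 1 : ℕ) : ℝ))) := by
        push_cast
        have e : 1 / τ * (1 / (1 + τ * n) - 1 / (1 + τ * ((n : ℝ) + 1)))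
            = 1 / ((1 + τ * n) * (1 + τ * ((n : ℝ) + 1))) := by field_simp; ring
        rw [e]
        apply one_div_le_one_div_of_le (by positivity)
        rw [sq]
        gcongr
        linarith
      linarith
  have hs : Summable fun n : ℕ => 1 / (1 + τ * (n : ℝ)) ^ 2 :=
    summable_of_sum_range_le (fun n => by positivity) hpart
  have ht : ∑' n : ℕ, 1 / (1 + τ * (n : ℝ)) ^ 2 ≤ 1 + 1 / τ :=
    hs.tsum_le_of_sum_range_le hpart
  have h1 : HasSum (fun n : ℕ => 1 / (1 + τ * |(((n : ℕ) : ℤ) : ℝ)|) ^ 2)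
      (∑' n : ℕ, 1 / (1 + τ * (n : ℝ)) ^ 2) := by simpa using hs.hasSum
  have h2 : HasSum (fun n : ℕ => 1 / (1 + τ * |((-(n : ℕ) : ℤ) : ℝ)|) ^ 2)
      (∑' n : ℕ, 1 / (1 + τ * (n : ℝ)) ^ 2) := by simpa using hs.hasSum
  have h3 := HasSum.of_nat_of_neg (f := fun x : ℤ => 1 / (1 + τ * |(x : ℝ)|) ^ 2) h1 h2
  refine ⟨h3.summable, ?_⟩
  rw [h3.tsum_eq]
  have h4 : 1 ≤ 1 / τ := by rw [le_div_iff₀ hτ]; linarith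
  have h5 : 4 / τ = 4 * (1 / τ) := by ring
  simp only [Int.cast_zero, abs_zero, mul_zero, add_zero, one_pow, div_one]
  linarith

/-- A weighted Cauchy–Schwarz bound of an `ℓ¹` norm. -/
theorem tsum_abs_le_of_sq {f : ℤ → ℝ} (hf : Summable f) {τ A : ℝ} (hτ : 0 < τ) (hτ1 : τ ≤ 1)
    (h2 : Summable fun x => f x ^ 2) (h2' : Summable fun x => mom f x ^ 2)
    (hA1 : ∑' x, f x ^ 2 ≤ A * τ ^ 3) (hA2 : ∑' x, mom f x ^ 2 ≤ A * τ) :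
    ∑' x, |f x| ≤ (2 * A + 2) * τ := by
  obtain ⟨hs, hle⟩ := hasSum_int_inv_sq_le hτ hτ1
  have hpt : ∀ x, |f x| ≤ (1 / τ ^ 2 * f x ^ 2 + mom f x ^ 2)
      + τ ^ 2 / 2 * (1 / (1 + τ * |(x : ℝ)|) ^ 2) := fun x => by
    set q := 1 + τ * |(x : ℝ)| with hq
    have hq0 : 0 < q := by positivity
    -- Cauchy–Schwarz in additive form, balanced so that the three resulting sums are all of order
    -- τ.
    have h3 : 0 ≤ (|f x| * q / τ - τ / q) ^ 2 := sq_nonneg _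
    have h4 : (|f x| * q / τ - τ / q) ^ 2 = f x ^ 2 * q ^ 2 / τ ^ 2 - 2 * |f x| + τ ^ 2 * (1 / q ^ 2) := by
      rw [← sq_abs (f x)]; field_simp; ring
    have h5 : q ^ 2 ≤ 2 * (1 + τ ^ 2 * (x : ℝ) ^ 2) := by
      rw [← sq_abs (x : ℝ), hq]
      nlinarith [sq_nonneg (1 - τ * |(x : ℝ)|)]
    have h6 : f x ^ 2 * q ^ 2 / τ ^ 2 ≤ 2 * (1 / τ ^ 2 * f x ^ 2 + mom f x ^ 2) := by
      rw [div_le_iff₀ (by positivity)]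
      have e : 2 * (1 / τ ^ 2 * f x ^ 2 + mom f x ^ 2) * τ ^ 2
          = f x ^ 2 * (2 * (1 + τ ^ 2 * (x : ℝ) ^ 2)) := by
        simp only [mom]; field_simp
      rw [e]
      gcongr
    linarith
  have hsum := ((h2.mul_left (1 / τ ^ 2)).add h2').add (hs.mul_left (τ ^ 2 / 2))
  refine (hf.abs.tsum_le_tsum hpt hsum).trans ?_
  rw [((h2.mul_left (1 / τ ^ 2)).add h2').tsum_add (hs.mul_left _),
    (h2.mul_left (1 / τ ^ 2)).tsum_add h2', tsum_mul_left, tsum_mul_left]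
  calc _ ≤ 1 / τ ^ 2 * (A * τ ^ 3) + A * τ + τ ^ 2 / 2 * (4 / τ) := by gcongr
    _ = _ := by field_simp; ring

/-- A value is at most any other value in the window plus the variation over the window; average
over the L choices. -/
theorem le_sum_Ico_of_diff {u : ℤ → ℝ} (y : ℤ) {L : ℕ} (hL : 1 ≤ L) :
    u y ≤ ∑ m ∈ Finset.Ico y (y + L), (u m / L + |diff u m|) := by
  have hL0 : (0 : ℝ) < L := by exact_mod_cast hL
  have tel : ∀ i : ℕ, u y ≤ u (y + i) + ∑ m ∈ Finset.Ico y (y + i), |diff u m| := by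
    intro i
    induction i with
    | zero => simp
    | succ i ih =>
      have e : Finset.Ico y (y + ((i + 1 : ℕ) : ℤ)) = insert (y + i) (Finset.Ico y (y + i)) := by
        ext m; simp only [Finset.mem_Ico, Finset.mem_insert]; omega
      rw [e, Finset.sum_insert (by simp)]
      have h1 : -|diff u (y + i)| ≤ u (y + i + 1) - u (y + i) := neg_abs_le _
      have e2 : y + ((i + 1 : ℕ) : ℤ) = y + i + 1 := by push_cast; ring
      rw [e2]
      linarith
  have h1 : ∀ m ∈ Finset.Ico y (y + L), u y ≤ u m + ∑ m ∈ Finset.Ico y (y + L), |diff u m| := by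
    intro m hm
    rw [Finset.mem_Ico] at hm
    obtain ⟨i, rfl⟩ : ∃ i : ℕ, m = y + i := ⟨(m - y).toNat, by omega⟩
    refine (tel i).trans ?_
    gcongr
    omega
  have hcard : (Finset.Ico y (y + L)).card = L := by simp
  have h2 := Finset.sum_le_sum h1
  rw [Finset.sum_const, Finset.sum_add_distrib, Finset.sum_const, hcard, nsmul_eq_mul,
    nsmul_eq_mul] at h2
  rw [Finset.sum_add_distrib, ← Finset.sum_div, ← sub_nonneg]
  have h3 : (∑ m ∈ Finset.Ico y (y + L), u m) / L + ∑ m ∈ Finset.Ico y (y + L), |diff u m| - u y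
      = ((∑ m ∈ Finset.Ico y (y + L), u m) + L * ∑ m ∈ Finset.Ico y (y + L), |diff u m|
        - L * u y) / L := by field_simp
  rw [h3]
  exact div_nonneg (by linarith) hL0.le

/-- A nonnegative sequence with bounded window sums, tested against a slowly varying one. -/
theorem sum_mul_le_of_window {W u : ℤ → ℝ} (hW : ∀ k, 0 ≤ W k) (hu0 : ∀ k, 0 ≤ u k)
    (hu : Summable u) {L : ℕ} (hL : 1 ≤ L) {A : ℝ} (hA0 : 0 ≤ A)
    (hA : ∀ (S : Finset ℤ) (x₀ : ℤ), (∀ k ∈ S, x₀ ≤ k ∧ k < x₀ + L) → ∑ k ∈ S, W k ≤ A)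
    (S : Finset ℤ) (x : ℤ) :
    ∑ k ∈ S, W k * u (x - k) ≤ A * ((∑' k, u k) / L + ∑' k, |diff u k|) := by
  set v : ℤ → ℝ := fun m => u m / L + |diff u m| with hv
  have hv0 : ∀ m, 0 ≤ v m := fun m => by
    have := hu0 m
    simp only [hv]; positivity
  have hvs : Summable v := (hu.div_const _).add (summable_diff hu).abs
  have hvt : ∑' m, v m = (∑' k, u k) / L + ∑' k, |diff u k| := by
    rw [(hu.div_const _).tsum_add (summable_diff hu).abs, tsum_div_const]
  rw [← hvt]
  set M := S.biUnion fun k => Finset.Ico (x - k) (x - k + L) with hM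
  calc ∑ k ∈ S, W k * u (x - k)
      ≤ ∑ k ∈ S, W k * ∑ m ∈ Finset.Ico (x - k) (x - k + L), v m := by
        refine Finset.sum_le_sum fun k _ => ?_
        exact mul_le_mul_of_nonneg_left (le_sum_Ico_of_diff _ hL) (hW k)
    _ = ∑ k ∈ S, ∑ m ∈ M, if x - k ≤ m ∧ m < x - k + L then v m * W k else 0 := by
        refine Finset.sum_congr rfl fun k hk => ?_
        rw [← Finset.sum_filter, Finset.mul_sum]
        have : M.filter (fun m => x - k ≤ m ∧ m < x - k + L) = Finset.Ico (x - k) (x - k + L) := by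
          ext m
          simp only [Finset.mem_filter, Finset.mem_Ico, hM, Finset.mem_biUnion]
          exact ⟨fun h => h.2, fun h => ⟨⟨k, hk, h⟩, h⟩⟩
        rw [this]
        exact Finset.sum_congr rfl fun m _ => mul_comm _ _
    _ = ∑ m ∈ M, v m * ∑ k ∈ S.filter (fun k => x - k ≤ m ∧ m < x - k + L), W k := by
        rw [Finset.sum_comm]
        refine Finset.sum_congr rfl fun m _ => ?_
        rw [Finset.mul_sum, Finset.sum_filter]
    _ ≤ ∑ m ∈ M, v m * A := by
        refine Finset.sum_le_sum fun m _ => mul_le_mul_of_nonneg_left ?_ (hv0 m)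
        -- For fixed m the admissible k fill the window of length L starting at x - m.
        refine hA _ (x - m) fun k hk => ?_
        have := (Finset.mem_filter.1 hk).2
        omega
    _ ≤ A * ∑' m, v m := by
        rw [← Finset.sum_mul, mul_comm]
        exact mul_le_mul_of_nonneg_left (hvs.sum_le_tsum M fun m _ => hv0 m) hA0

/-! ### Identities for the powers -/

theorem diff_conv_right {a b : ℤ → ℝ} (ha : Summable a) (hb : Summable b) :
    diff (conv a b) = conv a (diff b) := by
  rw [conv_comm ha hb, diff_conv hb ha, conv_comm (summable_diff hb) ha]

theorem mom_diff (u : ℤ → ℝ) (x : ℤ) : mom (diff u) x = diff (mom u) x - u (x + 1) := by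
  simp only [mom, diff]; push_cast; ring

/-- The truncated subtraction at n = 0 is harmless because of the factor n. -/
theorem mom_power_eq (hm : FiniteFirstMoment μ) (n : ℕ) :
    mom (power μ n) = fun k => (n : ℝ) * conv (mom (weight μ)) (power μ (n - 1)) k := by
  cases n with
  | zero => rw [mom_power_zero]; ext k; simp
  | succ n => rw [mom_power_succ hm]; ext k; simp

theorem ft_const_mul (a : ℝ) (h : ℤ → ℝ) (t : ℝ) : ft (fun k => a * h k) t = a * ft h t := by
  unfold ft
  rw [← tsum_mul_left]
  exact tsum_congr fun k => by push_cast; ring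

theorem ft_mom_power (hm : FiniteFirstMoment μ) (n : ℕ) (t : ℝ) :
    ft (mom (power μ n)) t = n * (ft (mom (weight μ)) t * fourier μ t ^ (n - 1)) := by
  rw [mom_power_eq hm, ft_const_mul, ft_conv (summable_mom_weight hm) (summable_power μ _), ft_power]
  push_cast; rfl

theorem diff_const_mul (a : ℝ) (h : ℤ → ℝ) : diff (fun k => a * h k) = fun k => a * diff h k := by
  ext k; simp only [diff]; ring

theorem mom_diff_power (hm : FiniteFirstMoment μ) (n : ℕ) (x : ℤ) :
    mom (diff (power μ n)) x
      = n * conv (mom (weight μ)) (diff (power μ (n - 1))) x - power μ n (x + 1) := by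
  rw [mom_diff, mom_power_eq hm, diff_const_mul,
    diff_conv_right (summable_mom_weight hm) (summable_power μ _)]

theorem norm_fourier_le_one (t : ℝ) : ‖fourier μ t‖ ≤ 1 := by
  rw [fourier_eq_ft]
  refine (norm_ft_le (summable_weight μ) t).trans (le_of_eq ?_)
  rw [← (hasSum_weight μ).tsum_eq]
  exact tsum_congr fun k => abs_of_nonneg (weight_nonneg μ k)

theorem norm_char_neg_one_sub_one_le (t : ℝ) : ‖char (-1) t - 1‖ ≤ 7 * |t| := by
  have := norm_char_sub_one_le (-1) t
  simp only [Int.cast_neg, Int.cast_one, abs_neg, abs_one, one_mul] at this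
  refine this.trans ?_
  gcongr
  linarith [Real.pi_lt_d2]

/-! ### Kernel estimates for the convolution powers. -/

namespace Regular

/-- The `ℓ¹` norm of the difference of a convolution power is controlled by its scale. -/
theorem exists_tsum_abs_diff_power_le (h : Regular μ δ K c) : ∃ C : ℝ, 0 < C ∧ ∀ (n : ℕ) (τ : ℝ),
    IsScale μ δ n τ → ∀ m : ℕ, n ≤ 4 * m + 4 → m ≤ n →
      ∑' k, |diff (power μ m) k| ≤ C * τ := by
  obtain ⟨C, hC, hint⟩ := h.exists_integral_le
  have hmom := continuous_ft (summable_mom_weight h.moment)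
  refine ⟨2 * (200 * C) + 2, by positivity, fun n τ hτ m hnm hmn => ?_⟩
  have hτ0 := hτ.pos
  have hτ1 : τ ≤ 1 := by linarith [hτ.le, h.δ_le]
  have hp := summable_power μ m
  have hd := summable_diff hp
  have hmp := summable_mom_power h.moment m
  have hs2 : ∀ {f : ℤ → ℝ}, Summable f → Summable fun x => f x ^ 2 := fun hf =>
    (hasSum_sq_integral hf).summable
  have hmd : Summable (mom (diff (power μ m))) := by
    have : mom (diff (power μ m)) = fun x => diff (mom (power μ m)) x - power μ m (x + 1) :=
      funext fun x => mom_diff _ x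
    rw [this]
    exact (summable_diff hmp).sub (summable_shift hp 1)
  obtain ⟨hI1, -⟩ := hint n τ hτ m (by omega)
  have hsq1 : ∀ (t : ℝ) (j : ℕ), (‖fourier μ t‖ ^ j) ^ 2 ≤ ‖fourier μ t‖ ^ j := fun t j => by
    have h1 : ‖fourier μ t‖ ^ j ≤ 1 := pow_le_one₀ (norm_nonneg _) (norm_fourier_le_one t)
    have h0 : 0 ≤ ‖fourier μ t‖ ^ j := by positivity
    nlinarith
  have habs : ∀ t : ℝ, |t| ^ 2 ≤ τ ^ 2 * (1 + |t| / τ) ^ 2 := fun t => by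
    rw [← mul_pow]
    gcongr
    rw [mul_add, mul_div_cancel₀ _ hτ0.ne']; linarith
  -- By Parseval, the factor |e(-t) - 1| ≤ 7|t| is worth τ in norm, hence τ² in the square, and
  -- ∫|θ|ᵐ is O(τ). This accounts for τ³. In the moment, the extra factor m² ∫|θ'|²|θ|ᵐ⁻¹ is at most
  -- (nφ(τ))²/τ up to constants, whence τ.
  refine tsum_abs_le_of_sq hd hτ0 hτ1 (hs2 hd) (hs2 hmd) ?_ ?_
  · rw [(hasSum_sq_integral hd).tsum_eq]
    have hc := continuous_ft hd
    calc ∫ t in (-(1 / 2) : ℝ)..(1 / 2), ‖ft (diff (power μ m)) t‖ ^ 2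
        ≤ ∫ t in (-(1 / 2) : ℝ)..(1 / 2), 49 * τ ^ 2 * ((1 + |t| / τ) ^ 2 * ‖fourier μ t‖ ^ m) := by
          refine intervalIntegral.integral_mono_on (by norm_num)
            ((by fun_prop : Continuous _).intervalIntegrable _ _)
            ((by fun_prop : Continuous _).intervalIntegrable _ _) fun t _ => ?_
          rw [ft_diff hp, ft_power, norm_mul, norm_pow, mul_pow]
          calc _ ≤ (7 * |t|) ^ 2 * ‖fourier μ t‖ ^ m :=
                mul_le_mul (pow_le_pow_left₀ (norm_nonneg _) (norm_char_neg_one_sub_one_le t) 2)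
                  (hsq1 t m) (by positivity) (by positivity)
            _ = 49 * |t| ^ 2 * ‖fourier μ t‖ ^ m := by ring
            _ ≤ 49 * (τ ^ 2 * (1 + |t| / τ) ^ 2) * ‖fourier μ t‖ ^ m := by
                gcongr; exact habs t
            _ = _ := by ring
      _ ≤ 49 * τ ^ 2 * (C * τ) := by
          rw [intervalIntegral.integral_const_mul]; gcongr
      _ ≤ 200 * C * τ ^ 3 := by
          have : 0 ≤ C * τ ^ 3 := by positivity
          nlinarith
  · have hB1 : ∑' x, diff (mom (power μ m)) x ^ 2 ≤ 49 * C * τ := by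
      rcases Nat.eq_zero_or_pos m with rfl | hm0
      · rw [mom_power_zero]
        have : ∀ x, diff (0 : ℤ → ℝ) x ^ 2 = 0 := fun x => by simp [diff]
        simp only [this, tsum_zero]; positivity
      obtain ⟨-, hI2⟩ := hint n τ hτ (m - 1) (by omega)
      rw [(hasSum_sq_integral (summable_diff hmp)).tsum_eq]
      have hc := continuous_ft (summable_diff hmp)
      have hmn' : (m : ℝ) ≤ n := by exact_mod_cast hmn
      have hφ := phi_nonneg (μ := μ) τ
      calc ∫ t in (-(1 / 2) : ℝ)..(1 / 2), ‖ft (diff (mom (power μ m))) t‖ ^ 2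
          ≤ ∫ t in (-(1 / 2) : ℝ)..(1 / 2), 49 * τ ^ 2 * m ^ 2 * ((1 + |t| / τ) ^ 2 *
              ‖ft (mom (weight μ)) t‖ ^ 2 * ‖fourier μ t‖ ^ (m - 1)) := by
            refine intervalIntegral.integral_mono_on (by norm_num)
              ((by fun_prop : Continuous _).intervalIntegrable _ _)
              ((by fun_prop : Continuous _).intervalIntegrable _ _) fun t _ => ?_
            rw [ft_diff hmp, ft_mom_power h.moment, norm_mul, norm_mul, norm_mul, norm_pow,
              mul_pow, mul_pow, mul_pow]
            simp only [RCLike.norm_natCast]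
            calc _ ≤ (7 * |t|) ^ 2 * (m ^ 2 * (‖ft (mom (weight μ)) t‖ ^ 2 *
                    ‖fourier μ t‖ ^ (m - 1))) := by
                  gcongr
                  · exact norm_char_neg_one_sub_one_le t
                  · exact hsq1 t (m - 1)
              _ = 49 * |t| ^ 2 * m ^ 2 * ‖ft (mom (weight μ)) t‖ ^ 2 * ‖fourier μ t‖ ^ (m - 1) := by
                  ring
              _ ≤ 49 * (τ ^ 2 * (1 + |t| / τ) ^ 2) * m ^ 2 * ‖ft (mom (weight μ)) t‖ ^ 2
                    * ‖fourier μ t‖ ^ (m - 1) := by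
                  gcongr; exact habs t
              _ = _ := by ring
        _ ≤ 49 * τ ^ 2 * m ^ 2 * (C * (phi μ τ ^ 2 / τ)) := by
            rw [intervalIntegral.integral_const_mul]; gcongr
        _ = 49 * C * τ * (m * phi μ τ) ^ 2 := by field_simp
        _ ≤ 49 * C * τ * 1 := by
            gcongr
            refine pow_le_one₀ (by positivity) (le_trans ?_ hτ.le_one)
            gcongr
        _ = _ := mul_one _
    have hB2 : ∑' x, power μ m (x + 1) ^ 2 ≤ C * τ := by
      have h1 := (hasSum_sq_integral hp)
      have h2 : ∑' x, power μ m (x + 1) ^ 2 = ∑' x, power μ m x ^ 2 :=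
        (Equiv.addRight (1 : ℤ)).tsum_eq fun x => power μ m x ^ 2
      rw [h2, h1.tsum_eq]
      have hc := continuous_ft hp
      refine le_trans ?_ hI1
      refine intervalIntegral.integral_mono_on (by norm_num)
        ((by fun_prop : Continuous _).intervalIntegrable _ _)
        ((by fun_prop : Continuous _).intervalIntegrable _ _) fun t _ => ?_
      rw [ft_power, norm_pow]
      refine (hsq1 t m).trans (le_mul_of_one_le_left (by positivity) ?_)
      refine one_le_pow₀ ?_
      have : 0 ≤ |t| / τ := by positivity
      linarith
    have hsA := hs2 (summable_diff hmp)
    have hsB := hs2 (summable_shift hp 1)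
    have hle : ∀ x, mom (diff (power μ m)) x ^ 2
        ≤ 2 * diff (mom (power μ m)) x ^ 2 + 2 * power μ m (x + 1) ^ 2 := fun x => by
      rw [mom_diff]
      nlinarith [sq_nonneg (diff (mom (power μ m)) x + power μ m (x + 1))]
    refine ((hs2 hmd).tsum_le_tsum hle ((hsA.mul_left 2).add (hsB.mul_left 2))).trans ?_
    rw [(hsA.mul_left 2).tsum_add (hsB.mul_left 2), tsum_mul_left, tsum_mul_left]
    have : 0 ≤ C * τ := by positivity
    nlinarith

end Regular

theorem conv_shift (a b : ℤ → ℝ) (x : ℤ) : conv a (fun y => b (y + 1)) x = conv a b (x + 1) := by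
  unfold conv
  refine tsum_congr fun j => ?_
  simp only [show x - j + 1 = x + 1 - j by ring]

namespace Regular

/-- At scale 1/τ the kernel μᵐ is slowly varying: mass 1 and total variation O(τ). With windows of
length L ≈ 1/(2τ), each carrying second moment O(φ(τ)/τ²), the test costs 1/L + O(τ) = O(τ). -/
theorem exists_sum_sq_weight_power_le (h : Regular μ δ K c) : ∃ C : ℝ, 0 < C ∧ ∀ (n : ℕ) (τ : ℝ),
    IsScale μ δ n τ → ∀ m : ℕ, n ≤ 4 * m + 4 → m ≤ n → ∀ (S : Finset ℤ) (x : ℤ),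
      ∑ k ∈ S, (k : ℝ) ^ 2 * weight μ k * power μ m (x - k) ≤ C * (phi μ τ / τ) := by
  obtain ⟨C, hC, hdiff⟩ := h.exists_tsum_abs_diff_power_le
  refine ⟨10 * (4 + C), by positivity, fun n τ hτ m hnm hmn S x => ?_⟩
  have hτ0 := hτ.pos
  have hτδ := hτ.le
  have hδ := h.δ_le
  have hδ0 := h.δ_pos
  have hφ := phi_nonneg (μ := μ) τ
  set L := ⌊1 / (2 * τ)⌋₊ with hL
  have h1 : (L : ℝ) ≤ 1 / (2 * τ) := Nat.floor_le (by positivity)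
  have h2 : 1 / (2 * τ) < L + 1 := Nat.lt_floor_add_one _
  have h3 : 1 ≤ 1 / (4 * τ) := by rw [le_div_iff₀ (by positivity)]; linarith
  have h4 : 1 / (2 * τ) = 2 * (1 / (4 * τ)) := by field_simp; norm_num
  have h5 : 1 / (4 * τ) ≤ L := by linarith
  have hL0 : (0 : ℝ) < L := by linarith
  have hL1 : 1 ≤ L := by exact_mod_cast hL0
  have hLinv : 1 / (L : ℝ) ≤ 4 * τ := by
    rw [div_le_iff₀ hL0]
    rw [div_le_iff₀ (by positivity)] at h5
    linarith
  have hLτ : (L : ℝ) * τ ≤ 1 / 2 := by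
    rw [le_div_iff₀ (by positivity)] at h1; linarith
  have hwin := sum_mul_le_of_window (W := fun k : ℤ => (k : ℝ) ^ 2 * weight μ k) (u := power μ m)
    (fun k => mul_nonneg (sq_nonneg _) (weight_nonneg μ k)) (power_nonneg μ m) (summable_power μ m)
    hL1 (A := 10 * phi μ τ / τ ^ 2) (by positivity) (fun S x₀ hS =>
      sum_sq_weight_window_le h.convex hτ0 (by linarith) S x₀ fun k hk => by
        obtain ⟨ha, hb⟩ := hS k hk
        refine le_trans (mul_le_mul_of_nonneg_right ?_ hτ0.le) hLτ
        rw [abs_le]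
        have ha' : (0 : ℝ) ≤ ((k - x₀ : ℤ) : ℝ) := by exact_mod_cast sub_nonneg.2 ha
        have hb' : ((k - x₀ : ℤ) : ℝ) ≤ L := by
          have : k - x₀ ≤ (L : ℤ) := by omega
          exact_mod_cast this
        exact ⟨by linarith, hb'⟩) S x
  refine hwin.trans ?_
  rw [tsum_power]
  calc 10 * phi μ τ / τ ^ 2 * (1 / L + ∑' k, |diff (power μ m) k|)
      ≤ 10 * phi μ τ / τ ^ 2 * (4 * τ + C * τ) := by
        gcongr
        exact hdiff n τ hτ m hnm hmn
    _ = _ := by field_simp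

/-- Write μⁿ⁻¹ as a convolution of two nearly equal powers. The difference falls on one and costs
O(τ) in ℓ¹; the other absorbs k² μ(k) at cost O(φ(τ)/τ). The product with n is O(n φ(τ)). -/
theorem exists_sum_sq_weight_diff_power_le (h : Regular μ δ K c) : ∃ C : ℝ, 0 < C ∧
    ∀ n : ℕ, ∀ (S : Finset ℤ) (x : ℤ),
      (n : ℝ) * ∑ k ∈ S, (k : ℝ) ^ 2 * weight μ k * |diff (power μ (n - 1)) (x - k)| ≤ C := by
  obtain ⟨C₁, hC₁, hdiff⟩ := h.exists_tsum_abs_diff_power_le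
  obtain ⟨C₂, hC₂, hsq⟩ := h.exists_sum_sq_weight_power_le
  refine ⟨C₁ * C₂, by positivity, fun n S x => ?_⟩
  rcases Nat.eq_zero_or_pos n with rfl | hn
  · simp; positivity
  obtain ⟨τ, hτ⟩ := h.exists_scale hn
  have hτ0 := hτ.pos
  have hφ := phi_nonneg (μ := μ) τ
  set m := (n - 1) / 2 with hm
  set m' := n - 1 - m with hm'
  have e : n - 1 = m + m' := by omega
  have hp := summable_power μ m
  have hp' := summable_power μ m'
  have hd := summable_diff hp
  have hpt : ∀ y, |diff (power μ (n - 1)) y|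
      ≤ ∑' j, |diff (power μ m) j| * power μ m' (y - j) := fun y => by
    rw [e, power_add, diff_conv hp hp']
    refine tsum_of_norm_bounded (f := fun j => diff (power μ m) j * power μ m' (y - j))
      (summable_conv_term_of_summable hd.abs hp' y).hasSum fun j => ?_
    rw [norm_mul, Real.norm_eq_abs, Real.norm_eq_abs, abs_of_nonneg (power_nonneg μ m' _)]
  have hterm : ∀ k ∈ S, Summable fun j =>
      (k : ℝ) ^ 2 * weight μ k * (|diff (power μ m) j| * power μ m' (x - k - j)) := fun k _ =>
    (summable_conv_term_of_summable hd.abs hp' (x - k)).mul_left _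
  have hmain : ∑ k ∈ S, (k : ℝ) ^ 2 * weight μ k * |diff (power μ (n - 1)) (x - k)|
      ≤ C₁ * τ * (C₂ * (phi μ τ / τ)) := by
    calc _ ≤ ∑ k ∈ S, ∑' j, (k : ℝ) ^ 2 * weight μ k *
            (|diff (power μ m) j| * power μ m' (x - k - j)) := by
          refine Finset.sum_le_sum fun k _ => ?_
          rw [tsum_mul_left]
          exact mul_le_mul_of_nonneg_left (hpt _) (mul_nonneg (sq_nonneg _) (weight_nonneg μ k))
      _ = ∑' j, ∑ k ∈ S, (k : ℝ) ^ 2 * weight μ k *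
            (|diff (power μ m) j| * power μ m' (x - k - j)) :=
          (Summable.tsum_finsetSum hterm).symm
      _ ≤ ∑' j, |diff (power μ m) j| * (C₂ * (phi μ τ / τ)) := by
          refine Summable.tsum_le_tsum (fun j => ?_) (summable_sum hterm) (hd.abs.mul_right _)
          have h1 := hsq n τ hτ m' (by omega) (by omega) S (x - j)
          calc _ = |diff (power μ m) j| *
                ∑ k ∈ S, (k : ℝ) ^ 2 * weight μ k * power μ m' (x - j - k) := by
                rw [Finset.mul_sum]
                refine Finset.sum_congr rfl fun k _ => ?_
                rw [show x - j - k = x - k - j by ring]; ring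
            _ ≤ _ := mul_le_mul_of_nonneg_left h1 (abs_nonneg _)
      _ ≤ _ := by
          rw [tsum_mul_right]
          gcongr
          exact hdiff n τ hτ m (by omega) (by omega)
  calc _ ≤ (n : ℝ) * (C₁ * τ * (C₂ * (phi μ τ / τ))) := by gcongr
    _ = C₁ * C₂ * (n * phi μ τ) := by field_simp
    _ ≤ C₁ * C₂ * 1 := by gcongr; exact hτ.le_one
    _ = _ := mul_one _

/-- By inversion the supremum is at most n ∫ |θ'||θ|ⁿ⁻¹. The inequality z ≤ A/2 + z²/(2A) with A =
φ(τ)/τ, the typical size of θ', reduces this to the two weighted integrals. -/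
theorem exists_abs_mom_power_le (h : Regular μ δ K c) : ∃ C : ℝ, 0 < C ∧
    ∀ (n : ℕ) (x : ℤ), |mom (power μ n) x| ≤ C := by
  obtain ⟨C, hC, hint⟩ := h.exists_integral_le
  have hmom := continuous_ft (summable_mom_weight h.moment)
  refine ⟨C, by positivity, fun n x => ?_⟩
  rcases Nat.eq_zero_or_pos n with rfl | hn
  · rw [mom_power_zero]; simp; positivity
  obtain ⟨τ, hτ⟩ := h.exists_scale hn
  have hτ0 := hτ.pos
  have hφ : 0 < phi μ τ := h.phi_pos hτ0.ne' (by
    rw [abs_of_pos hτ0]; linarith [hτ.le, h.δ_le, h.δ_pos])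
  have hs := summable_mom_power h.moment n
  obtain ⟨hI1, hI2⟩ := hint n τ hτ (n - 1) (by omega)
  set A := phi μ τ / τ with hA
  have hA0 : 0 < A := by positivity
  refine (abs_le_integral_ft hs x).trans ?_
  have hc := continuous_ft hs
  calc ∫ t in (-(1 / 2) : ℝ)..(1 / 2), ‖ft (mom (power μ n)) t‖
      ≤ ∫ t in (-(1 / 2) : ℝ)..(1 / 2), (n * (A / 2) * ((1 + |t| / τ) ^ 2 * ‖fourier μ t‖ ^ (n - 1))
          + n * (1 / (2 * A)) * ((1 + |t| / τ) ^ 2 * ‖ft (mom (weight μ)) t‖ ^ 2 *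
            ‖fourier μ t‖ ^ (n - 1))) := by
        refine intervalIntegral.integral_mono_on (by norm_num)
          ((by fun_prop : Continuous _).intervalIntegrable _ _)
          ((by fun_prop : Continuous _).intervalIntegrable _ _) fun t _ => ?_
        rw [ft_mom_power h.moment, norm_mul, norm_mul, norm_pow]
        simp only [RCLike.norm_natCast]
        set z := ‖ft (mom (weight μ)) t‖ with hz
        have h1 : 1 ≤ (1 + |t| / τ) ^ 2 := by
          refine one_le_pow₀ ?_
          have : 0 ≤ |t| / τ := by positivity
          linarith
        have h2 : z ≤ A / 2 + 1 / (2 * A) * z ^ 2 := by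
          have h3 : 0 ≤ (A - z) ^ 2 / (2 * A) := by positivity
          have h4 : (A - z) ^ 2 / (2 * A) = A / 2 + 1 / (2 * A) * z ^ 2 - z := by
            field_simp; ring
          linarith
        calc (n : ℝ) * (z * ‖fourier μ t‖ ^ (n - 1))
            ≤ n * ((A / 2 + 1 / (2 * A) * z ^ 2) * ‖fourier μ t‖ ^ (n - 1)) := by gcongr
          _ ≤ n * ((A / 2 + 1 / (2 * A) * z ^ 2) * ‖fourier μ t‖ ^ (n - 1)) * (1 + |t| / τ) ^ 2 :=
              le_mul_of_one_le_right (by positivity) h1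
          _ = _ := by ring
    _ ≤ n * (A / 2) * (C * τ) + n * (1 / (2 * A)) * (C * (phi μ τ ^ 2 / τ)) := by
        rw [intervalIntegral.integral_add ((by fun_prop : Continuous _).intervalIntegrable _ _)
          ((by fun_prop : Continuous _).intervalIntegrable _ _),
          intervalIntegral.integral_const_mul, intervalIntegral.integral_const_mul]
        gcongr
    _ = C * (n * phi μ τ) := by rw [hA]; field_simp; ring
    _ ≤ C * 1 := by gcongr; exact hτ.le_one
    _ = C := mul_one C

/-- The transform is (e(-t) - 1) θ'² θⁿ⁻². The first factor gains τ, at the cost of the weight, and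
the rest integrates to O(φ(τ)²/τ), so the total is O((nφ(τ))²). -/
theorem exists_abs_conv_mom_conv_mom_diff_le (h : Regular μ δ K c) : ∃ C : ℝ, 0 < C ∧
    ∀ (n : ℕ) (x : ℤ), (n : ℝ) * ((n - 1 : ℕ) : ℝ) *
      |conv (mom (weight μ)) (conv (mom (weight μ)) (diff (power μ (n - 1 - 1)))) x| ≤ C := by
  obtain ⟨C, hC, hint⟩ := h.exists_integral_le
  have hκ := summable_mom_weight h.moment
  have hmom := continuous_ft hκ
  refine ⟨7 * C, by positivity, fun n x => ?_⟩
  rcases Nat.lt_or_ge n 2 with hn | hn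
  · have : n - 1 = 0 := by omega
    rw [this]; simp; positivity
  obtain ⟨τ, hτ⟩ := h.exists_scale (n := n) (by omega)
  have hτ0 := hτ.pos
  have hφ := phi_nonneg (μ := μ) τ
  have hp := summable_power μ (n - 1 - 1)
  have hd := summable_diff hp
  have hs1 := summable_conv hκ hd
  have hs := summable_conv hκ hs1
  obtain ⟨-, hI2⟩ := hint n τ hτ (n - 1 - 1) (by omega)
  have hc := continuous_ft hs
  have h1 : |conv (mom (weight μ)) (conv (mom (weight μ)) (diff (power μ (n - 1 - 1)))) x|
      ≤ 7 * τ * (C * (phi μ τ ^ 2 / τ)) := by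
    refine (abs_le_integral_ft hs x).trans ?_
    calc _ ≤ ∫ t in (-(1 / 2) : ℝ)..(1 / 2), 7 * τ * ((1 + |t| / τ) ^ 2 *
            ‖ft (mom (weight μ)) t‖ ^ 2 * ‖fourier μ t‖ ^ (n - 1 - 1)) := by
          refine intervalIntegral.integral_mono_on (by norm_num)
            ((by fun_prop : Continuous _).intervalIntegrable _ _)
            ((by fun_prop : Continuous _).intervalIntegrable _ _) fun t _ => ?_
          rw [ft_conv hκ hs1, ft_conv hκ hd, ft_diff hp, ft_power, norm_mul, norm_mul, norm_mul,
            norm_pow]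
          have h2 : ‖char (-1) t - 1‖ ≤ 7 * τ * (1 + |t| / τ) ^ 2 := by
            refine (norm_char_neg_one_sub_one_le t).trans ?_
            have h3 : |t| = τ * (|t| / τ) := by field_simp
            have h4 : |t| / τ ≤ (1 + |t| / τ) ^ 2 := by
              have : 0 ≤ |t| / τ := by positivity
              nlinarith
            calc 7 * |t| = 7 * τ * (|t| / τ) := by rw [mul_assoc, ← h3]
              _ ≤ _ := by gcongr
          calc _ = ‖char (-1) t - 1‖ * (‖ft (mom (weight μ)) t‖ ^ 2 *
                ‖fourier μ t‖ ^ (n - 1 - 1)) := by ring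
            _ ≤ 7 * τ * (1 + |t| / τ) ^ 2 * (‖ft (mom (weight μ)) t‖ ^ 2 *
                ‖fourier μ t‖ ^ (n - 1 - 1)) := by gcongr
            _ = _ := by ring
      _ ≤ _ := by rw [intervalIntegral.integral_const_mul]; gcongr
  have h2 : ((n - 1 : ℕ) : ℝ) ≤ n := by exact_mod_cast Nat.sub_le n 1
  calc _ ≤ (n : ℝ) * n * (7 * τ * (C * (phi μ τ ^ 2 / τ))) := by gcongr
    _ = 7 * C * (n * phi μ τ) ^ 2 := by field_simp
    _ ≤ 7 * C * 1 := by
        gcongr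
        exact pow_le_one₀ (by positivity) hτ.le_one
    _ = _ := mul_one _

/-- The kernel estimate `|μⁿ(x + 1) - μⁿ(x)| ≤ C / x²`, uniformly in `n`. -/
theorem exists_sq_mul_abs_diff_power_le (h : Regular μ δ K c) : ∃ C : ℝ, 0 < C ∧
    ∀ (n : ℕ) (x : ℤ), (x : ℝ) ^ 2 * |diff (power μ n) x| ≤ C := by
  obtain ⟨C₁, hC₁, h1⟩ := h.exists_sum_sq_weight_diff_power_le
  obtain ⟨C₂, hC₂, h2⟩ := h.exists_abs_mom_power_le
  obtain ⟨C₃, hC₃, h3⟩ := h.exists_abs_conv_mom_conv_mom_diff_le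
  refine ⟨C₁ + C₃ + 2 * C₂ + 1, by positivity, fun n x => ?_⟩
  have hκ := summable_mom_weight h.moment
  have hp := summable_power μ (n - 1)
  set e := diff (power μ (n - 1)) with he
  have hes : Summable e := summable_diff hp
  have hme : mom e = fun y => ((n - 1 : ℕ) : ℝ) *
      conv (mom (weight μ)) (diff (power μ (n - 1 - 1))) y - power μ (n - 1) (y + 1) :=
    funext fun y => mom_diff_power h.moment (n - 1) y
  have hcs := summable_conv hκ (summable_diff (summable_power μ (n - 1 - 1)))
  have hmes : Summable (mom e) := by
    rw [hme]; exact (hcs.mul_left _).sub (summable_shift hp 1)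
  -- The splitting k² = xk - k(x - k) expresses x(κ * Δμⁿ⁻¹)(x) through this second moment sum and a
  -- convolution with the moment of Δμⁿ⁻¹. Only absolute values of W need be summable, not k² μ(k).
  set W : ℤ → ℝ := fun k => (k : ℝ) ^ 2 * weight μ k * e (x - k) with hW
  have hWeq : W = fun k => (x : ℝ) * (mom (weight μ) k * e (x - k))
      - mom (weight μ) k * mom e (x - k) := by
    ext k; simp only [hW, mom]; push_cast; ring
  have hs1 := (summable_conv_term_of_summable hκ hes x).mul_left (x : ℝ)
  have hs2 := summable_conv_term_of_summable hκ hmes x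
  have hWs : Summable W := by rw [hWeq]; exact hs1.sub hs2
  have hWt : ∑' k, W k = x * conv (mom (weight μ)) e x - conv (mom (weight μ)) (mom e) x := by
    rw [hWeq, hs1.tsum_sub hs2, tsum_mul_left]; rfl
  have hWb : (n : ℝ) * |∑' k, W k| ≤ C₁ := by
    rcases Nat.eq_zero_or_pos n with hn | hn
    · rw [hn]; simp; positivity
    have hn0 : (0 : ℝ) < n := by exact_mod_cast hn
    rw [mul_comm, ← le_div_iff₀ hn0]
    refine (norm_tsum_le_tsum_norm hWs.norm).trans (hWs.norm.tsum_le_of_sum_le fun S => ?_)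
    rw [le_div_iff₀ hn0, mul_comm]
    refine le_trans (le_of_eq ?_) (h1 n S x)
    congr 1
    refine Finset.sum_congr rfl fun k _ => ?_
    simp only [hW, Real.norm_eq_abs]
    rw [abs_mul, abs_of_nonneg (mul_nonneg (sq_nonneg _) (weight_nonneg μ k))]
  have hcm : conv (mom (weight μ)) (mom e) x = ((n - 1 : ℕ) : ℝ) *
      conv (mom (weight μ)) (conv (mom (weight μ)) (diff (power μ (n - 1 - 1)))) x
        - conv (mom (weight μ)) (power μ (n - 1)) (x + 1) := by
    rw [← conv_shift, hme]
    simp only [conv]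
    rw [← tsum_mul_left, ← Summable.tsum_sub]
    · exact tsum_congr fun j => by ring
    · exact (summable_conv_term_of_summable hκ hcs x).mul_left _
    · exact summable_conv_term_of_summable hκ (summable_shift hp 1) x
  have hmu : mom (power μ n) (x + 1) = n * conv (mom (weight μ)) (power μ (n - 1)) (x + 1) := by
    rw [mom_power_eq h.moment]
  have hmu' : mom (power μ n) (x + 1) = x * power μ n (x + 1) + power μ n (x + 1) := by
    simp only [mom]; push_cast; ring
  have hd := mom_diff_power h.moment n x
  rw [← he] at hd
  -- The moment identity is used at n for one factor x and at n - 1 for the other. The terms in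
  -- μⁿ(x+1) are what shifting leaves behind.
  have hid : (x : ℝ) ^ 2 * diff (power μ n) x = n * ∑' k, W k
      + n * ((n - 1 : ℕ) : ℝ) *
        conv (mom (weight μ)) (conv (mom (weight μ)) (diff (power μ (n - 1 - 1)))) x
      - 2 * mom (power μ n) (x + 1) + power μ n (x + 1) := by
    have hx : (x : ℝ) ^ 2 * diff (power μ n) x = x * mom (diff (power μ n)) x := by
      simp only [mom]; ring
    rw [hx, hd, hWt, hcm]
    linear_combination hmu + hmu'
  rw [← abs_of_nonneg (sq_nonneg (x : ℝ)), ← abs_mul, hid]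
  have b1 : |(n : ℝ) * ∑' k, W k| ≤ C₁ := by rw [abs_mul, Nat.abs_cast]; exact hWb
  have b2 : |(n : ℝ) * ((n - 1 : ℕ) : ℝ) *
      conv (mom (weight μ)) (conv (mom (weight μ)) (diff (power μ (n - 1 - 1)))) x| ≤ C₃ := by
    rw [abs_mul, abs_mul, Nat.abs_cast, Nat.abs_cast]; exact h3 n x
  have b3 := h2 n (x + 1)
  have b4 := power_nonneg μ n (x + 1)
  have b5 := power_le_one μ n (x + 1)
  rw [abs_le] at b1 b2 b3 ⊢
  constructor <;> linarith [b1.1, b1.2, b2.1, b2.2, b3.1, b3.2]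

/-- The norm is O(τ), and c τ² ≤ φ(τ) ≤ 1/n forces τ ≤ (cn)^(-1/2). -/
theorem tendsto_tsum_abs_diff_power (h : Regular μ δ K c) :
    Tendsto (fun n => ∑' k, |diff (power μ n) k|) atTop (𝓝 0) := by
  obtain ⟨C, hC, hdiff⟩ := h.exists_tsum_abs_diff_power_le
  have hc := h.c_pos
  have hlim : Tendsto (fun n : ℕ => C * Real.sqrt (1 / c * (1 / (n : ℝ)))) atTop (𝓝 0) := by
    have h1 := (tendsto_one_div_atTop_nhds_zero_nat (𝕜 := ℝ)).const_mul (1 / c)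
    rw [mul_zero] at h1
    have h2 := (Real.continuous_sqrt.tendsto 0).comp h1
    rw [Real.sqrt_zero] at h2
    simpa using h2.const_mul C
  refine squeeze_zero' (Eventually.of_forall fun n => tsum_nonneg fun k => abs_nonneg _) ?_ hlim
  filter_upwards [eventually_ge_atTop 1] with n hn
  obtain ⟨τ, hτ⟩ := h.exists_scale hn
  have hτ0 := hτ.pos
  have hn0 : (0 : ℝ) < n := by exact_mod_cast hn
  refine (hdiff n τ hτ n (by omega) le_rfl).trans ?_
  gcongr
  apply Real.le_sqrt_of_sq_le
  have h1 := h.lower τ (by rw [abs_of_pos hτ0]; linarith [hτ.le, h.δ_le, h.δ_pos])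
  have h2 : n * (c * τ ^ 2) ≤ 1 := (mul_le_mul_of_nonneg_left h1 hn0.le).trans hτ.le_one
  rw [one_div_mul_one_div, le_div_iff₀ (by positivity)]
  linarith

end Regular

/-! ### The weak type inequality on `ℤ` -/

/-- The dyadic interval of generation `s` with index `q`. -/
noncomputable def dyadic (s : ℕ) (q : ℤ) : Finset ℤ := Finset.Ico (q * 2 ^ s) (q * 2 ^ s + 2 ^ s)

theorem mem_dyadic {s : ℕ} {q i : ℤ} : i ∈ dyadic s q ↔ i / 2 ^ s = q := by
  have hR : (0 : ℤ) < 2 ^ s := by positivity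
  rw [dyadic, Finset.mem_Ico]
  constructor
  · rintro ⟨h1, h2⟩
    apply le_antisymm
    · rw [← Int.lt_add_one_iff, Int.ediv_lt_iff_lt_mul hR]
      linarith
    · rwa [Int.le_ediv_iff_mul_le hR]
  · rintro rfl
    have := Int.ediv_mul_le i hR.ne'
    have := Int.lt_ediv_add_one_mul_self i hR
    constructor <;> linarith

theorem card_dyadic (s : ℕ) (q : ℤ) : ((dyadic s q).card : ℝ) = 2 ^ s := by
  have : (dyadic s q).card = 2 ^ s := by
    rw [dyadic, Int.card_Ico]
    have : q * 2 ^ s + 2 ^ s - q * 2 ^ s = ((2 ^ s : ℕ) : ℤ) := by push_cast; ring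
    rw [this, Int.toNat_natCast]
  rw [this]; push_cast; rfl

theorem ediv_two_pow_eq_of_le {i j : ℤ} {s t : ℕ} (hst : s ≤ t) (h : i / 2 ^ s = j / 2 ^ s) :
    i / 2 ^ t = j / 2 ^ t := by
  obtain ⟨r, rfl⟩ := Nat.exists_eq_add_of_le hst
  have h0 : (0 : ℤ) ≤ 2 ^ s := by positivity
  rw [pow_add, ← Int.ediv_ediv_of_nonneg h0, ← Int.ediv_ediv_of_nonneg h0, h]

/-- The average of `a` over a dyadic interval. -/
noncomputable def dyadicAvg (a : ℤ → ℝ) (s : ℕ) (q : ℤ) : ℝ := (∑ k ∈ dyadic s q, a k) / 2 ^ s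

/-- Telescoping: all r steps take place at distance at least |x|/2 from 0, where a difference is at
most 4C/x². -/
theorem abs_sub_le_of_sq_mul_abs_diff_le {u : ℤ → ℝ} {C : ℝ}
    (hC : ∀ x : ℤ, (x : ℝ) ^ 2 * |diff u x| ≤ C) {x : ℤ} {r : ℕ} (hr : 2 * (r : ℝ) ≤ |(x : ℝ)|)
    (hx : x ≠ 0) : |u (x + r) - u x| ≤ r * (4 * C / (x : ℝ) ^ 2) := by
  have hx' : (x : ℝ) ≠ 0 := by exact_mod_cast hx
  have hx2 : 0 < (x : ℝ) ^ 2 := by positivity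
  suffices ∀ i : ℕ, i ≤ r → |u (x + i) - u x| ≤ i * (4 * C / (x : ℝ) ^ 2) from this r le_rfl
  intro i
  induction i with
  | zero => simp
  | succ i ih =>
    intro hi
    have h1 := ih (by omega)
    have hi' : ((i : ℝ) + 1) ≤ r := by exact_mod_cast hi
    have h2 : |(x : ℝ)| / 2 ≤ |((x + i : ℤ) : ℝ)| := by
      push_cast
      have := abs_sub_abs_le_abs_sub (x : ℝ) (-(i : ℝ))
      rw [abs_neg, Nat.abs_cast, sub_neg_eq_add] at this
      linarith
    have h3 : (x : ℝ) ^ 2 / 4 ≤ ((x + i : ℤ) : ℝ) ^ 2 := by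
      rw [← sq_abs (x : ℝ), ← sq_abs ((x + i : ℤ) : ℝ)]
      have := pow_le_pow_left₀ (by positivity) h2 2
      linarith [show (|(x : ℝ)| / 2) ^ 2 = |(x : ℝ)| ^ 2 / 4 by ring]
    have h4 : |diff u (x + i)| ≤ 4 * C / (x : ℝ) ^ 2 := by
      rw [le_div_iff₀ hx2]
      have h5 := hC (x + i)
      have h6 := mul_le_mul_of_nonneg_right h3 (abs_nonneg (diff u (x + i)))
      linarith
    have e : u (x + ((i + 1 : ℕ) : ℤ)) - u x = diff u (x + i) + (u (x + i) - u x) := by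
      simp only [diff]; push_cast; rw [← add_assoc]; ring
    rw [e]
    refine (abs_add_le _ _).trans ?_
    push_cast
    linarith

theorem sum_inv_sq_le {R : ℝ} (hR : 1 ≤ R) (i₀ : ℤ) (E : Finset ℤ)
    (hE : ∀ j ∈ E, 2 * R ≤ |((i₀ - j : ℤ) : ℝ)|) :
    ∑ j ∈ E, 1 / ((i₀ - j : ℤ) : ℝ) ^ 2 ≤ 16 / R := by
  have hR0 : 0 < R := by linarith
  obtain ⟨hs, hle⟩ := hasSum_int_inv_sq_le (τ := 1 / R) (by positivity)
    (by rw [div_le_one hR0]; exact hR)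
  have hinj : Function.Injective fun j : ℤ => i₀ - j := fun a b hab => by simpa using hab
  calc ∑ j ∈ E, 1 / ((i₀ - j : ℤ) : ℝ) ^ 2
      ≤ ∑ j ∈ E, 4 / R ^ 2 * (1 / (1 + 1 / R * |((i₀ - j : ℤ) : ℝ)|) ^ 2) := by
        refine Finset.sum_le_sum fun j hj => ?_
        have h1 := hE j hj
        set d := |((i₀ - j : ℤ) : ℝ)| with hd
        have hd0 : 0 < d := by linarith
        rw [← sq_abs, ← hd]
        have h2 : 1 + 1 / R * d ≤ 2 * d / R := by
          rw [one_div_mul_eq_div, ← sub_nonneg]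
          have : 2 * d / R - (1 + d / R) = (d - R) / R := by field_simp; ring
          rw [this]; exact div_nonneg (by linarith) hR0.le
        calc 1 / d ^ 2 = 4 / R ^ 2 * (1 / (2 * d / R) ^ 2) := by field_simp; ring
          _ ≤ _ := by gcongr
    _ = 4 / R ^ 2 * ∑ x ∈ E.map ⟨_, hinj⟩, 1 / (1 + 1 / R * |(x : ℝ)|) ^ 2 := by
        rw [← Finset.mul_sum, Finset.sum_map]; rfl
    _ ≤ 4 / R ^ 2 * (4 / (1 / R)) := by
        gcongr
        exact (hs.sum_le_tsum _ fun x _ => by positivity).trans hle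
    _ = 16 / R := by field_simp; ring

/-- The cancellation step. Since a - A has sum zero on the interval, u may be replaced by its
deviation from the value at the left endpoint, and |a - A| ≤ a + A has sum 2∑a. -/
theorem sum_mul_sub_avg_le {a u : ℤ → ℝ} (ha : ∀ k, 0 ≤ a k) {C : ℝ} (hC0 : 0 ≤ C)
    (hC : ∀ x : ℤ, (x : ℝ) ^ 2 * |diff u x| ≤ C) (s : ℕ) (q j : ℤ)
    (hj : 2 * (2 : ℝ) ^ s ≤ |((q * 2 ^ s - j : ℤ) : ℝ)|) :
    ∑ i ∈ dyadic s q, a i * u (i - j) ≤ dyadicAvg a s q * ∑ i ∈ dyadic s q, u (i - j)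
      + 8 * C * 2 ^ s * (∑ i ∈ dyadic s q, a i) * (1 / ((q * 2 ^ s - j : ℤ) : ℝ) ^ 2) := by
  set i₀ := q * 2 ^ s with hi₀
  set x := i₀ - j with hx
  set A := dyadicAvg a s q with hA
  have hR : (0 : ℝ) < 2 ^ s := by positivity
  have hA0 : 0 ≤ A := div_nonneg (Finset.sum_nonneg fun k _ => ha k) hR.le
  have hsum : ∑ i ∈ dyadic s q, (a i - A) = 0 := by
    rw [Finset.sum_sub_distrib, Finset.sum_const, nsmul_eq_mul, card_dyadic, hA, dyadicAvg]
    field_simp; ring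
  have hx0 : x ≠ 0 := by
    intro h0; rw [h0] at hj; simp at hj; linarith
  have e : ∑ i ∈ dyadic s q, a i * u (i - j) - A * ∑ i ∈ dyadic s q, u (i - j)
      = ∑ i ∈ dyadic s q, (a i - A) * (u (i - j) - u x) := by
    have h2 : ∑ i ∈ dyadic s q, (a i - A) * u x = 0 := by rw [← Finset.sum_mul, hsum, zero_mul]
    have h3 : ∑ i ∈ dyadic s q, (a i - A) * (u (i - j) - u x)
        = ∑ i ∈ dyadic s q, (a i - A) * u (i - j) - ∑ i ∈ dyadic s q, (a i - A) * u x := by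
      rw [← Finset.sum_sub_distrib]
      exact Finset.sum_congr rfl fun i _ => mul_sub _ _ _
    rw [h3, h2, sub_zero, Finset.mul_sum, ← Finset.sum_sub_distrib]
    exact Finset.sum_congr rfl fun i _ => (sub_mul _ _ _).symm
  have hb : ∑ i ∈ dyadic s q, (a i - A) * (u (i - j) - u x)
      ≤ ∑ i ∈ dyadic s q, (a i + A) * (2 ^ s * (4 * C / (x : ℝ) ^ 2)) := by
    refine Finset.sum_le_sum fun i hi => ?_
    rw [dyadic, Finset.mem_Ico] at hi
    obtain ⟨r, hr⟩ : ∃ r : ℕ, i = i₀ + r := ⟨(i - i₀).toNat, by omega⟩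
    have hr2 : (r : ℝ) ≤ 2 ^ s := by
      have : (r : ℤ) ≤ 2 ^ s := by omega
      exact_mod_cast this
    have h1 : i - j = x + r := by rw [hx, hr]; ring
    have h2 := abs_sub_le_of_sq_mul_abs_diff_le hC (x := x) (r := r) (by linarith) hx0
    rw [h1]
    calc _ ≤ |(a i - A) * (u (x + r) - u x)| := le_abs_self _
      _ = |a i - A| * |u (x + r) - u x| := abs_mul _ _
      _ ≤ (a i + A) * (r * (4 * C / (x : ℝ) ^ 2)) := by
          refine mul_le_mul ?_ h2 (abs_nonneg _) (by linarith [ha i])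
          rw [abs_le]; constructor <;> linarith [ha i]
      _ ≤ _ := by
          have := ha i
          gcongr
  have hsumA : ∑ i ∈ dyadic s q, (a i + A) = 2 * ∑ i ∈ dyadic s q, a i := by
    rw [Finset.sum_add_distrib, Finset.sum_const, nsmul_eq_mul, card_dyadic, hA, dyadicAvg]
    field_simp; ring
  rw [← Finset.sum_mul, hsumA] at hb
  have e2 : 2 * (∑ i ∈ dyadic s q, a i) * (2 ^ s * (4 * C / (x : ℝ) ^ 2))
      = 8 * C * 2 ^ s * (∑ i ∈ dyadic s q, a i) * (1 / (x : ℝ) ^ 2) := by ring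
  linarith

/-- Calderón–Zygmund decomposition of a finitely supported function: a finite family of disjoint
dyadic intervals of average between `l` and `2l`, off which the function is at most `l`. -/
theorem exists_dyadic_family {a : ℤ → ℝ} (ha : ∀ k, 0 ≤ a k) {F : Finset ℤ}
    (hF : ∀ k, k ∉ F → a k = 0) {l : ℝ} (hl : 0 < l) :
    ∃ P : Finset (ℕ × ℤ), (P : Set (ℕ × ℤ)).PairwiseDisjoint (fun p => dyadic p.1 p.2) ∧
      (∀ p ∈ P, l < dyadicAvg a p.1 p.2 ∧ dyadicAvg a p.1 p.2 ≤ 2 * l) ∧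
      ∀ k, (∀ p ∈ P, k ∉ dyadic p.1 p.2) → a k ≤ l := by
  classical
  have hsumF : ∀ s q, ∑ k ∈ dyadic s q, a k ≤ ∑ k ∈ F, a k := fun s q => by
    calc ∑ k ∈ dyadic s q, a k ≤ ∑ k ∈ dyadic s q ∪ F, a k :=
          Finset.sum_le_sum_of_subset_of_nonneg Finset.subset_union_left fun k _ _ => ha k
      _ = ∑ k ∈ F, a k := (Finset.sum_subset Finset.subset_union_right fun k _ hk => hF k hk).symm
  -- The total mass is finite, so long intervals have average at most l.
  obtain ⟨N, hN⟩ : ∃ N : ℕ, ∀ s, N ≤ s → ∀ q, dyadicAvg a s q ≤ l := by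
    obtain ⟨N, hN⟩ := pow_unbounded_of_one_lt ((∑ k ∈ F, a k) / l) (one_lt_two (α := ℝ))
    refine ⟨N, fun s hs q => ?_⟩
    rw [dyadicAvg, div_le_iff₀ (by positivity)]
    rw [div_lt_iff₀ hl] at hN
    have : (2 : ℝ) ^ N ≤ 2 ^ s := pow_le_pow_right₀ one_le_two hs
    have := hsumF s q
    nlinarith
  set good : ℤ → ℕ → Prop := fun i s => l < dyadicAvg a s (i / 2 ^ s) with hgood
  have hlt : ∀ i s, good i s → s < N := fun i s h => by
    by_contra hc
    exact absurd h (not_lt.2 (hN s (not_lt.1 hc) _))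
  -- The largest good generation; it defaults to 0 when there is none, which is why goodness at σ is
  -- always required separately.
  set σ : ℤ → ℕ := fun i => Nat.findGreatest (good i) N with hσ
  have hσ_good : ∀ i s, good i s → good i (σ i) := fun i s h =>
    Nat.findGreatest_spec (hlt i s h).le h
  have hσ_max : ∀ i s, σ i < s → ¬ good i s := fun i s h hg =>
    absurd (Nat.le_findGreatest (hlt i s hg).le hg) (not_le.2 h)
  -- All points of a selected interval select that same interval, so selected intervals are
  -- disjoint.
  have hσ_eq : ∀ i k, good k (σ k) → i / 2 ^ σ k = k / 2 ^ σ k → σ i = σ k := fun i k hk h => by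
    have hi : good i (σ k) := by simp only [hgood]; rw [h]; exact hk
    apply le_antisymm
    · by_contra hc
      push Not at hc
      have h1 := hσ_good i _ hi
      refine hσ_max k (σ i) hc ?_
      have h2 := ediv_two_pow_eq_of_le hc.le h
      simp only [hgood] at h1 ⊢
      rw [← h2]; exact h1
    · exact Nat.le_findGreatest (hlt i _ hi).le hi
  set π : ℤ → ℕ × ℤ := fun i => (σ i, i / 2 ^ σ i) with hπ
  refine ⟨(F.filter fun i => good i (σ i)).image π, ?_, ?_, ?_⟩
  · intro p hp p' hp' hne
    simp only [Finset.coe_image, Set.mem_image, Finset.coe_filter, Set.mem_ofPred_eq] at hp hp'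
    obtain ⟨k, ⟨-, hk⟩, rfl⟩ := hp
    obtain ⟨k', ⟨-, hk'⟩, rfl⟩ := hp'
    rw [Function.onFun, Finset.disjoint_left]
    intro i hi hi'
    rw [mem_dyadic] at hi hi'
    have h1 := hσ_eq i k hk hi
    have h2 := hσ_eq i k' hk' hi'
    apply hne
    simp only [hπ] at hi hi' ⊢
    rw [← hi, ← hi', ← h1, ← h2]
  · intro p hp
    rw [Finset.mem_image] at hp
    obtain ⟨k, hk, rfl⟩ := hp
    have hk' := (Finset.mem_filter.1 hk).2
    refine ⟨hk', ?_⟩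
    -- The parent has average at most l and twice the length, so the selected interval has average
    -- at most 2l.
    have h1 : ¬ good k (σ k + 1) := hσ_max k _ (Nat.lt_succ_self _)
    simp only [hgood, not_lt] at h1
    simp only [hπ]
    rw [dyadicAvg, div_le_iff₀ (by positivity)] at h1 ⊢
    have h2 : ∑ i ∈ dyadic (σ k) (k / 2 ^ σ k), a i
        ≤ ∑ i ∈ dyadic (σ k + 1) (k / 2 ^ (σ k + 1)), a i := by
      refine Finset.sum_le_sum_of_subset_of_nonneg (fun i hi => ?_) fun i _ _ => ha i
      rw [mem_dyadic] at hi ⊢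
      exact ediv_two_pow_eq_of_le (Nat.le_succ _) hi
    have h3 : l * 2 ^ (σ k + 1) = 2 * l * 2 ^ σ k := by ring
    linarith
  · intro k hk
    by_contra hc
    push Not at hc
    have h0 : good k 0 := by
      have : dyadic 0 k = {k} := by
        ext i; rw [mem_dyadic]; simp
      simp only [hgood, dyadicAvg, pow_zero, Int.ediv_one, this, Finset.sum_singleton, div_one]
      exact hc
    have h1 := hσ_good k 0 h0
    have hkF : k ∈ F := by
      by_contra hkF
      rw [hF k hkF] at hc; linarith
    refine hk (π k) (Finset.mem_image_of_mem _ (Finset.mem_filter.2 ⟨hkF, h1⟩)) ?_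
    rw [mem_dyadic]

/-- Points near a selected interval are counted: at most 4·2ˢ per interval, with l·2ˢ less than its
mass. At any other point, replacing the function by its averages contributes at most 2l, as the
kernel has mass at most 1; the error must then exceed l. By cancellation it is a sum of terms
8C·2ˢ·mass/d², dominated independently of n. Summing over far points gives 16/2ˢ per interval, hence
128 = 8·16. -/
theorem weak_type_int {ι : Type*} {u : ι → ℤ → ℝ} (hu0 : ∀ n k, 0 ≤ u n k)
    (hus : ∀ n, Summable (u n)) (hu1 : ∀ n, ∑' k, u n k ≤ 1) {C : ℝ} (hC0 : 0 ≤ C)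
    (hC : ∀ n, ∀ x : ℤ, (x : ℝ) ^ 2 * |diff (u n) x| ≤ C) {a : ℤ → ℝ} (ha : ∀ k, 0 ≤ a k)
    {F : Finset ℤ} (hF : ∀ k, k ∉ F → a k = 0) {l : ℝ} (hl : 0 < l) (E : Finset ℤ)
    (hE : ∀ j ∈ E, ∃ n, 3 * l < ∑ i ∈ F, a i * u n (i - j)) :
    l * (E.card : ℝ) ≤ (128 * C + 4) * ∑ k ∈ F, a k := by
  classical
  obtain ⟨P, hdisj, hP, hoff⟩ := exists_dyadic_family ha hF hl
  set Ω := P.biUnion fun p => dyadic p.1 p.2 with hΩ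
  have hsumΩ : ∀ f : ℤ → ℝ, ∑ k ∈ Ω, f k = ∑ p ∈ P, ∑ k ∈ dyadic p.1 p.2, f k := fun f =>
    Finset.sum_biUnion hdisj
  have hmass : ∑ p ∈ P, ∑ k ∈ dyadic p.1 p.2, a k ≤ ∑ k ∈ F, a k := by
    rw [← hsumΩ]
    calc ∑ k ∈ Ω, a k ≤ ∑ k ∈ Ω ∪ F, a k :=
          Finset.sum_le_sum_of_subset_of_nonneg Finset.subset_union_left fun k _ _ => ha k
      _ = ∑ k ∈ F, a k := (Finset.sum_subset Finset.subset_union_right fun k _ hk => hF k hk).symm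
  set near : ℕ × ℤ → ℤ → Prop := fun p j => |((p.2 * 2 ^ p.1 - j : ℤ) : ℝ)| < 2 * 2 ^ p.1
    with hnear
  set E₁ := E.filter fun j => ∃ p ∈ P, near p j with hE₁
  set E₂ := E.filter fun j => ¬ ∃ p ∈ P, near p j with hE₂
  have hcard : (E.card : ℝ) = E₁.card + E₂.card := by
    rw [← Nat.cast_add, Finset.card_filter_add_card_filter_not]
  have hb1 : l * (E₁.card : ℝ) ≤ 4 * ∑ k ∈ F, a k := by
    have hsub : E₁ ⊆ P.biUnion fun p => Finset.Ioo (p.2 * 2 ^ p.1 - 2 * 2 ^ p.1)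
        (p.2 * 2 ^ p.1 + 2 * 2 ^ p.1) := by
      intro j hj
      obtain ⟨p, hp, hpj⟩ := (Finset.mem_filter.1 hj).2
      refine Finset.mem_biUnion.2 ⟨p, hp, ?_⟩
      simp only [hnear] at hpj
      rw [Finset.mem_Ioo]
      have : |p.2 * 2 ^ p.1 - j| < 2 * 2 ^ p.1 := by exact_mod_cast hpj
      rw [abs_lt] at this
      constructor <;> linarith [this.1, this.2]
    have h1 : (E₁.card : ℝ) ≤ ∑ p ∈ P, 4 * (2 : ℝ) ^ p.1 := by
      have h2 := (Finset.card_le_card hsub).trans Finset.card_biUnion_le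
      have h3 : ∀ p ∈ P, (Finset.Ioo (p.2 * 2 ^ p.1 - 2 * 2 ^ p.1)
          (p.2 * 2 ^ p.1 + 2 * 2 ^ p.1)).card ≤ 4 * 2 ^ p.1 := fun p _ => by
        rw [Int.card_Ioo]
        have : (((4 * 2 ^ p.1 : ℕ)) : ℤ) = 4 * 2 ^ p.1 := by push_cast; ring
        omega
      have h4 := h2.trans (Finset.sum_le_sum h3)
      exact_mod_cast h4
    calc l * (E₁.card : ℝ) ≤ l * ∑ p ∈ P, 4 * (2 : ℝ) ^ p.1 := by gcongr
      _ = 4 * ∑ p ∈ P, l * (2 : ℝ) ^ p.1 := by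
          rw [Finset.mul_sum, Finset.mul_sum]
          exact Finset.sum_congr rfl fun p _ => by ring
      _ ≤ 4 * ∑ p ∈ P, ∑ k ∈ dyadic p.1 p.2, a k := by
          gcongr with p hp
          have := (hP p hp).1
          rw [dyadicAvg, lt_div_iff₀ (by positivity)] at this
          exact this.le
      _ ≤ _ := by gcongr
  have hb2 : l * (E₂.card : ℝ) ≤ 128 * C * ∑ k ∈ F, a k := by
    set V : ℕ × ℤ → ℤ → ℝ := fun p j => 8 * C * 2 ^ p.1 * (∑ i ∈ dyadic p.1 p.2, a i)
      * (1 / ((p.2 * 2 ^ p.1 - j : ℤ) : ℝ) ^ 2) with hV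
    have hpt : ∀ j ∈ E₂, l ≤ ∑ p ∈ P, V p j := by
      intro j hj
      obtain ⟨hjE, hjP⟩ := Finset.mem_filter.1 hj
      obtain ⟨n, hn⟩ := hE j hjE
      have h1 : ∑ i ∈ F, a i * u n (i - j)
          ≤ ∑ i ∈ F \ Ω, a i * u n (i - j) + ∑ i ∈ Ω, a i * u n (i - j) := by
        rw [← Finset.sum_union Finset.sdiff_disjoint, Finset.sdiff_union_self_eq_union]
        exact Finset.sum_le_sum_of_subset_of_nonneg Finset.subset_union_left
          fun i _ _ => mul_nonneg (ha i) (hu0 n _)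
      have h2 : ∑ i ∈ F \ Ω, a i * u n (i - j) ≤ 2 * l * ∑ i ∈ F \ Ω, u n (i - j) := by
        rw [Finset.mul_sum]
        refine Finset.sum_le_sum fun i hi => mul_le_mul_of_nonneg_right ?_ (hu0 n _)
        have := hoff i fun p hp hip => (Finset.mem_sdiff.1 hi).2 (Finset.mem_biUnion.2 ⟨p, hp, hip⟩)
        linarith
      have h3 : ∑ i ∈ Ω, a i * u n (i - j) ≤ 2 * l * ∑ i ∈ Ω, u n (i - j) + ∑ p ∈ P, V p j := by
        rw [hsumΩ, hsumΩ, Finset.mul_sum, ← Finset.sum_add_distrib]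
        refine Finset.sum_le_sum fun p hp => ?_
        have hfar : ¬ near p j := fun h => hjP ⟨p, hp, h⟩
        refine (sum_mul_sub_avg_le ha hC0 (hC n) p.1 p.2 j (not_lt.1 hfar)).trans ?_
        gcongr
        · exact Finset.sum_nonneg fun i _ => hu0 n _
        · exact (hP p hp).2
      have h4 : ∑ i ∈ F \ Ω, u n (i - j) + ∑ i ∈ Ω, u n (i - j) ≤ 1 := by
        rw [← Finset.sum_union Finset.sdiff_disjoint]
        refine le_trans ?_ (hu1 n)
        have hs : Summable fun i => u n (i - j) := by
          simpa [sub_eq_add_neg] using summable_shift (hus n) (-j)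
        refine (hs.sum_le_tsum _ fun i _ => hu0 n _).trans (le_of_eq ?_)
        exact (Equiv.subRight j).tsum_eq (u n)
      nlinarith
    have hV0 : ∀ p j, 0 ≤ V p j := fun p j => by
      have : 0 ≤ ∑ i ∈ dyadic p.1 p.2, a i := Finset.sum_nonneg fun k _ => ha k
      simp only [hV]; positivity
    calc l * (E₂.card : ℝ) = ∑ j ∈ E₂, l := by rw [Finset.sum_const, nsmul_eq_mul, mul_comm]
      _ ≤ ∑ j ∈ E₂, ∑ p ∈ P, V p j := Finset.sum_le_sum hpt
      _ = ∑ p ∈ P, ∑ j ∈ E₂, V p j := Finset.sum_comm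
      _ ≤ ∑ p ∈ P, 128 * C * ∑ i ∈ dyadic p.1 p.2, a i := by
          refine Finset.sum_le_sum fun p hp => ?_
          simp only [hV]
          rw [← Finset.mul_sum]
          have hA : 0 ≤ ∑ i ∈ dyadic p.1 p.2, a i := Finset.sum_nonneg fun k _ => ha k
          have h5 := sum_inv_sq_le (R := 2 ^ p.1) (one_le_pow₀ one_le_two) (p.2 * 2 ^ p.1) E₂
            fun j hj => not_lt.1 fun h => (Finset.mem_filter.1 hj).2 ⟨p, hp, h⟩
          calc _ ≤ 8 * C * 2 ^ p.1 * (∑ i ∈ dyadic p.1 p.2, a i) * (16 / 2 ^ p.1) := by gcongr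
            _ = _ := by field_simp; ring
      _ = 128 * C * ∑ p ∈ P, ∑ i ∈ dyadic p.1 p.2, a i := by rw [Finset.mul_sum]
      _ ≤ _ := by gcongr
  rw [hcard]
  linarith

variable {X : Type*} [MeasurableSpace X] {P : Measure X} {T : X ≃ᵐ X}

/-! ### Transference to a measure-preserving system -/

theorem measurePreserving_zpow (hT : MeasurePreserving T P P) (k : ℤ) :
    MeasurePreserving (⇑(T.toEquiv ^ k)) P P := by
  induction k using Int.induction_on with
  | zero => simpa using MeasurePreserving.id P
  | succ n ih =>
    have : ⇑(T.toEquiv ^ ((n : ℤ) + 1)) = ⇑(T.toEquiv ^ (n : ℤ)) ∘ T := by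
      rw [zpow_add_one, Equiv.Perm.coe_mul]; rfl
    rw [this]; exact ih.comp hT
  | pred n ih =>
    have : ⇑(T.toEquiv ^ (-(n : ℤ) - 1)) = ⇑(T.toEquiv ^ (-(n : ℤ))) ∘ T.symm := by
      rw [zpow_sub_one, Equiv.Perm.coe_mul]; rfl
    rw [this]; exact ih.comp hT.symm

theorem zpow_add_apply (j k : ℤ) (x : X) :
    (T.toEquiv ^ (k + j)) x = (T.toEquiv ^ k) ((T.toEquiv ^ j) x) := by
  rw [zpow_add, Equiv.Perm.mul_apply]

theorem zpow_add_one_apply (k : ℤ) (x : X) :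
    (T.toEquiv ^ (k + 1)) x = T ((T.toEquiv ^ k) x) := by
  rw [add_comm, zpow_add_apply, zpow_one]; rfl

/-- The set where some truncated average exceeds `l`. -/
def truncMaxSet {ι : Type*} (T : X ≃ᵐ X) (u : ι → ℤ → ℝ) (J : Finset ι) (N : ℕ) (F : X → ℝ) (l : ℝ) :
    Set X :=
  {x | ∃ n ∈ J, l < ∑ k ∈ Finset.Icc (-(N : ℤ)) N, F ((T.toEquiv ^ k) x) * u n k}

theorem measurableSet_truncMaxSet {ι : Type*} (hT : MeasurePreserving T P P) (u : ι → ℤ → ℝ)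
    (J : Finset ι) (N : ℕ) {F : X → ℝ} (hF : Measurable F) (l : ℝ) :
    MeasurableSet (truncMaxSet T u J N F l) := by
  have : truncMaxSet T u J N F l = ⋃ n ∈ J,
      {x | l < ∑ k ∈ Finset.Icc (-(N : ℤ)) N, F ((T.toEquiv ^ k) x) * u n k} := by
    ext x; simp [truncMaxSet]
  rw [this]
  refine Finset.measurableSet_biUnion J fun n _ => measurableSet_lt measurable_const ?_
  exact Finset.measurable_sum _ fun k _ =>
    (hF.comp (measurePreserving_zpow hT k).measurable).mul_const _

/-- Calderón transference. Along an orbit, the averages based at 0, …, Q-1 with truncation N see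
only times in [-N, Q+N], so the inequality on ℤ applies to this segment. Integrating gives the claim
with Q + 2N + 1 in place of Q on the right; the excess disappears as Q grows. -/
theorem measureReal_truncMaxSet_le [IsProbabilityMeasure P] {ι : Type*}
    (hT : MeasurePreserving T P P) {u : ι → ℤ → ℝ} (hu0 : ∀ n k, 0 ≤ u n k) {l D : ℝ}
    (hweak : ∀ (a : ℤ → ℝ), (∀ k, 0 ≤ a k) → ∀ (F : Finset ℤ), (∀ k, k ∉ F → a k = 0) →
      ∀ E : Finset ℤ, (∀ j ∈ E, ∃ n, 3 * l < ∑ i ∈ F, a i * u n (i - j)) →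
        l * (E.card : ℝ) ≤ D * ∑ k ∈ F, a k)
    (J : Finset ι) (N : ℕ) {F : X → ℝ} (hF : Measurable F) (hF0 : ∀ x, 0 ≤ F x)
    (hFi : Integrable F P) :
    l * P.real (truncMaxSet T u J N F (3 * l)) ≤ D * ∫ x, F x ∂P := by
  classical
  set M := truncMaxSet T u J N F (3 * l) with hM
  have hMm : MeasurableSet M := measurableSet_truncMaxSet hT u J N hF _
  set I := ∫ x, F x ∂P with hI
  have hI0 : 0 ≤ I := integral_nonneg hF0
  have hFk : ∀ k : ℤ, Integrable (fun x => F ((T.toEquiv ^ k) x)) P := fun k =>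
    (measurePreserving_zpow hT k).integrable_comp_of_integrable hFi
  have hFkI : ∀ k : ℤ, ∫ x, F ((T.toEquiv ^ k) x) ∂P = I := fun k => by
    have h1 := integral_map (μ := P) (measurePreserving_zpow hT k).measurable.aemeasurable
      (f := F) (by rw [(measurePreserving_zpow hT k).map_eq]; exact hFi.aestronglyMeasurable)
    rw [(measurePreserving_zpow hT k).map_eq] at h1
    exact h1.symm
  have hMk : ∀ k : ℤ, Integrable (fun x => M.indicator (fun _ => (1 : ℝ)) ((T.toEquiv ^ k) x)) P :=
    fun k => (measurePreserving_zpow hT k).integrable_comp_of_integrable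
      ((integrable_const 1).indicator hMm)
  have hMkI : ∀ k : ℤ, ∫ x, M.indicator (fun _ => (1 : ℝ)) ((T.toEquiv ^ k) x) ∂P = P.real M :=
    fun k => by
      have h1 := integral_map (μ := P) (measurePreserving_zpow hT k).measurable.aemeasurable
        (f := M.indicator fun _ => (1 : ℝ))
        ((stronglyMeasurable_const.indicator hMm).aestronglyMeasurable)
      rw [(measurePreserving_zpow hT k).map_eq] at h1
      rw [← h1, integral_indicator_const _ hMm]; simp
  have hQ : ∀ Q : ℕ, l * (Q * P.real M) ≤ D * ((Q + 2 * N + 1) * I) := by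
    intro Q
    have hpt : ∀ x, l * ∑ j ∈ Finset.Ico (0 : ℤ) Q, M.indicator (fun _ => (1 : ℝ)) ((T.toEquiv ^ j) x)
        ≤ D * ∑ i ∈ Finset.Icc (-(N : ℤ)) (Q + N), F ((T.toEquiv ^ i) x) := by
      intro x
      set R := Finset.Icc (-(N : ℤ)) (Q + N) with hR
      set a : ℤ → ℝ := fun i => if i ∈ R then F ((T.toEquiv ^ i) x) else 0 with ha
      have ha0 : ∀ i, 0 ≤ a i := fun i => by
        simp only [ha]; split_ifs
        · exact hF0 _
        · exact le_rfl
      set E := (Finset.Ico (0 : ℤ) Q).filter fun j => (T.toEquiv ^ j) x ∈ M with hE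
      have h1 := hweak a ha0 R (fun k hk => by simp only [ha, if_neg hk]) E fun j hj => by
        obtain ⟨hj1, hj2⟩ := Finset.mem_filter.1 hj
        rw [Finset.mem_Ico] at hj1
        obtain ⟨n, -, hn⟩ := hj2
        refine ⟨n, hn.trans_le ?_⟩
        calc ∑ k ∈ Finset.Icc (-(N : ℤ)) N, F ((T.toEquiv ^ k) ((T.toEquiv ^ j) x)) * u n k
            = ∑ i ∈ (Finset.Icc (-(N : ℤ)) N).map (addRightEmbedding j), a i * u n (i - j) := by
              rw [Finset.sum_map]
              refine Finset.sum_congr rfl fun k hk => ?_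
              rw [Finset.mem_Icc] at hk
              have : k + j ∈ R := by rw [hR, Finset.mem_Icc]; omega
              simp only [addRightEmbedding_apply, ha, if_pos this, zpow_add_apply,
                add_sub_cancel_right]
          _ ≤ ∑ i ∈ R, a i * u n (i - j) := by
              refine Finset.sum_le_sum_of_subset_of_nonneg (fun i hi => ?_)
                fun i _ _ => mul_nonneg (ha0 i) (hu0 n _)
              rw [Finset.mem_map] at hi
              obtain ⟨k, hk, rfl⟩ := hi
              rw [Finset.mem_Icc] at hk
              rw [hR, Finset.mem_Icc, addRightEmbedding_apply]; omega
      have h2 : (E.card : ℝ)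
          = ∑ j ∈ Finset.Ico (0 : ℤ) Q, M.indicator (fun _ => (1 : ℝ)) ((T.toEquiv ^ j) x) := by
        rw [hE, Finset.card_filter]
        push_cast
        refine Finset.sum_congr rfl fun j _ => ?_
        rw [Set.indicator_apply]
      have h3 : ∑ k ∈ R, a k = ∑ i ∈ R, F ((T.toEquiv ^ i) x) :=
        Finset.sum_congr rfl fun i hi => by simp only [ha, if_pos hi]
      rw [← h2, ← h3]; exact h1
    have hint := integral_mono ((integrable_finsetSum _ fun j _ => hMk j).const_mul l)
      ((integrable_finsetSum _ fun i _ => hFk i).const_mul D) hpt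
    rw [integral_const_mul, integral_const_mul, integral_finsetSum _ fun j _ => hMk j,
      integral_finsetSum _ fun i _ => hFk i] at hint
    simp only [hMkI, hFkI, Finset.sum_const, nsmul_eq_mul, Int.card_Ico, Int.card_Icc] at hint
    have e1 : (((Q : ℤ) - 0).toNat : ℝ) = Q := by simp
    have e2 : (((Q : ℤ) + N + 1 - -(N : ℤ)).toNat : ℝ) = Q + 2 * N + 1 := by
      have : ((Q : ℤ) + N + 1 - -(N : ℤ)).toNat = Q + 2 * N + 1 := by omega
      rw [this]; push_cast; ring
    rwa [e1, e2] at hint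
  by_contra hc
  push Not at hc
  obtain ⟨Q, hQ'⟩ := exists_nat_gt (D * ((2 * N + 1) * I) / (l * P.real M - D * I))
  rw [div_lt_iff₀ (by linarith)] at hQ'
  have := hQ Q
  nlinarith

theorem measure_max_le [IsProbabilityMeasure P] (hT : MeasurePreserving T P P)
    {u : ℕ → ℤ → ℝ} (hu0 : ∀ n k, 0 ≤ u n k) {l D : ℝ} (hl : 0 < l)
    (hweak : ∀ (a : ℤ → ℝ), (∀ k, 0 ≤ a k) → ∀ (F : Finset ℤ), (∀ k, k ∉ F → a k = 0) →
      ∀ E : Finset ℤ, (∀ j ∈ E, ∃ n, 3 * l < ∑ i ∈ F, a i * u n (i - j)) →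
        l * (E.card : ℝ) ≤ D * ∑ k ∈ F, a k)
    {F : X → ℝ} (hF : Measurable F) (hF0 : ∀ x, 0 ≤ F x) (hFi : Integrable F P) :
    P {x | ∃ n, Summable (fun k : ℤ => F ((T.toEquiv ^ k) x) * u n k) ∧
      3 * l < ∑' k : ℤ, F ((T.toEquiv ^ k) x) * u n k} ≤ ENNReal.ofReal (D / l * ∫ x, F x ∂P) := by
  set M : ℕ → Set X := fun N => truncMaxSet T u (Finset.range (N + 1)) N F (3 * l) with hM
  have hmono : Monotone M := by
    refine monotone_nat_of_le_succ fun N x hx => ?_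
    obtain ⟨n, hn, h⟩ := hx
    refine ⟨n, Finset.range_mono (Nat.le_succ _) hn, h.trans_le ?_⟩
    refine Finset.sum_le_sum_of_subset_of_nonneg (Finset.Icc_subset_Icc (by push_cast; omega)
      (by push_cast; omega)) fun k _ _ => mul_nonneg (hF0 _) (hu0 _ _)
  have hsub : {x | ∃ n, Summable (fun k : ℤ => F ((T.toEquiv ^ k) x) * u n k) ∧
      3 * l < ∑' k : ℤ, F ((T.toEquiv ^ k) x) * u n k} ⊆ ⋃ N, M N := by
    rintro x ⟨n, hs, hlt⟩
    -- A strict inequality for the full sum already holds for a finite partial sum, so the truncated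
    -- sets exhaust the maximal set.
    obtain ⟨S, hS⟩ := ((hs.hasSum.eventually (lt_mem_nhds hlt))).exists
    obtain ⟨B, hB⟩ : ∃ B : ℕ, ∀ k ∈ S, |k| ≤ B := by
      refine ⟨∑ k ∈ S, k.natAbs, fun k hk => ?_⟩
      rw [Int.abs_eq_natAbs]
      exact_mod_cast Finset.single_le_sum (f := fun k : ℤ => k.natAbs) (fun _ _ => Nat.zero_le _) hk
    refine Set.mem_iUnion.2 ⟨max n B, n, by simp, hS.trans_le ?_⟩
    refine Finset.sum_le_sum_of_subset_of_nonneg (fun k hk => ?_)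
      fun k _ _ => mul_nonneg (hF0 _) (hu0 _ _)
    have := abs_le.1 (hB k hk)
    rw [Finset.mem_Icc]; push_cast
    omega
  refine (measure_mono hsub).trans ?_
  rw [hmono.measure_iUnion]
  refine iSup_le fun N => ?_
  have h1 := measureReal_truncMaxSet_le hT hu0 hweak (Finset.range (N + 1)) N hF hF0 hFi
  rw [← ENNReal.ofReal_toReal (measure_ne_top P (M N))]
  refine ENNReal.ofReal_le_ofReal ?_
  rw [div_mul_eq_mul_div, le_div_iff₀ hl, mul_comm]
  exact h1

/-! ### A dense class -/

variable {𝕜 : Type*} [RCLike 𝕜]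

/-- The hypothesis says ⟨Ug, g⟩ = ‖g‖²; expanding ‖Ug - g‖² with ‖Ug‖ = ‖g‖ gives zero. -/
theorem isometry_fixed_of_orthogonal {H : Type*} [NormedAddCommGroup H] [InnerProductSpace 𝕜 H]
    (U : H →ₗᵢ[𝕜] H) {g : H} (hg : inner 𝕜 (U g - g) g = 0) : U g = g := by
  rw [← sub_eq_zero, ← norm_eq_zero, ← sq_eq_zero_iff]
  have h1 := norm_sub_sq (𝕜 := 𝕜) (U g) g
  rw [inner_sub_left, sub_eq_zero] at hg
  rw [h1, hg, inner_self_eq_norm_sq, U.norm_map]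
  ring

/-- Approximate f in L¹ by a simple function, split it in L² into the closed range of U - 1 and its
orthogonal complement, which consists of U-fixed vectors, then approximate the coboundary generator
by a simple, hence bounded, function. On a probability space the L² errors bound the L¹ errors;
there are four, of size ε/4. -/
theorem exists_decomposition [IsProbabilityMeasure P] (hT : MeasurePreserving T P P) {f : X → 𝕜}
    (hf : Integrable f P) {ε : ℝ} (hε : 0 < ε) :
    ∃ (g : X → 𝕜) (h : SimpleFunc X 𝕜), StronglyMeasurable g ∧ Integrable g P ∧
      (∀ᵐ x ∂P, g (T x) = g x) ∧
      ∫ x, ‖f x - g x - (h x - h (T x))‖ ∂P ≤ ε := by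
  set η : ENNReal := ENNReal.ofReal (ε / 4) with hη
  have hη0 : η ≠ 0 := by rw [hη]; simp; positivity
  obtain ⟨s, hs, -⟩ := (memLp_one_iff_integrable.2 hf).exists_simpleFunc_eLpNorm_sub_lt
    ENNReal.one_ne_top hη0
  have hs2 : MemLp s 2 P := s.memLp_of_isFiniteMeasure 2 P
  set F := hs2.toLp s with hF
  set U := Lp.compMeasurePreservingₗᵢ (E := 𝕜) (p := 2) 𝕜 T hT with hU
  set V := (LinearMap.range (U.toLinearMap - LinearMap.id)).topologicalClosure with hV
  obtain ⟨R, hR, G, hG, hFRG⟩ := V.exists_add_mem_mem_orthogonal F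
  have hUG : U G = G := by
    refine isometry_fixed_of_orthogonal U ?_
    refine (Submodule.mem_orthogonal V G).1 hG _ (Submodule.le_topologicalClosure _ ?_)
    exact ⟨G, rfl⟩
  have hR' : R ∈ closure (LinearMap.range (U.toLinearMap - LinearMap.id) : Set (Lp 𝕜 2 P)) := hR
  obtain ⟨_, ⟨H, rfl⟩, hH⟩ := Metric.mem_closure_iff.1 hR' (ε / 4) (by positivity)
  obtain ⟨h, hh, -⟩ := (Lp.memLp H).exists_simpleFunc_eLpNorm_sub_lt ENNReal.ofNat_ne_top hη0
  have hGT : (fun x => G (T x)) =ᵐ[P] G := by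
    have h1 := Lp.coeFn_compMeasurePreserving G hT
    have h2 : Lp.compMeasurePreserving T hT G = G := hUG
    rw [h2] at h1
    exact h1.symm
  have hGi : Integrable G P := (Lp.memLp G).integrable (by norm_num)
  -- The sign turns UH - H into the form h - h ∘ T.
  refine ⟨G, -h, Lp.stronglyMeasurable G, hGi, hGT, ?_⟩
  have hsmall : eLpNorm (⇑(R - (U H - H))) 2 P ≤ η := by
    have h1 : ‖R - (U H - H)‖ < ε / 4 := by rw [← dist_eq_norm]; exact hH
    rw [← Lp.enorm_def, ← ofReal_norm, hη]
    exact ENNReal.ofReal_le_ofReal h1.le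
  have e : (fun x => f x - G x - ((-h) x - (-h) (T x))) =ᵐ[P]
      (f - ⇑s) + (⇑(R - (U H - H)) + ((fun x => (⇑H - ⇑h) (T x)) - (⇑H - ⇑h))) := by
    have a1 := hs2.coeFn_toLp
    have a2 := Lp.coeFn_add R G
    have a3 := Lp.coeFn_sub R (U H - H)
    have a4 := Lp.coeFn_sub (U H) H
    have a5 : ⇑(U H) =ᵐ[P] ⇑H ∘ T := Lp.coeFn_compMeasurePreserving H hT
    rw [← hF, hFRG] at a1
    filter_upwards [a1, a2, a3, a4, a5] with x b1 b2 b3 b4 b5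
    simp only [Pi.add_apply, Pi.sub_apply, Function.comp_apply] at *
    rw [b3, b4, b5, ← b1, b2, SimpleFunc.coe_neg]
    simp only [Pi.neg_apply]
    ring
  have m1 : AEStronglyMeasurable (f - ⇑s) P := hf.1.sub s.aestronglyMeasurable
  have m2 : AEStronglyMeasurable (⇑(R - (U H - H))) P := Lp.aestronglyMeasurable _
  have m3 : AEStronglyMeasurable (⇑H - ⇑h) P := (Lp.aestronglyMeasurable _).sub h.aestronglyMeasurable
  have m4 : AEStronglyMeasurable (fun x => (⇑H - ⇑h) (T x)) P := m3.comp_measurePreserving hT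
  have n3 : eLpNorm (⇑H - ⇑h) 1 P ≤ η :=
    (eLpNorm_le_eLpNorm_of_exponent_le (by norm_num) m3).trans hh.le
  have n4 : eLpNorm (fun x => (⇑H - ⇑h) (T x)) 1 P ≤ η := by
    have := eLpNorm_comp_measurePreserving (p := 1) m3 hT
    exact (le_of_eq this).trans n3
  have n2 : eLpNorm (⇑(R - (U H - H))) 1 P ≤ η :=
    (eLpNorm_le_eLpNorm_of_exponent_le (by norm_num) m2).trans hsmall
  have ntot : eLpNorm (fun x => f x - G x - ((-h) x - (-h) (T x))) 1 P ≤ ENNReal.ofReal ε := by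
    rw [eLpNorm_congr_ae e]
    refine (eLpNorm_add_le m1 (m2.add (m4.sub m3)) le_rfl).trans ?_
    refine (add_le_add hs.le ((eLpNorm_add_le m2 (m4.sub m3) le_rfl).trans
      (add_le_add n2 ((eLpNorm_sub_le m4 m3 le_rfl).trans (add_le_add n4 n3))))).trans ?_
    rw [hη, ← ENNReal.ofReal_add (by positivity) (by positivity),
      ← ENNReal.ofReal_add (by positivity) (by positivity),
      ← ENNReal.ofReal_add (by positivity) (by positivity)]
    exact ENNReal.ofReal_le_ofReal (by linarith)
  have mtot : AEStronglyMeasurable (fun x => f x - G x - ((-h) x - (-h) (T x))) P :=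
    (m1.add (m2.add (m4.sub m3))).congr e.symm
  rw [integral_norm_eq_lintegral_enorm mtot, ← eLpNorm_one_eq_lintegral_enorm]
  exact ENNReal.toReal_le_of_le_ofReal hε.le ntot

theorem ae_forall_zpow (hT : MeasurePreserving T P P) {p : X → Prop} (hp : ∀ᵐ x ∂P, p x) :
    ∀ᵐ x ∂P, ∀ k : ℤ, p ((T.toEquiv ^ k) x) :=
  ae_all_iff.2 fun k => (measurePreserving_zpow hT k).quasiMeasurePreserving.ae hp

/-- Tonelli: the absolute series integrates to ‖μⁿ‖₁ ‖f‖₁, since each T^k preserves the measure. -/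
theorem ae_summable_term (hT : MeasurePreserving T P P) {f : X → 𝕜} (hf : Integrable f P) :
    ∀ᵐ x ∂P, ∀ n, Summable (term μ T.toEquiv f n x) := by
  refine ae_all_iff.2 fun n => ?_
  have hk : ∀ k : ℤ, AEStronglyMeasurable (fun x => f ((T.toEquiv ^ k) x)) P := fun k =>
    hf.1.comp_measurePreserving (measurePreserving_zpow hT k)
  have hkI : ∀ k : ℤ, ∫⁻ x, ‖f ((T.toEquiv ^ k) x)‖ₑ ∂P = ∫⁻ x, ‖f x‖ₑ ∂P := fun k => by
    rw [← eLpNorm_one_eq_lintegral_enorm, ← eLpNorm_one_eq_lintegral_enorm]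
    exact eLpNorm_comp_measurePreserving hf.1 (measurePreserving_zpow hT k)
  have hu : ∑' k, ‖power μ n k‖ₑ ≠ ⊤ := by
    rw [tsum_enorm_ne_top_iff_summable_norm]
    exact (summable_power μ n).norm
  have hterm : ∀ k, AEMeasurable (fun x => ‖term μ T.toEquiv f n x k‖ₑ) P := fun k =>
    ((hk k).const_mul _).enorm
  have htot : ∫⁻ x, ∑' k, ‖term μ T.toEquiv f n x k‖ₑ ∂P ≠ ⊤ := by
    rw [lintegral_tsum hterm]
    have : ∀ k, ∫⁻ x, ‖term μ T.toEquiv f n x k‖ₑ ∂P = ‖power μ n k‖ₑ * ∫⁻ x, ‖f x‖ₑ ∂P := by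
      intro k
      rw [← hkI k, ← lintegral_const_mul'' _ (hk k).enorm]
      refine lintegral_congr fun x => ?_
      rw [term, enorm_mul]
      congr 1
      rw [← ofReal_norm, ← ofReal_norm, RCLike.norm_ofReal, Real.norm_eq_abs]
    simp_rw [this]
    rw [ENNReal.tsum_mul_right]
    exact ENNReal.mul_ne_top hu hf.2.ne
  filter_upwards [ae_lt_top' (AEMeasurable.tsum hterm) htot]
    with x hx
  exact (tsum_enorm_ne_top_iff_summable_norm.1 hx.ne).of_norm

theorem hasSum_term_of_invariant {g : X → 𝕜} {x : X} (hg : ∀ k : ℤ, g ((T.toEquiv ^ k) x) = g x)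
    (n : ℕ) : HasSum (term μ T.toEquiv g n x) (g x) := by
  have h1 : HasSum (fun k => ((power μ n k : ℝ) : 𝕜)) ((1 : ℝ) : 𝕜) := by
    rw [← tsum_power μ n]
    exact (summable_power μ n).hasSum.map (RCLike.ofRealCLM : ℝ →L[ℝ] 𝕜) RCLike.ofRealCLM.continuous
  have h2 := h1.mul_right (g x)
  simp only [RCLike.ofReal_one, one_mul] at h2
  exact h2.congr_fun fun k => by rw [term, hg]

theorem ae_forall_zpow_eq {E : Type*} (hT : MeasurePreserving T P P) {g : X → E}
    (hg : ∀ᵐ x ∂P, g (T x) = g x) : ∀ᵐ x ∂P, ∀ k : ℤ, g ((T.toEquiv ^ k) x) = g x := by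
  filter_upwards [ae_forall_zpow hT hg] with x hx k
  have hs : ∀ k : ℤ, g ((T.toEquiv ^ (k + 1)) x) = g ((T.toEquiv ^ k) x) := fun k => by
    rw [zpow_add_one_apply]; exact hx k
  induction k using Int.induction_on with
  | zero => simp
  | succ n ih => rw [hs, ih]
  | pred n ih => rw [← ih, ← hs, sub_add_cancel]

theorem summable_term_of_bounded {h : X → 𝕜} {B : ℝ} (hB : ∀ x, ‖h x‖ ≤ B) (n : ℕ) (x : X) :
    Summable (term μ T.toEquiv h n x) := by
  refine Summable.of_norm_bounded ((summable_power μ n).abs.mul_right B) fun k => ?_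
  rw [term, norm_mul, RCLike.norm_ofReal]
  exact mul_le_mul_of_nonneg_left (hB _) (abs_nonneg _)

/-- Averages of a bounded coboundary. -/
theorem norm_average_coboundary_le {h : X → 𝕜} {B : ℝ} (hB : ∀ x, ‖h x‖ ≤ B) (n : ℕ) (x : X) :
    ‖average μ T.toEquiv (fun y => h y - h (T y)) n x‖ ≤ (∑' k, |diff (power μ n) k|) * B := by
  have s1 := summable_term_of_bounded (T := T) (μ := μ) hB n x
  have s2 : Summable (term μ T.toEquiv (fun y => h (T y)) n x) :=
    summable_term_of_bounded (h := fun y => h (T y)) (fun y => hB _) n x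
  have e : average μ T.toEquiv (fun y => h y - h (T y)) n x
      = ∑' k, ((diff (power μ n) k : ℝ) : 𝕜) * h ((T.toEquiv ^ (k + 1)) x) := by
    have e0 : average μ T.toEquiv (fun y => h y - h (T y)) n x
        = ∑' k, (term μ T.toEquiv h n x k - term μ T.toEquiv (fun y => h (T y)) n x k) :=
      tsum_congr fun k => by simp only [term]; ring
    -- Summation by parts: shifting the first sum by one moves the difference from h to the kernel.
    rw [e0, s1.tsum_sub s2, ← (Equiv.addRight (1 : ℤ)).tsum_eq (term μ T.toEquiv h n x)]
    refine (Summable.tsum_sub ((Equiv.addRight (1 : ℤ)).summable_iff.2 s1) s2).symm.trans ?_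
    refine tsum_congr fun k => ?_
    simp only [term, diff, Equiv.coe_addRight, Function.comp_apply, zpow_add_one_apply]
    push_cast
    ring
  rw [e]
  refine tsum_of_norm_bounded ((summable_diff (summable_power μ n)).abs.hasSum.mul_right B)
    fun k => ?_
  rw [norm_mul, RCLike.norm_ofReal]
  exact mul_le_mul_of_nonneg_left (hB _) (abs_nonneg _)

/-! ### From the maximal inequality to almost everywhere convergence. -/

/-- The oscillation of the averages exceeds `8 l` infinitely often only on a null set. -/
theorem ae_eventually_oscillation_le [IsProbabilityMeasure P] (hT : MeasurePreserving T P P)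
    {D l : ℝ} (hl : 0 < l)
    (hweak : ∀ (a : ℤ → ℝ), (∀ k, 0 ≤ a k) → ∀ (F : Finset ℤ), (∀ k, k ∉ F → a k = 0) →
      ∀ E : Finset ℤ, (∀ j ∈ E, ∃ n, 3 * l < ∑ i ∈ F, a i * power μ n (i - j)) →
        l * (E.card : ℝ) ≤ D * ∑ k ∈ F, a k)
    (hdiff : Tendsto (fun n => ∑' k, |diff (power μ n) k|) atTop (𝓝 0))
    {f : X → 𝕜} (hfm : StronglyMeasurable f) (hf : Integrable f P) :
    ∀ᵐ x ∂P, ∃ N, ∀ m ≥ N, ∀ n ≥ N,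
      ‖average μ T.toEquiv f m x - average μ T.toEquiv f n x‖ ≤ 8 * l := by
  set Bad := {x | ¬ ∃ N, ∀ m ≥ N, ∀ n ≥ N,
    ‖average μ T.toEquiv f m x - average μ T.toEquiv f n x‖ ≤ 8 * l} with hBad
  have key : ∀ ε : ℝ, 0 < ε → P Bad ≤ ENNReal.ofReal (|D| / l * ε) := by
    intro ε hε
    obtain ⟨g, h, hgm, hgi, hgT, hsmall⟩ := exists_decomposition hT hf hε
    set e : X → 𝕜 := fun x => f x - g x - (h x - h (T x)) with he
    have hem : StronglyMeasurable e := (hfm.sub hgm).sub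
      (h.stronglyMeasurable.sub (h.stronglyMeasurable.comp_measurable T.measurable))
    have hhi : Integrable h P := h.integrable_of_isFiniteMeasure
    have hei : Integrable e P := (hf.sub hgi).sub (hhi.sub (hT.integrable_comp_of_integrable hhi))
    obtain ⟨B, hB⟩ := h.exists_forall_norm_le
    have hmax := measure_max_le hT (power_nonneg μ) hl hweak hem.norm.measurable
      (fun x => norm_nonneg (e x)) hei.norm
    set M := {x | ∃ n, Summable (fun k : ℤ => ‖e ((T.toEquiv ^ k) x)‖ * power μ n k) ∧
      3 * l < ∑' k : ℤ, ‖e ((T.toEquiv ^ k) x)‖ * power μ n k} with hM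
    -- Off M the error averages stay below 3l for every n, the coboundary averages are eventually
    -- below l, and the invariant part does not oscillate: 8l = 2(3l + l).
    have hBM : Bad ≤ᵐ[P] M := by
      filter_upwards [ae_summable_term (μ := μ) hT hei, ae_forall_zpow_eq hT hgT]
        with x hxe hxg hxBad
      by_contra hxM
      refine hxBad ?_
      have hsum : ∀ n, Summable (fun k : ℤ => ‖e ((T.toEquiv ^ k) x)‖ * power μ n k) := fun n =>
        (hxe n).norm.congr fun k => by
          rw [term, norm_mul, RCLike.norm_ofReal, abs_of_nonneg (power_nonneg μ n k), mul_comm]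
      have he3 : ∀ n, ‖average μ T.toEquiv e n x‖ ≤ 3 * l := fun n => by
        have h1 : ∑' k : ℤ, ‖e ((T.toEquiv ^ k) x)‖ * power μ n k ≤ 3 * l := by
          by_contra hc
          exact hxM ⟨n, hsum n, not_le.1 hc⟩
        refine (tsum_of_norm_bounded (hsum n).hasSum fun k => ?_).trans h1
        rw [term, norm_mul, RCLike.norm_ofReal, abs_of_nonneg (power_nonneg μ n k), mul_comm]
      have hdec : ∀ n, average μ T.toEquiv f n x = g x
          + average μ T.toEquiv (fun y => h y - h (T y)) n x + average μ T.toEquiv e n x := fun n => by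
        have s1 := hasSum_term_of_invariant (T := T) (μ := μ) hxg n
        have s2 : Summable (term μ T.toEquiv (fun y => h y - h (T y)) n x) :=
          summable_term_of_bounded (B := B + B)
            (fun y => (norm_sub_le _ _).trans (add_le_add (hB _) (hB _))) n x
        have s3 := (s1.add s2.hasSum).add (hxe n).hasSum
        refine (s3.congr_fun fun k => ?_).tsum_eq
        simp only [term, he]
        ring
      have hlim : Tendsto (fun n => (∑' k, |diff (power μ n) k|) * B) atTop (𝓝 0) := by
        simpa using hdiff.mul_const B
      obtain ⟨N, hN⟩ := eventually_atTop.1 (hlim.eventually (gt_mem_nhds hl))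
      refine ⟨N, fun m hm n hn => ?_⟩
      have c1 := (norm_average_coboundary_le (T := T) (μ := μ) hB m x).trans (hN m hm).le
      have c2 := (norm_average_coboundary_le (T := T) (μ := μ) hB n x).trans (hN n hn).le
      have d1 := he3 m
      have d2 := he3 n
      rw [hdec m, hdec n]
      set A1 := average μ T.toEquiv (fun y => h y - h (T y)) m x
      set A2 := average μ T.toEquiv (fun y => h y - h (T y)) n x
      set E1 := average μ T.toEquiv e m x
      set E2 := average μ T.toEquiv e n x
      have : g x + A1 + E1 - (g x + A2 + E2) = (A1 - A2) + (E1 - E2) := by ring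
      rw [this]
      have t1 := norm_add_le (A1 - A2) (E1 - E2)
      have t2 := norm_sub_le A1 A2
      have t3 := norm_sub_le E1 E2
      linarith
    refine (measure_mono_ae hBM).trans (hmax.trans (ENNReal.ofReal_le_ofReal ?_))
    have hI0 : 0 ≤ ∫ x, ‖e x‖ ∂P := integral_nonneg fun x => norm_nonneg _
    calc D / l * ∫ x, ‖e x‖ ∂P ≤ |D| / l * ∫ x, ‖e x‖ ∂P := by
          gcongr; exact le_abs_self D
      _ ≤ |D| / l * ε := by gcongr
  have hlim : Tendsto (fun ε : ℝ => ENNReal.ofReal (|D| / l * ε)) (𝓝[>] 0) (𝓝 0) := by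
    have : Tendsto (fun ε : ℝ => |D| / l * ε) (𝓝[>] 0) (𝓝 (|D| / l * 0)) :=
      (Continuous.tendsto (by fun_prop) 0).mono_left nhdsWithin_le_nhds
    simpa using ENNReal.tendsto_ofReal this
  have hz : P Bad ≤ 0 := ge_of_tendsto hlim (eventually_nhdsWithin_of_forall fun ε hε => key ε hε)
  exact ae_iff.2 (le_antisymm hz zero_le)

/-- Oscillation bounds for the countably many levels 1/(j+1) give a Cauchy sequence. Passing to a
strongly measurable representative changes no average outside a null set, since whole orbits are
controlled. -/
theorem ae_exists_tendsto_average [IsProbabilityMeasure P] (hT : MeasurePreserving T P P) {D : ℝ}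
    (hweak : ∀ l : ℝ, 0 < l → ∀ (a : ℤ → ℝ), (∀ k, 0 ≤ a k) → ∀ (F : Finset ℤ),
      (∀ k, k ∉ F → a k = 0) →
      ∀ E : Finset ℤ, (∀ j ∈ E, ∃ n, 3 * l < ∑ i ∈ F, a i * power μ n (i - j)) →
        l * (E.card : ℝ) ≤ D * ∑ k ∈ F, a k)
    (hdiff : Tendsto (fun n => ∑' k, |diff (power μ n) k|) atTop (𝓝 0))
    {f : X → 𝕜} (hf : Integrable f P) :
    ∀ᵐ x ∂P, ∃ l : 𝕜, Tendsto (fun n => average μ T.toEquiv f n x) atTop (𝓝 l) := by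
  set f' := hf.1.mk f with hf'
  have hf'i : Integrable f' P := hf.congr hf.1.ae_eq_mk
  have hosc : ∀ᵐ x ∂P, ∀ j : ℕ, ∃ N, ∀ m ≥ N, ∀ n ≥ N,
      ‖average μ T.toEquiv f' m x - average μ T.toEquiv f' n x‖ ≤ 8 * (1 / ((j : ℝ) + 1)) :=
    ae_all_iff.2 fun j => ae_eventually_oscillation_le hT Nat.one_div_pos_of_nat
      (hweak _ Nat.one_div_pos_of_nat) hdiff hf.1.stronglyMeasurable_mk hf'i
  filter_upwards [hosc, ae_forall_zpow hT hf.1.ae_eq_mk] with x hx hfx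
  have hav : ∀ n, average μ T.toEquiv f n x = average μ T.toEquiv f' n x := fun n =>
    tsum_congr fun k => by rw [term, term, hfx k]
  simp_rw [hav]
  refine cauchySeq_tendsto_of_complete (Metric.cauchySeq_iff.2 fun ε hε => ?_)
  obtain ⟨j, hj⟩ := exists_nat_one_div_lt (show (0 : ℝ) < ε / 8 by positivity)
  obtain ⟨N, hN⟩ := hx j
  refine ⟨N, fun m hm n hn => ?_⟩
  rw [dist_eq_norm]
  exact (hN m hm n hn).trans_lt (by linarith)

/-! ### Deriving the quantitative properties of θ from the hypotheses. -/

theorem hasDerivAt_phi (hm : FiniteFirstMoment μ) (t : ℝ) :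
    HasDerivAt (phi μ) (-(deriv (fourier μ) t).re) t := by
  have h := Complex.reCLM.hasFDerivAt.comp_hasDerivAt t
    (hasDerivAt_fourier hm t).differentiableAt.hasDerivAt
  exact h.const_sub 1

theorem continuous_deriv_fourier (hm : FiniteFirstMoment μ) : Continuous (deriv (fourier μ)) := by
  have : deriv (fourier μ) = fun t => 2 * Real.pi * Complex.I * ft (mom (weight μ)) t :=
    funext fun t => (hasDerivAt_fourier hm t).deriv
  rw [this]
  exact continuous_const.mul (continuous_ft (summable_mom_weight hm))

/-- φ' = -Re θ' is increasing on each side of 0 by the sign of Re θ'', and is continuous at 0 by the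
first moment. The two monotone pieces share the point 0 and glue; θ''(0) need not exist. -/
theorem convexOn_phi (hm : FiniteFirstMoment μ) {δ : ℝ} (hδ : 0 < δ)
    (hdiff : ∀ t : ℝ, 0 < |t| → |t| < δ → DifferentiableAt ℝ (deriv (fourier μ)) t)
    (hneg : ∀ t : ℝ, 0 < |t| → |t| < δ → (deriv (deriv (fourier μ)) t).re < 0) :
    ConvexOn ℝ (Set.Ioo (-δ) δ) (phi μ) := by
  set D : ℝ → ℝ := fun t => -(deriv (fourier μ) t).re with hD
  have hDc : Continuous D := (Complex.continuous_re.comp (continuous_deriv_fourier hm)).neg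
  have hDd : ∀ t, 0 < |t| → |t| < δ → HasDerivAt D (-(deriv (deriv (fourier μ)) t).re) t :=
    fun t h0 h1 =>
      (Complex.reCLM.hasFDerivAt.comp_hasDerivAt t (hdiff t h0 h1).hasDerivAt).neg
  have mono : ∀ s : Set ℝ, Convex ℝ s → (∀ t ∈ interior s, 0 < |t| ∧ |t| < δ) → MonotoneOn D s :=
    fun s hs hi => monotoneOn_of_deriv_nonneg hs hDc.continuousOn
      (fun t ht => (hDd t (hi t ht).1 (hi t ht).2).differentiableAt.differentiableWithinAt)
      fun t ht => by
        rw [(hDd t (hi t ht).1 (hi t ht).2).deriv]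
        linarith [hneg t (hi t ht).1 (hi t ht).2]
  have h1 : MonotoneOn D (Set.Ioc (-δ) 0) := mono _ (convex_Ioc _ _) fun t ht => by
    rw [interior_Ioc] at ht
    have := abs_of_neg ht.2
    constructor <;> linarith [ht.1, ht.2]
  have h2 : MonotoneOn D (Set.Ico 0 δ) := mono _ (convex_Ico _ _) fun t ht => by
    rw [interior_Ico] at ht
    have := abs_of_pos ht.1
    constructor <;> linarith [ht.1, ht.2]
  have h3 := h1.union_right h2 (isGreatest_Ioc (by linarith)) (isLeast_Ico hδ)
  rw [Set.Ioc_union_Ico_eq_Ioo (by linarith) hδ] at h3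
  have hderiv : deriv (phi μ) = D := funext fun t => (hasDerivAt_phi hm t).deriv
  refine MonotoneOn.convexOn_of_deriv (convex_Ioo _ _) continuous_phi.continuousOn
    (fun t _ => (hasDerivAt_phi hm t).differentiableAt.differentiableWithinAt) ?_
  rw [interior_Ioo, hderiv]
  exact h3

/-- Equality in the triangle inequality: with z = θ(t) of modulus 1, the nonnegative terms μ(k)(1 -
Re(z̄ e(kt))) sum to 0, so each vanishes. -/
theorem char_eq_fourier_of_norm_ge {t : ℝ} (ht : 1 ≤ ‖fourier μ t‖) {k : ℤ} (hk : 0 < weight μ k) :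
    char k t = fourier μ t := by
  set z := fourier μ t with hz
  have hz1 : ‖z‖ = 1 := by
    refine le_antisymm ?_ ht
    have h := norm_ft_le (summable_weight μ) t
    simp only [abs_of_nonneg (weight_nonneg μ _), (hasSum_weight μ).tsum_eq] at h
    exact h
  have hzz : starRingEnd ℂ z * z = 1 := by
    rw [mul_comm, Complex.mul_conj, Complex.normSq_eq_norm_sq, hz1]; simp
  have hw : ∀ j, ‖starRingEnd ℂ z * char j t‖ = 1 := fun j => by
    rw [norm_mul, norm_char, RCLike.norm_conj, hz1, one_mul]
  have hs : HasSum (fun j => weight μ j * (1 - (starRingEnd ℂ z * char j t).re)) 0 := by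
    have h1 := Complex.hasSum_re
      (((summable_ofReal_mul_char (summable_weight μ) t).hasSum).mul_left (starRingEnd ℂ z))
    have h2 : ∑' j, (weight μ j : ℂ) * char j t = z := rfl
    rw [h2, hzz] at h1
    have h3 := (hasSum_weight μ).sub h1
    simp only [Complex.one_re, sub_self] at h3
    refine h3.congr_fun fun j => ?_
    rw [mul_left_comm, Complex.re_ofReal_mul]; ring
  have h0 := (hasSum_zero_iff_of_nonneg fun j => mul_nonneg (weight_nonneg μ j)
    (by have := (Complex.re_le_norm (starRingEnd ℂ z * char j t)).trans_eq (hw j); linarith)).1 hs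
  have hk0 : weight μ k * (1 - (starRingEnd ℂ z * char k t).re) = 0 := congrFun h0 k
  have hre : (starRingEnd ℂ z * char k t).re = 1 := by
    rcases mul_eq_zero.1 hk0 with h | h <;> linarith
  have him : (starRingEnd ℂ z * char k t).im = 0 := by
    have h1 := Complex.sq_norm (starRingEnd ℂ z * char k t)
    rw [hw k, Complex.normSq_apply, hre] at h1
    nlinarith
  have h1 : starRingEnd ℂ z * char k t = 1 := Complex.ext (by simpa using hre) (by simpa using him)
  calc char k t = (starRingEnd ℂ z * z) * char k t := by rw [hzz, one_mul]
    _ = z * (starRingEnd ℂ z * char k t) := by ring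
    _ = z := by rw [h1, mul_one]

theorem weight_pos_iff {k : ℤ} : 0 < weight μ k ↔ k ∈ μ.support := by
  rw [weight, ENNReal.toReal_pos_iff, PMF.mem_support_iff]
  exact ⟨fun h => h.1.ne', fun h => ⟨pos_iff_ne_zero.2 h, μ.apply_lt_top k⟩⟩

/-- If |θ(t)| = 1, the support lies in one coset of the subgroup of k with e(kt) = 1. This subgroup
is proper, since it contains 1 only for integral t. -/
theorem norm_fourier_lt_one (hap : StrictlyAperiodic μ) {t : ℝ} (ht0 : t ≠ 0) (ht : |t| ≤ 1 / 2) :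
    ‖fourier μ t‖ < 1 := by
  by_contra hc
  have key := fun k hk => char_eq_fourier_of_norm_ge (μ := μ) (not_lt.1 hc) (k := k)
    (weight_pos_iff.2 hk)
  let H : AddSubgroup ℤ :=
    { carrier := {k | char k t = 1}
      zero_mem' := char_zero t
      add_mem' := fun {a b} ha hb => by
        simp only [Set.mem_ofPred_eq] at *
        rw [char_add, ha, hb, one_mul]
      neg_mem' := fun {a} ha => by
        simp only [Set.mem_ofPred_eq] at *
        rw [char_neg, ha, map_one] }
  obtain ⟨a, ha⟩ := μ.support_nonempty
  refine hap H (fun hH => ?_) a fun k hk => ?_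
  · have h1 : (1 : ℤ) ∈ H := hH ▸ AddSubgroup.mem_top 1
    have h2 : char 1 t = 1 := h1
    have h3 := char_re 1 t
    rw [h2, Complex.one_re, Int.cast_one, mul_one] at h3
    have h4 := eight_mul_sq_le_one_sub_cos ht
    rw [← h3] at h4
    have : 0 < t ^ 2 := by positivity
    linarith
  · change char (k - a) t = 1
    rw [char_sub, key k hk, ← key a ha, ← char_sub, sub_self, char_zero]

/-- Fix k ≠ 0 in the support. Where |kt| < 1/2 its single term in φ already dominates t². The rest
of the interval is compact and avoids 0, so φ has a positive minimum there. -/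
theorem exists_mul_sq_le_phi (hap : StrictlyAperiodic μ) :
    ∃ c, 0 < c ∧ ∀ t, |t| ≤ 1 / 2 → c * t ^ 2 ≤ phi μ t := by
  obtain ⟨k, hk0, hk⟩ : ∃ k : ℤ, k ≠ 0 ∧ 0 < weight μ k := by
    by_contra hc
    push Not at hc
    refine hap ⊥ bot_ne_top 0 fun k hk => ?_
    by_contra hk'
    have : k ≠ 0 := fun h => hk' (by simp [h])
    exact absurd (weight_pos_iff.2 hk) (not_lt.2 (hc k this))
  have hk1 : (1 : ℝ) ≤ |(k : ℝ)| := by exact_mod_cast Int.one_le_abs hk0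
  set s : Set ℝ := {t | |t| ≤ 1 / 2} ∩ {t | 1 / 2 ≤ |(k : ℝ) * t|} with hs
  have hsc : IsCompact s := by
    have : {t : ℝ | |t| ≤ 1 / 2} = Set.Icc (-(1 / 2)) (1 / 2) := by ext t; simp [abs_le]
    rw [hs, this]
    exact isCompact_Icc.inter_right (isClosed_le continuous_const (by fun_prop))
  have hsne : s.Nonempty := ⟨1 / 2, by simp [abs_of_pos], by
    simp only [Set.mem_ofPred_eq, abs_mul]
    rw [abs_of_pos (show (0 : ℝ) < 1 / 2 by norm_num)]; linarith⟩
  obtain ⟨t₀, ht₀, hmin⟩ := hsc.exists_isMinOn hsne (continuous_phi (μ := μ)).continuousOn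
  have hpos : 0 < phi μ t₀ := by
    have h0 : t₀ ≠ 0 := by
      rintro rfl
      have := ht₀.2
      norm_num at this
    have h1 := norm_fourier_lt_one hap h0 ht₀.1
    have h2 := Complex.re_le_norm (fourier μ t₀)
    unfold phi; linarith
  refine ⟨min (8 * weight μ k) (4 * phi μ t₀), by positivity, fun t ht => ?_⟩
  have ht2 : t ^ 2 ≤ 1 / 4 := by
    have := (sq_le_sq₀ (abs_nonneg t) (by norm_num)).2 ht
    rw [sq_abs] at this
    linarith
  rcases le_or_gt (1 / 2) |(k : ℝ) * t| with h | h
  · have h1 : phi μ t₀ ≤ phi μ t := hmin ⟨ht, h⟩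
    calc min (8 * weight μ k) (4 * phi μ t₀) * t ^ 2 ≤ 4 * phi μ t₀ * t ^ 2 := by
          gcongr; exact min_le_right _ _
      _ ≤ phi μ t := by nlinarith
  · have h1 := eight_mul_sq_le_one_sub_cos h.le
    have h2 := le_hasSum (hasSum_phi (μ := μ) t) k fun j _ => phi_term_nonneg j t
    have h3 : t ^ 2 ≤ (k * t) ^ 2 := by
      rw [mul_pow, ← sq_abs (k : ℝ)]
      exact le_mul_of_one_le_left (sq_nonneg t) (one_le_pow₀ hk1)
    rw [← mul_assoc] at h1
    calc min (8 * weight μ k) (4 * phi μ t₀) * t ^ 2 ≤ 8 * weight μ k * (k * t) ^ 2 := by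
          gcongr; exact min_le_left _ _
      _ = weight μ k * (8 * (k * t) ^ 2) := by ring
      _ ≤ weight μ k * (1 - Real.cos (2 * Real.pi * k * t)) := by gcongr
      _ ≤ phi μ t := h2

theorem exists_angular_ratio (hang : BoundedAngularRatio μ) :
    ∃ K, 1 ≤ K ∧ ∀ t, |t| ≤ 1 / 2 → ‖fourier μ t - 1‖ ≤ K * (1 - ‖fourier μ t‖) := by
  obtain ⟨hap, B, hB⟩ := hang
  refine ⟨max B 1, le_max_right _ _, fun t ht => ?_⟩
  have half : ∀ t : ℝ, t ∈ Set.Ico (-(1 / 2) : ℝ) (1 / 2) →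
      ‖fourier μ t - 1‖ ≤ max B 1 * (1 - ‖fourier μ t‖) := by
    intro t ht
    rcases eq_or_ne t 0 with rfl | h0
    · have h1 : fourier μ 0 = 1 := by
        have h := ft_power μ 1 0
        rw [pow_one] at h
        rw [← h]
        unfold ft
        simp only [char_at_zero, mul_one, ← Complex.ofReal_tsum, tsum_power, Complex.ofReal_one]
      rw [h1]; simp
    · have hlt := norm_fourier_lt_one hap h0 (abs_le.2 ⟨ht.1, ht.2.le⟩)
      have h1 := hB ⟨t, ⟨ht, h0⟩, rfl⟩
      simp only at h1
      rw [div_le_iff₀ (by linarith)] at h1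
      refine h1.trans (mul_le_mul_of_nonneg_right (le_max_left _ _) (by linarith))
  obtain ⟨h1, h2⟩ := abs_le.1 ht
  -- The endpoint 1/2 is outside the half-open interval of the hypothesis and is reached from -1/2
  -- by conjugation.
  rcases h2.lt_or_eq with h | h
  · exact half t ⟨h1, h⟩
  · have e : fourier μ (-t) = starRingEnd ℂ (fourier μ t) := by
      rw [fourier_eq_ft, ft_neg_arg]
    have h3 := half (-t) ⟨by linarith, by linarith⟩
    rw [e, RCLike.norm_conj] at h3
    have h4 : starRingEnd ℂ (fourier μ t) - 1 = starRingEnd ℂ (fourier μ t - 1) := by simp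
    rwa [h4, RCLike.norm_conj] at h3

theorem exists_regular (hm : FiniteFirstMoment μ) (hang : BoundedAngularRatio μ) {δ : ℝ}
    (hδ : 0 < δ)
    (hdiff : ∀ t : ℝ, 0 < |t| → |t| < δ → DifferentiableAt ℝ (deriv (fourier μ)) t)
    (hneg : ∀ t : ℝ, 0 < |t| → |t| < δ → (deriv (deriv (fourier μ)) t).re < 0) :
    ∃ δ' K c, Regular μ δ' K c := by
  obtain ⟨c, hc, hlow⟩ := exists_mul_sq_le_phi hang.1
  obtain ⟨K, hK, hKt⟩ := exists_angular_ratio hang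
  have hK0 : 0 < K := by linarith
  have hδm : min δ (1 / 2) ≤ δ := min_le_left _ _
  refine ⟨min δ (1 / 2), K, c, hm, ?_, by positivity, min_le_right _ _, hK0, hc, ?_, ?_, hlow⟩
  · exact (convexOn_phi hm hδ hdiff hneg).subset
      (Set.Ioo_subset_Ioo (by linarith) hδm) (convex_Ioo _ _)
  · intro t ht
    refine (hKt t ht).trans (mul_le_mul_of_nonneg_left ?_ hK0.le)
    have := Complex.re_le_norm (fourier μ t)
    unfold phi; linarith
  -- The angular ratio gives φ/K ≤ |θ - 1|/K ≤ 1 - |θ|, and 1 - y ≤ exp(-y).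
  · intro t ht
    have h1 : phi μ t ≤ ‖fourier μ t - 1‖ := by
      have h := Complex.re_le_norm (1 - fourier μ t)
      rw [norm_sub_rev, Complex.sub_re, Complex.one_re] at h
      exact h
    have h2 : phi μ t / K ≤ 1 - ‖fourier μ t‖ := by
      rw [div_le_iff₀ hK0, mul_comm]; exact h1.trans (hKt t ht)
    have h3 := Real.add_one_le_exp (-(phi μ t / K))
    linarith

end ConvPow

/-! ### The convergence theorem. -/

theorem theorem2p1 (μ : PMF ℤ)
    (hm : ConvPow.FiniteFirstMoment μ)
    (hang : ConvPow.BoundedAngularRatio μ)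
    (α : ℝ) (hα0 : 0 < α) (hα1 : α ≤ 1)
    (htrunc : ConvPow.truncSecondMoment μ =O[atTop] fun n : ℕ => (n : ℝ) ^ (1 - α))
    (δ : ℝ) (hδ : 0 < δ)
    (hdiff : ∀ t : ℝ, 0 < |t| → |t| < δ → DifferentiableAt ℝ (deriv (ConvPow.fourier μ)) t)
    (p : ℝ → ℝ) (hp : MonotoneOn p (Set.Ioo 0 δ))
    (hO : ∃ C : ℝ, ∀ t : ℝ, 0 < |t| → |t| < δ →
      |(deriv (deriv (ConvPow.fourier μ)) t).re - p t| ≤ C)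
    (hneg : ∀ t : ℝ, 0 < |t| → |t| < δ → (deriv (deriv (ConvPow.fourier μ)) t).re < 0)
    {X : Type*} [MeasurableSpace X] (P : Measure X) [IsProbabilityMeasure P]
    (T : X ≃ᵐ X) (hT : MeasurePreserving T P P)
    {𝕜 : Type*} [RCLike 𝕜] (f : X → 𝕜) (hf : Integrable f P) :
    ∀ᵐ x ∂P,
      (∀ n : ℕ, Summable (ConvPow.term μ T.toEquiv f n x)) ∧
      ∃ l : 𝕜, Tendsto (fun n : ℕ => ConvPow.average μ T.toEquiv f n x) atTop (𝓝 l) := by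
  obtain ⟨δ', K, c, hreg⟩ := ConvPow.exists_regular hm hang hδ hdiff hneg
  obtain ⟨C, hC0, hC⟩ := hreg.exists_sq_mul_abs_diff_power_le
  have hconv := ConvPow.ae_exists_tendsto_average (μ := μ) hT (D := 128 * C + 4)
    (fun l hl a ha F hF E hE => ConvPow.weak_type_int (ConvPow.power_nonneg μ)
      (ConvPow.summable_power μ) (fun n => (ConvPow.tsum_power μ n).le) hC0.le hC ha hF hl E hE)
    hreg.tendsto_tsum_abs_diff_power hf
  filter_upwards [ConvPow.ae_summable_term (μ := μ) hT hf, hconv] with x h1 h2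
  exact ⟨h1, h2⟩
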